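/- Let $(G;A,B)$ be a double Lie group: $G$ is a (real, finite-dimensional, second countable, Hausdorff) Lie group, $A,B\subset G$ are closed Lie subgroups, $A\cap B=\{e\}$ and $G=AB$. For $g\in G$ write $g=a_L(g)b_R(g)=b_L(g)a_R(g)$ with $a_L(g),a_R(g)\in A$ and $b_L(g),b_R(g)\in B$. Let $G_A=(G,m_A,A,s_A)$ be the differential groupoid with the multiplication $m_A(b_1a,ab_2)=b_1ab_2$ ($a\in A$, $b_1,b_2\in B$), set of identities $A$ and inverse $s_A(g)=b_L(g)^{-1}a_L(g)$; its left and right projections are $a_L$ and $a_R$, and its left and right fibres are $F_l(g)=a_L(g)B$ and $F_r(g)=Ba_R(g)$. Let $\delta$ be the morphism from $G_A$ to $G_A\times G_A$ with graph $\{(a_1b,ba_2;a_1ba_2):a_1,a_2\in A,\ b\in B\}$ (the transpose of the multiplication relation $m_B$ of $G_B$). Let $\mathcal A(G_A)$ be the space of bidensities, i.e. smooth compactly supported sections $\omega=\lambda\otimes\rho$ of $\Omega^{1/2}(e_L)\otimes\Omega^{1/2}(e_R)$, the tensor product of the bundles of complex half-densities along left and right fibres. For a morphism $h$ from $G_A$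 to a groupoid $\Gamma'$ (here $h=\mathrm{id}$, $\Gamma'=G_A$, or $h=\delta$, $\Gamma'=G_A\times G_A$) with base map $f_h$, let $t_h(x,y)=(x,m_h(x,y))$ be the diffeomorphism from $G_A\times_h\Gamma'=\{(x,y): e_R(x)=f_h(e'_L(y))\}$ onto $G_A*_h\Gamma'=\{(x,z): e_L(x)=f_h(e'_L(z))\}$, where $m_h(x,y)$ is the product of $y$ with the element of $h(x)$ composable with $y$. For a smooth compactly supported half-density $\Psi$ on $\Gamma'$ write the push-forward by $t_h$ of the half-density $\rho(x)\otimes\Psi(y)$ as $\tilde\lambda_x\otimes\Psi_x(z)$, with $\tilde\lambda_x$ a half-density on $T_xF_l(x)$ and $\Psi_x(z)$ a half-density on $T_z\Gamma'$, and put $$(\pi_h(\omega)\Psi)(z)=\int_{F_l(f_h(e'_L(z)))}[\lambda(x)\tilde\lambda_x]\otimes\Psi_x(z).$$ Let $W:G\times G\to G\times G$ be the pentagonal diffeomorphism $$W(s,t)=\bigl(s\,a_L(t)^{-1},\ b_R(s\,a_L(t)^{-1})\,t\bigr),\qquad W^{-1}(s,t)=\bigl(s\,a_L(b_R(s)^{-1}t),\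 b_R(s)^{-1}t\bigr).$$ Then the push-forward of half-densities by $W$ is a (unique) unitary operator on the Hilbert space $L^2(G\times G)=L^2(G)\otimes L^2(G)$ of square integrable half-densities, again denoted by $W$. For every $\omega\in\mathcal A(G_A)$ the operators $\pi_{\mathrm{id}}(\omega)$ and $\pi_\delta(\omega)$ extend uniquely to bounded operators on $L^2(G)$ and on $L^2(G\times G)$, respectively, and $$\pi_\delta(\omega)=W\,(\pi_{\mathrm{id}}(\omega)\otimes I)\,W^*.$$ -/

import Mathlib

open MeasureTheory
open scoped Manifold ContDiff

noncomputable section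

namespace DLG

/-! ### Half-densities

In Mathlib the tangent space `TangentSpace I x` of a manifold modelled on `V` is, as a vector space,
the model space `V` itself, for every point `x`.  So a half-density at `x` is a half-density
on `V`, and a section of the bundle of half-densities is a function into `HalfDensity ι V`.
It is evaluated on frames; `ι` indexes the frames (its cardinality is the dimension of `V`). -/

/-- A (complex valued) half-density on `V`: a function on frames that is multiplied by
`|det L| ^ (1/2)` when a linear map `L` is applied to the frame. -/
structure HalfDensity (ι V : Type*) [AddCommGroup V] [Module ℝ V] where
  toFun : (ι → V) → ℂ
  map_comp' : ∀ (L : V →ₗ[ℝ] V) (v : ι → V),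
    toFun (fun i => L (v i)) = ((Real.sqrt |LinearMap.det L| : ℝ) : ℂ) * toFun v

/-- An element of `Ω^{1/2} V ⊗ Ω^{1/2} V'`, evaluated on pairs of frames. -/
structure BiHalfDensity (ι V ι' V' : Type*) [AddCommGroup V] [Module ℝ V]
    [AddCommGroup V'] [Module ℝ V'] where
  toFun : (ι → V) → (ι' → V') → ℂ
  map_comp_left' : ∀ (L : V →ₗ[ℝ] V) (v : ι → V) (w : ι' → V'),
    toFun (fun i => L (v i)) w = ((Real.sqrt |LinearMap.det L| : ℝ) : ℂ) * toFun v w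
  map_comp_right' : ∀ (L : V' →ₗ[ℝ] V') (v : ι → V) (w : ι' → V'),
    toFun v (fun i => L (w i)) = ((Real.sqrt |LinearMap.det L| : ℝ) : ℂ) * toFun v w

section Linear

variable {ι V ι' V' : Type*} [AddCommGroup V] [Module ℝ V] [AddCommGroup V'] [Module ℝ V']

/-- Pull-back of a half-density by a linear map. -/
def HalfDensity.pull (L : V →ₗ[ℝ] V) (σ : HalfDensity ι V) : HalfDensity ι V where
  toFun v := σ.toFun (fun i => L (v i))
  map_comp' M v := by
    have h1 := σ.map_comp' (L ∘ₗ M) v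
    have h2 := σ.map_comp' L v
    simp only [LinearMap.comp_apply] at h1
    rw [h1, h2, LinearMap.det_comp, abs_mul, Real.sqrt_mul (abs_nonneg _)]
    push_cast
    ring

/-- The half-density on the second space obtained by fixing the frame of the first one. -/
def BiHalfDensity.right (om : BiHalfDensity ι V ι' V') (v : ι → V) : HalfDensity ι' V' where
  toFun w := om.toFun v w
  map_comp' L w := om.map_comp_right' L v w

variable [Fintype ι] [DecidableEq ι] [Fintype ι'] [DecidableEq ι']

/-- The product half-density `σ ⊗ τ` on `V × V'`.  It does not depend on the bases `b`, `b'`: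
see `HalfDensity.prod_apply`. -/
def HalfDensity.prod (b : Module.Basis ι ℝ V) (b' : Module.Basis ι' ℝ V')
    (σ : HalfDensity ι V) (τ : HalfDensity ι' V') : HalfDensity (ι ⊕ ι') (V × V') where
  toFun F := ((Real.sqrt |(b.prod b').det F| : ℝ) : ℂ) * (σ.toFun b * τ.toFun b')
  map_comp' L F := by
    have h : (b.prod b').det (fun i => L (F i)) = LinearMap.det L * (b.prod b').det F :=
      (b.prod b').det_comp L F
    rw [h, abs_mul, Real.sqrt_mul (abs_nonneg _)]
    push_cast
    ring

/-- `(σ ⊗ τ)(v ∧ w) = σ(v) τ(w)` for all frames `v` of `V` and `w` of `V'`. -/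
theorem HalfDensity.prod_apply (b : Module.Basis ι ℝ V) (b' : Module.Basis ι' ℝ V')
    (σ : HalfDensity ι V) (τ : HalfDensity ι' V') (v : ι → V) (w : ι' → V') :
    (HalfDensity.prod b b' σ τ).toFun
      (Sum.elim (fun i => (v i, (0 : V'))) (fun j => ((0 : V), w j))) = σ.toFun v * τ.toFun w := by
  have hv : v = fun i => (b.constr ℝ v) (b i) := by ext i; simp
  have hw : w = fun i => (b'.constr ℝ w) (b' i) := by ext i; simp
  have := Module.Finite.of_basis b
  have := Module.Finite.of_basis b'
  have := Module.Free.of_basis b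
  have := Module.Free.of_basis b'
  have hF : (Sum.elim (fun i => (v i, (0 : V'))) (fun j => ((0 : V), w j))) =
      fun i => ((b.constr ℝ v).prodMap (b'.constr ℝ w)) ((b.prod b') i) := by
    ext i <;> rcases i with i | i <;> simp
  have h1 := σ.map_comp' (b.constr ℝ v) b
  have h2 := τ.map_comp' (b'.constr ℝ w) b'
  rw [← hv] at h1
  rw [← hw] at h2
  rw [hF, HalfDensity.map_comp', h1, h2, LinearMap.det_prodMap, abs_mul,
    Real.sqrt_mul (abs_nonneg _)]
  simp only [HalfDensity.prod, Module.Basis.det_self, abs_one, Real.sqrt_one]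
  push_cast
  ring

end Linear

/-! ### Lie groups: invariant frames, integration of invariant densities -/

/-- The model space `ℝ^d`; also the tangent space at any point of a `d`-dimensional manifold. -/
abbrev E (d : ℕ) := EuclideanSpace ℝ (Fin d)

/-- The linear map underlying a continuous one; used to view a derivative, which is a map between
tangent spaces, as a map of the model space. -/
def onModel {V : Type*} [NormedAddCommGroup V] [NormedSpace ℝ V] (L : V →L[ℝ] V) : V →ₗ[ℝ] V :=
  L.toLinearMap

/-- The standard basis of `ℝ^d`. -/
def stdBasis (d : ℕ) : Module.Basis (Fin d) ℝ (E d) := (EuclideanSpace.basisFun (Fin d) ℝ).toBasis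

section LieGroup

variable (d : ℕ) {H : Type*} [TopologicalSpace H] [ChartedSpace (E d) H] [Group H]

/-- The left-invariant frame `(g X_1, …, g X_d)` of a Lie group, where `(X_1, …, X_d)` is the
standard basis of the tangent space at `1`. -/
def leftFrame (g : H) : Fin d → E d := fun i =>
  (mulInvariantVectorField (I := 𝓡 d) (stdBasis d i : TangentSpace (𝓡 d) (1 : H)) g :
    TangentSpace (𝓡 d) g)

/-- The left-invariant 1-density with the value `1` on the left-invariant frame, written in the
chart `φ` at `1`: at the point `x = φ⁻¹(u)` it takes the coordinate frame, moved to the tangent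
space at `1` by left translation by `x⁻¹`, to the absolute value of its determinant. -/
def densityInChart (H : Type*) [TopologicalSpace H] [ChartedSpace (E d) H] [Group H]
    (u : E d) : ℝ :=
  |LinearMap.det (onModel (V := E d) (mfderiv (𝓡 d) (𝓡 d)
    (fun v : E d => ((extChartAt (𝓡 d) (1 : H)).symm u)⁻¹ * (extChartAt (𝓡 d) (1 : H)).symm v) u))|

variable [MeasurableSpace H]

/-- Integration of the left-invariant 1-density over the domain of the chart at `1`. -/
def chartMeasure (H : Type*) [TopologicalSpace H] [ChartedSpace (E d) H] [Group H]
    [MeasurableSpace H] : Measure H :=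
  Measure.map (extChartAt (𝓡 d) (1 : H)).symm
    (((volume : Measure (E d)).restrict (extChartAt (𝓡 d) (1 : H)).target).withDensity
      (fun u => ENNReal.ofReal (densityInChart d H u)))

/-- Integration over the whole Lie group of the left-invariant 1-density that has the value `1` on
the left-invariant frame.  With `U` the domain of the chart at `1` and
`(c_i)` a dense sequence, the sets `c_i U` cover the group; on each of the
disjoint pieces `c_i U \ ⋃_{j < i} c_j U` the density is integrated in the chart of `c_i U`
that is the left translate of the chart of `U`. This is a left Haar measure. -/
def leftMeasure (H : Type*) [TopologicalSpace H] [ChartedSpace (E d) H] [Group H]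
    [MeasurableSpace H] [SecondCountableTopology H] : Measure H :=
  Measure.sum fun i : ℕ =>
    ((chartMeasure d H).map (fun g => TopologicalSpace.denseSeq H i * g)).restrict
      (disjointed (fun j : ℕ => (fun g => TopologicalSpace.denseSeq H j * g) ''
        (extChartAt (𝓡 d) (1 : H)).source) i)

end LieGroup

/-! ### Double Lie groups -/

instance {G : Type*} [TopologicalSpace G] [Group G] [SecondCountableTopology G] (B : Subgroup G) :
    SecondCountableTopology B :=
  TopologicalSpace.Subtype.secondCountableTopology (B : Set G)

section Double

variable {G : Type*} [TopologicalSpace G] [Group G]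

/-- `(G; A, B)` is a double Lie group: `A` and `B` are closed Lie subgroups (closed subgroups that
are Lie groups, embedded in `G` as submanifolds), `A ∩ B = {e}` and `G = AB`. -/
structure DoubleLieGroup (n p k : ℕ) [ChartedSpace (E n) G] (A B : Subgroup G)
    [ChartedSpace (E p) A] [ChartedSpace (E k) B] : Prop where
  isClosed_left : IsClosed (A : Set G)
  isClosed_right : IsClosed (B : Set G)
  smooth_left : ContMDiff (𝓡 p) (𝓡 n) ∞ (fun a : A => (a : G))
  smooth_right : ContMDiff (𝓡 k) (𝓡 n) ∞ (fun b : B => (b : G))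
  immersive_left : ∀ a : A, Function.Injective (mfderiv (𝓡 p) (𝓡 n) (fun a : A => (a : G)) a)
  immersive_right : ∀ b : B, Function.Injective (mfderiv (𝓡 k) (𝓡 n) (fun b : B => (b : G)) b)
  inf_eq_bot : A ⊓ B = ⊥
  exists_mul : ∀ g : G, ∃ a : A, ∃ b : B, g = a * b

variable {n p k : ℕ} [ChartedSpace (E n) G] {A B : Subgroup G}
    [ChartedSpace (E p) A] [ChartedSpace (E k) B]

namespace DoubleLieGroup

/-- The projections `a_L, b_R, b_L, a_R` with `g = a_L(g) b_R(g) = b_L(g) a_R(g)`. -/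
def aL (D : DoubleLieGroup n p k A B) (g : G) : A := (D.exists_mul g).choose

/-- The projection `b_R`, see `aL`. -/
def bR (D : DoubleLieGroup n p k A B) (g : G) : B := (D.exists_mul g).choose_spec.choose

/-- The projection `b_L`, see `aL`. -/
def bL (D : DoubleLieGroup n p k A B) (g : G) : B := (D.bR g⁻¹)⁻¹

/-- The projection `a_R`, see `aL`. -/
def aR (D : DoubleLieGroup n p k A B) (g : G) : A := (D.aL g⁻¹)⁻¹

theorem aL_mul_bR (D : DoubleLieGroup n p k A B) (g : G) : (D.aL g : G) * D.bR g = g :=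
  (D.exists_mul g).choose_spec.choose_spec.symm

theorem bL_mul_aR (D : DoubleLieGroup n p k A B) (g : G) : (D.bL g : G) * D.aR g = g := by
  have h := D.aL_mul_bR g⁻¹
  simp only [bL, aR, Subgroup.coe_inv]
  rw [← mul_inv_rev, h, inv_inv]

end DoubleLieGroup

end Double

/-! ### The groupoid `G_A` and its morphisms -/

/-- The data `(m, E, s)` of a groupoid on `Γ`: `m z x y` says that `x, y` are composable, with the
product `z`; `units` is the set of identities, `s` is the inverse. -/
structure GroupoidData (Γ : Type*) where
  m : Γ → Γ → Γ → Prop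
  units : Set Γ
  s : Γ → Γ

/-- The left projection `e_L(x) = m(x, s(x))`. -/
def GroupoidData.eL {Γ : Type*} (𝒢 : GroupoidData Γ) (x : Γ) : Γ :=
  haveI : Nonempty Γ := ⟨x⟩
  Classical.epsilon fun e => 𝒢.m e x (𝒢.s x)

/-- The Cartesian product of two groupoids. -/
def GroupoidData.prod {Γ Γ' : Type*} (𝒢 : GroupoidData Γ) (𝒢' : GroupoidData Γ') :
    GroupoidData (Γ × Γ') where
  m z x y := 𝒢.m z.1 x.1 y.1 ∧ 𝒢'.m z.2 x.2 y.2
  units := 𝒢.units ×ˢ 𝒢'.units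
  s x := (𝒢.s x.1, 𝒢'.s x.2)

section Groupoid

variable {G : Type*} [TopologicalSpace G] [Group G]
  {n p k : ℕ} [ChartedSpace (E n) G] {A B : Subgroup G}
  [ChartedSpace (E p) A] [ChartedSpace (E k) B]

/-- The groupoid `G_A = (G, m_A, A, s_A)`, where `m_A(b₁ a, a b₂) = b₁ a b₂` and
`s_A(g) = b_L(g)⁻¹ a_L(g)`. -/
def groupoidA (D : DoubleLieGroup n p k A B) : GroupoidData G where
  m z x y := ∃ (a : A) (b₁ b₂ : B), z = b₁ * a * b₂ ∧ x = b₁ * a ∧ y = a * b₂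
  units := A
  s g := (D.bL g : G)⁻¹ * D.aL g

/-- The multiplication relation of `G_B`: `m_B(a₁ b, b a₂) = a₁ b a₂`. -/
def mulB (A B : Subgroup G) (z x y : G) : Prop :=
  ∃ (b : B) (a₁ a₂ : A), z = a₁ * b * a₂ ∧ x = a₁ * b ∧ y = b * a₂

/-- The morphism `δ = m_B^T` from `G_A` to `G_A × G_A`: `delta A B y x` says that `(y, x)` is in
the graph of `δ`. -/
def delta (A B : Subgroup G) (y : G × G) (x : G) : Prop := mulB A B x y.1 y.2

/-- The base map `f_h` of a morphism `h` from `𝒢` to `𝒢'`, whose graph is `(E × E') ∩ Gr(h^T)`. -/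
def baseMap {Γ' : Type*} (𝒢 : GroupoidData G) (𝒢' : GroupoidData Γ') (h : Γ' → G → Prop)
    (e' : Γ') : G :=
  Classical.epsilon fun e => e ∈ 𝒢.units ∧ e' ∈ 𝒢'.units ∧ h e' e

/-- The second component `y` of `t_h⁻¹(x, z) = (x, y)`, where `t_h(x, y) = (x, m_h(x, y))` and
`m_h(x, y) = m'(h(x), y)` is the product of `y` with the element of `h(x)` composable with `y`. -/
def tInv {Γ' : Type*} (𝒢' : GroupoidData Γ') (h : Γ' → G → Prop) (x : G) (z : Γ') : Γ' :=
  haveI : Nonempty Γ' := ⟨z⟩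
  Classical.epsilon fun y => ∃ x', h x' x ∧ 𝒢'.m z x' y

/-! ### Bidensities and the representation `π_h`

The left fibre of `G_A` through `x` is `F_l(x) = a B` with `a = a_L(x)`, and the right fibre is
`F_r(x) = B a'` with `a' = a_R(x)`.  They are identified with the manifold `B` by `b ↦ a b` and
`b ↦ b a'`, so the tangent spaces of the fibres at `x` are the tangent spaces of `B`
at `b_R(x)` and at `b_L(x)`. -/

/-- A section `ω` of `Ω^{1/2}(e_L) ⊗ Ω^{1/2}(e_R)`: `ω x` is evaluated on pairs of a
frame of `T_{b_R(x)} B` (the tangent space of the left fibre at `x`) and a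
frame of `T_{b_L(x)} B` (the tangent space of the right fibre at `x`). -/
abbrev Bidensity (G : Type*) (k : ℕ) := G → BiHalfDensity (Fin k) (E k) (Fin k) (E k)

/-- The coefficient of a bidensity in the smooth frames of the fibres that come from the
left-invariant frame of `B`. -/
def Bidensity.coeff (D : DoubleLieGroup n p k A B) (om : Bidensity G k) (x : G) : ℂ :=
  (om x).toFun (leftFrame k (D.bR x)) (leftFrame k (D.bL x))

/-- `ω` is in `𝒜(G_A)`: it is smooth and has compact support. -/
def Bidensity.IsTest (D : DoubleLieGroup n p k A B) (om : Bidensity G k) : Prop :=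
  ContMDiff (𝓡 n) 𝓘(ℝ, ℂ) ∞ (om.coeff D) ∧ HasCompactSupport (om.coeff D)

section Representation

variable {Γ' ι V' H' : Type*} [Fintype ι] [DecidableEq ι]
  [NormedAddCommGroup V'] [NormedSpace ℝ V'] [TopologicalSpace H']
  (I' : ModelWithCorners ℝ V' H') [TopologicalSpace Γ'] [ChartedSpace H' Γ']
  (bV' : Module.Basis ι ℝ V')
  (D : DoubleLieGroup n p k A B) (𝒢' : GroupoidData Γ') (h : Γ' → G → Prop)

/-- The point `x = a b` of the left fibre `F_l(a)`, `a = f_h(e'_L(z))`; the pairs `(x, z)` make up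
`G_A *_h Γ'`, which is identified in this way with `B × Γ'`. -/
def fibrePoint (b : B) (z : Γ') : G := baseMap (groupoidA D) 𝒢' h (𝒢'.eL z) * b

/-- The diffeomorphism `t_h⁻¹ : (x, z) ↦ (x, y)` from `G_A *_h Γ'` to `G_A ×_h Γ'`, where the first
manifold is identified with `B × Γ'` by `(b, z) ↦ (f_h(e'_L(z)) b, z)` and the second one by
`(b, y) ↦ (b f_h(e'_L(y)), y)`. -/
def tInvB (q : B × Γ') : B × Γ' :=
  (D.bL (fibrePoint D 𝒢' h q.1 q.2), tInv 𝒢' h (fibrePoint D 𝒢' h q.1 q.2) q.2)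

/-- The derivative of `t_h⁻¹`, from `T_b B × T_z Γ'` to `T_{b'} B × T_y Γ'`. -/
def tInvDeriv (b : B) (z : Γ') : (E k × V') →ₗ[ℝ] (E k × V') :=
  onModel (V := E k × V') (mfderiv ((𝓡 k).prod I') ((𝓡 k).prod I') (tInvB D 𝒢' h) (b, z))

/-- The integrand `λ(x) λ̃_x ⊗ Ψ_x(z)` of `π_h(ω)Ψ` at `x = a b` in `F_l(a)`, with
`λ̃_x ⊗ Ψ_x(z)` the push-forward by `t_h` of `ρ(x) ⊗ Ψ(y)` and `ω(x) = λ(x) ⊗ ρ(x)`.  As a 1-density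
in `x` it is evaluated on the left-invariant frame `(b X_i)` of `T_b B`, and the result is a
half-density on `T_z Γ'`, evaluated on the frame `w`. -/
def kernel (om : Bidensity G k) (Ψ : Γ' → HalfDensity ι V') (z : Γ') (w : ι → V') (b : B) : ℂ :=
  ((HalfDensity.prod (stdBasis k) bV'
      ((om (fibrePoint D 𝒢' h b z)).right (leftFrame k b))
      (Ψ (tInv 𝒢' h (fibrePoint D 𝒢' h b z) z))).pull (tInvDeriv I' D 𝒢' h b z)).toFun
    (Sum.elim (fun i => (leftFrame k b i, (0 : V'))) (fun j => ((0 : E k), w j)))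

theorem kernel_comp (om : Bidensity G k) (Ψ : Γ' → HalfDensity ι V') (z : Γ') (L : V' →ₗ[ℝ] V')
    (w : ι → V') (b : B) :
    kernel I' bV' D 𝒢' h om Ψ z (fun i => L (w i)) b =
      ((Real.sqrt |LinearMap.det L| : ℝ) : ℂ) * kernel I' bV' D 𝒢' h om Ψ z w b := by
  have := Module.Finite.of_basis bV'
  have := Module.Free.of_basis bV'
  have hF : (Sum.elim (fun i => (leftFrame k b i, (0 : V'))) (fun j => ((0 : E k), L (w j)))) =
      fun i => ((LinearMap.id : E k →ₗ[ℝ] E k).prodMap L)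
        ((Sum.elim (fun i => (leftFrame k b i, (0 : V'))) (fun j => ((0 : E k), w j))) i) := by
    ext i : 1
    rcases i with i | i <;> simp
  unfold kernel
  rw [hF, HalfDensity.map_comp', LinearMap.det_prodMap]
  simp

variable [MeasurableSpace G] [SecondCountableTopology G]

/-- `(π_h(ω)Ψ)(z) = ∫_{F_l(f_h(e'_L(z)))} [λ(x) λ̃_x] ⊗ Ψ_x(z)`. -/
def rep (om : Bidensity G k) (Ψ : Γ' → HalfDensity ι V') (z : Γ') : HalfDensity ι V' where
  toFun w := ∫ b : B, kernel I' bV' D 𝒢' h om Ψ z w b ∂(leftMeasure k B)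
  map_comp' L w := by
    simp only [kernel_comp]
    exact integral_const_mul _ _

end Representation

/-! ### The Hilbert spaces `L²(G)` and `L²(G × G)` of square integrable half-densities

A half-density is determined by its coefficient, that is its value on the left-invariant frame, and
the square of the left-invariant half-density with the value `1` on that
frame is the measure `leftMeasure`. -/

/-- Half-densities (arbitrary sections) on `G`. -/
abbrev Half (G : Type*) (n : ℕ) := G → HalfDensity (Fin n) (E n)

/-- Half-densities (arbitrary sections) on `G × G`. -/
abbrev Half2 (G : Type*) (n : ℕ) := G × G → HalfDensity (Fin n ⊕ Fin n) (E n × E n)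

/-- The value of a half-density on the left-invariant frame of `G`. -/
def coeff (Ψ : Half G n) (z : G) : ℂ := (Ψ z).toFun (leftFrame n z)

/-- The value of a half-density on the left-invariant frame of `G × G`. -/
def coeff2 (Ψ : Half2 G n) (z : G × G) : ℂ :=
  (Ψ z).toFun (Sum.elim (fun i => (leftFrame n z.1 i, (0 : E n)))
    (fun i => ((0 : E n), leftFrame n z.2 i)))

/-- Smooth half-densities with compact support on `G`. -/
def IsTestHalf (Ψ : Half G n) : Prop :=
  ContMDiff (𝓡 n) 𝓘(ℝ, ℂ) ∞ (coeff Ψ) ∧ HasCompactSupport (coeff Ψ)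

/-- Smooth half-densities with compact support on `G × G`. -/
def IsTestHalf2 (Ψ : Half2 G n) : Prop :=
  ContMDiff ((𝓡 n).prod (𝓡 n)) 𝓘(ℝ, ℂ) ∞ (coeff2 Ψ) ∧ HasCompactSupport (coeff2 Ψ)

/-- The pentagonal bijection `W(s, t) = (s a_L(t)⁻¹, b_R(s a_L(t)⁻¹) t)` with the inverse
`W⁻¹(s, t) = (s a_L(b_R(s)⁻¹ t), b_R(s)⁻¹ t)`. -/
def pentagonal (D : DoubleLieGroup n p k A B) : G × G ≃ G × G where
  toFun q := (q.1 * (D.aL q.2 : G)⁻¹, D.bR (q.1 * (D.aL q.2 : G)⁻¹) * q.2)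
  invFun q := (q.1 * D.aL ((D.bR q.1 : G)⁻¹ * q.2), (D.bR q.1 : G)⁻¹ * q.2)
  left_inv q := by simp
  right_inv q := by simp

/-- The push-forward of a half-density on `G × G` by a bijection (a diffeomorphism) `F`, that is
its pull-back by `F⁻¹`. -/
def pushforward (F : G × G ≃ G × G) (Ψ : Half2 G n) : Half2 G n := fun z =>
  (Ψ (F.symm z)).pull
    (onModel (V := E n × E n) (mfderiv ((𝓡 n).prod (𝓡 n)) ((𝓡 n).prod (𝓡 n)) F.symm z))

variable [MeasurableSpace G] [SecondCountableTopology G]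

/-- `L²(G)`: the half-density with coefficient `f` is represented by the class of `f`. -/
abbrev L2 (G : Type*) (n : ℕ) [TopologicalSpace G] [Group G] [ChartedSpace (E n) G]
    [MeasurableSpace G] [SecondCountableTopology G] := Lp ℂ 2 (leftMeasure n G)

/-- `L²(G × G)`: the half-density with coefficient `f` is represented by the class of `f`. -/
abbrev L2x2 (G : Type*) (n : ℕ) [TopologicalSpace G] [Group G] [ChartedSpace (E n) G]
    [MeasurableSpace G] [SecondCountableTopology G] :=
  Lp ℂ 2 ((leftMeasure n G).prod (leftMeasure n G))

/-- `T` is the bounded operator `π_id(ω)` on `L²(G)`, where `id` is the identity morphism of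
`G_A`: it extends `Ψ ↦ π_id(ω)Ψ` from the smooth half-densities with compact support. -/
def IsRepId (D : DoubleLieGroup n p k A B) (om : Bidensity G k) (T : L2 G n →L[ℂ] L2 G n) : Prop :=
  ∀ (Ψ : Half G n) (F : L2 G n), IsTestHalf Ψ → F =ᵐ[leftMeasure n G] coeff Ψ →
    T F =ᵐ[leftMeasure n G]
      coeff (rep (𝓡 n) (stdBasis n) D (groupoidA D) (fun y x => y = x) om Ψ)

/-- `S` is the bounded operator `π_δ(ω)` on `L²(G × G)`: it extends `Ψ ↦ π_δ(ω)Ψ` from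
the smooth half-densities with compact support. -/
def IsRepDelta (D : DoubleLieGroup n p k A B) (om : Bidensity G k)
    (S : L2x2 G n →L[ℂ] L2x2 G n) : Prop :=
  ∀ (Ψ : Half2 G n) (F : L2x2 G n), IsTestHalf2 Ψ →
    F =ᵐ[(leftMeasure n G).prod (leftMeasure n G)] coeff2 Ψ →
    S F =ᵐ[(leftMeasure n G).prod (leftMeasure n G)]
      coeff2 (rep ((𝓡 n).prod (𝓡 n)) ((stdBasis n).prod (stdBasis n)) D
        ((groupoidA D).prod (groupoidA D)) (delta A B) om Ψ)

/-- `R = T ⊗ I` on `L²(G × G) = L²(G) ⊗ L²(G)`: `R (φ ⊗ ψ) = T φ ⊗ ψ`. -/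
def IsTensorOne (T : L2 G n →L[ℂ] L2 G n) (R : L2x2 G n →L[ℂ] L2x2 G n) : Prop :=
  ∀ (φ ψ : L2 G n) (F : L2x2 G n),
    F =ᵐ[(leftMeasure n G).prod (leftMeasure n G)] (fun q => φ q.1 * ψ q.2) →
    R F =ᵐ[(leftMeasure n G).prod (leftMeasure n G)] (fun q => T φ q.1 * ψ q.2)

/-- `U` is the unitary operator on `L²(G × G)` given by the push-forward of half-densities by the
pentagonal diffeomorphism `W`. -/
def IsPentagonalUnitary (D : DoubleLieGroup n p k A B) (U : L2x2 G n →L[ℂ] L2x2 G n) : Prop :=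
  U ∈ unitary (L2x2 G n →L[ℂ] L2x2 G n) ∧
  ∀ (Ψ : Half2 G n) (F : L2x2 G n),
    F =ᵐ[(leftMeasure n G).prod (leftMeasure n G)] coeff2 Ψ →
    U F =ᵐ[(leftMeasure n G).prod (leftMeasure n G)] coeff2 (pushforward (pentagonal D) Ψ)

end Groupoid

end DLG

end

/-! In left-invariant frames a half-density becomes a function, and pulling it back by a
diffeomorphism `F` composes that function with `F` and multiplies it by `√(jac F)`
(`HalfDensity.pull_invFrame`). The same `jac F` is the Jacobian of `F` for `leftMeasure`
(`IsLeftDensity.lintegral_comp_mul_jac`), so the push-forward by `W` is a weighted composition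
operator and is unitary.

For the identity morphism, `t_h⁻¹` is the map `shear` of `B × G`, and `π_id(ω)` becomes an integral
operator over `B` with the kernel `√(jac shear)` times the coefficient of `ω` at `a_L(z) b`. For
`δ`, the geometric core is the factorization `tInvB_delta`: `t_δ⁻¹ = (id × W) ∘ (shear × id) ∘ (id ×
W⁻¹)`. It goes with `aL_pentagonal_symm`, by which `W⁻¹` carries the base map `(a₁, a₂) ↦ a₁ a₂` of
`δ` to the projection `a_L` of the first factor. Since `jac` is multiplicative, the integrand of
`π_δ(ω)` splits accordingly (`coeff2_rep_delta`): the outer factors are the weights of `W` and `W*`,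
and the middle one is the kernel of `π_id(ω) ⊗ I`.

Boundedness is Schur's test (`exists_schurOperator`). One marginal of the kernel integrates the
coefficient of `ω` along a section of `b_R`, the other, after `shear⁻¹`, along a section of `b_L`;
both are uniformly bounded by compactness of the support. Uniqueness of the extensions follows from
density of smooth compactly supported functions, and that of `T ⊗ I` from totality of products of
functions.

All of this needs `a_L` and `b_R` to be smooth, which is not part of the definition of a double Lie
group. The product map `A × B → G` is a smooth bijection whose derivative at the identity is
injective (one-parameter curves), it is open (a σ-compact group acting transitively), so the
dimensions agree; the inverse function theorem and translations then give a smooth inverse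
(`contMDiff_factor`). -/

noncomputable section

set_option linter.unusedSectionVars false

namespace DLG

section

/-! ### Derivatives between manifolds as maps of the model spaces -/

section Deriv

variable {V H M V' H' M' V'' H'' M'' : Type*}
  [NormedAddCommGroup V] [NormedSpace ℝ V] [TopologicalSpace H]
  [TopologicalSpace M] [ChartedSpace H M]
  [NormedAddCommGroup V'] [NormedSpace ℝ V'] [TopologicalSpace H']
  [TopologicalSpace M'] [ChartedSpace H' M']
  [NormedAddCommGroup V''] [NormedSpace ℝ V''] [TopologicalSpace H'']
  [TopologicalSpace M''] [ChartedSpace H'' M'']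
  (I : ModelWithCorners ℝ V H) (I' : ModelWithCorners ℝ V' H') (I'' : ModelWithCorners ℝ V'' H'')

/-- The derivative of a map of manifolds, as a map of the model spaces. -/
def modelDeriv (f : M → M') (x : M) : V →L[ℝ] V' := mfderiv I I' f x

variable {I I' I''}

theorem modelDeriv_comp {g : M' → M''} {f : M → M'} {x : M}
    (hg : MDifferentiableAt I' I'' g (f x)) (hf : MDifferentiableAt I I' f x) :
    modelDeriv I I'' (fun y => g (f y)) x =
      (modelDeriv I' I'' g (f x)).comp (modelDeriv I I' f x) :=
  mfderiv_comp x hg hf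

theorem modelDeriv_id (x : M) : modelDeriv I I (fun y : M => y) x = ContinuousLinearMap.id ℝ V :=
  mfderiv_id

theorem modelDeriv_congr {f g : M → M'} {x : M} (h : f =ᶠ[nhds x] g) :
    modelDeriv I I' f x = modelDeriv I I' g x :=
  h.mfderiv_eq

theorem modelDeriv_eq_fderiv (f : V → V') (x : V) :
    modelDeriv 𝓘(ℝ, V) 𝓘(ℝ, V') f x = fderiv ℝ f x :=
  mfderiv_eq_fderiv

theorem modelDeriv_prodMk {f : M → M'} {g : M → M''} {x : M}
    (hf : MDifferentiableAt I I' f x) (hg : MDifferentiableAt I I'' g x) :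
    modelDeriv I (I'.prod I'') (fun y => (f y, g y)) x =
      (modelDeriv I I' f x).prod (modelDeriv I I'' g x) :=
  hf.mfderiv_prod hg

theorem modelDeriv_fst (x : M × M') :
    modelDeriv (I.prod I') I Prod.fst x = ContinuousLinearMap.fst ℝ V V' :=
  mfderiv_fst

theorem modelDeriv_snd (x : M × M') :
    modelDeriv (I.prod I') I' Prod.snd x = ContinuousLinearMap.snd ℝ V V' :=
  mfderiv_snd


theorem modelDeriv_const (c : M') (x : M) : modelDeriv I I' (fun _ : M => c) x = 0 :=
  mfderiv_const

/-- If `f x` sends a fixed point to a fixed point, its derivative there depends smoothly on `x`. -/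
theorem contMDiffAt_modelDeriv_param [IsManifold I 1 M] [IsManifold I' 1 M']
    [IsManifold I'' 1 M''] {f : M'' → M → M'} {m₀ : M} {p : M'} {x₀ : M''}
    (hf : ContMDiffAt (I''.prod I) I' ∞ (Function.uncurry f) (x₀, m₀))
    (hp : ∀ x, f x m₀ = p) :
    ContMDiffAt I'' 𝓘(ℝ, V →L[ℝ] V') ∞ (fun x => modelDeriv I I' (f x) m₀) x₀ := by
  have h := ContMDiffAt.mfderiv (m := ∞) (n := ∞) f (fun _ => m₀) hf contMDiffAt_const (by simp)
  refine h.congr_of_eventuallyEq (Filter.Eventually.of_forall fun x => ?_)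
  -- The general theorem gives smoothness in coordinates of the tangent bundles. Both base points
  -- `m₀` and `p` stay fixed, so the coordinate changes involved are identities.
  have h2 := inTangentCoordinates_eq (I := I) (I' := I') (fun _ : M'' => m₀) (fun x => f x m₀)
    (fun x => modelDeriv I I' (f x) m₀) (x₀ := x₀) (x := x) (mem_chart_source H m₀)
    (by rw [hp, hp]; exact mem_chart_source H' p)
  refine Eq.trans ?_ h2.symm
  have h3 : achart H' (f x₀ m₀) = achart H' (f x m₀) := by rw [hp, hp]
  rw [h3]
  ext v
  simp only [ContinuousLinearMap.comp_apply]
  rw [(tangentBundleCore I M).coordChange_self _ _ (by simp),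
    (tangentBundleCore I' M').coordChange_self _ _ (by simp)]

end Deriv

section AbsDet

variable {V : Type*} [NormedAddCommGroup V] [NormedSpace ℝ V]

/-- The absolute value of the determinant. -/
def absDet (L : V →L[ℝ] V) : ℝ := |LinearMap.det (L : V →ₗ[ℝ] V)|

theorem absDet_comp (L M : V →L[ℝ] V) : absDet (L.comp M) = absDet L * absDet M := by
  simp [absDet, LinearMap.det_comp, abs_mul]

theorem absDet_id : absDet (ContinuousLinearMap.id ℝ V) = 1 := by
  simp [absDet]

theorem absDet_nonneg (L : V →L[ℝ] V) : 0 ≤ absDet L := abs_nonneg _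

theorem absDet_prodMap {V' : Type*} [NormedAddCommGroup V'] [NormedSpace ℝ V']
    [FiniteDimensional ℝ V] [FiniteDimensional ℝ V'] (L : V →L[ℝ] V) (L' : V' →L[ℝ] V') :
    absDet (L.prodMap L') = absDet L * absDet L' := by
  have : ((L.prodMap L' : V × V' →L[ℝ] V × V') : V × V' →ₗ[ℝ] V × V') =
    LinearMap.prodMap (L : V →ₗ[ℝ] V) (L' : V' →ₗ[ℝ] V') := rfl
  rw [absDet, this, LinearMap.det_prodMap, abs_mul, absDet, absDet]

theorem continuous_absDet [FiniteDimensional ℝ V] : Continuous (absDet (V := V)) :=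
  continuous_abs.comp ContinuousLinearMap.continuous_det

end AbsDet

/-! ### Derivatives of maps into a Lie group in left trivialization -/

section LeftDeriv

variable {V H M V' H' M' V'' H'' G : Type*}
  [NormedAddCommGroup V] [NormedSpace ℝ V] [TopologicalSpace H]
  [TopologicalSpace M] [ChartedSpace H M]
  [NormedAddCommGroup V'] [NormedSpace ℝ V'] [TopologicalSpace H']
  [TopologicalSpace M'] [ChartedSpace H' M']
  [NormedAddCommGroup V''] [NormedSpace ℝ V''] [TopologicalSpace H'']
  [TopologicalSpace G] [ChartedSpace H'' G] [Group G]
  (I : ModelWithCorners ℝ V H) (I' : ModelWithCorners ℝ V' H') (I'' : ModelWithCorners ℝ V'' H'')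

/-- The derivative of left translation at the identity. -/
def leftTranslation (g : G) : V'' →L[ℝ] V'' := modelDeriv I'' I'' (fun h : G => g * h) 1

/-- The derivative of a map into a Lie group, moved to the identity by left translation. -/
def leftDeriv (F : M → G) (x : M) : V →L[ℝ] V'' := modelDeriv I I'' (fun y => (F x)⁻¹ * F y) x

/-- The absolute value of the determinant of the derivative in the left-invariant frames. -/
def jac (F : G → G) (x : G) : ℝ :=
  absDet ((leftDeriv I'' I'' F x).comp (leftTranslation I'' x))

variable {I I' I''}

theorem leftDeriv_mul_left (c : G) (F : M → G) (x : M) :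
    leftDeriv I I'' (fun y => c * F y) x = leftDeriv I I'' F x := by
  simp [leftDeriv, mul_assoc]

theorem leftDeriv_congr {F F' : M → G} {x : M} (h : F =ᶠ[nhds x] F') :
    leftDeriv I I'' F x = leftDeriv I I'' F' x := by
  rw [leftDeriv, h.eq_of_nhds]
  exact modelDeriv_congr (h.mono fun y hy => by simp [hy])

theorem jac_nonneg (F : G → G) (x : G) : 0 ≤ jac I'' F x := absDet_nonneg _

variable [LieGroup I'' ∞ G]

theorem mdifferentiable_mul_left (g : G) : MDifferentiable I'' I'' (fun h : G => g * h) :=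
  (contMDiff_mul_left (n := ∞)).mdifferentiable (by simp)

theorem leftDeriv_comp {F : M' → G} {K : M → M'} {x : M}
    (hF : MDifferentiableAt I' I'' F (K x)) (hK : MDifferentiableAt I I' K x) :
    leftDeriv I I'' (fun y => F (K y)) x = (leftDeriv I' I'' F (K x)).comp (modelDeriv I I' K x) :=
  modelDeriv_comp (g := fun y => (F (K x))⁻¹ * F y)
    ((mdifferentiable_mul_left _ _).comp _ hF) hK

theorem modelDeriv_eq_leftTranslation_comp {F : M → G} {x : M} (hF : MDifferentiableAt I I'' F x) :
    modelDeriv I I'' F x = (leftTranslation I'' (F x)).comp (leftDeriv I I'' F x) := by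
  have h : leftTranslation I'' (F x) =
      modelDeriv I'' I'' (fun h : G => F x * h) ((F x)⁻¹ * F x) := by simp [leftTranslation]
  rw [h, leftDeriv, ← modelDeriv_comp (f := fun y => (F x)⁻¹ * F y) (mdifferentiable_mul_left _ _)
    ((mdifferentiable_mul_left _ _).comp _ hF)]
  simp

/-- The left derivative of the identity map is the Maurer–Cartan form, so it inverts the derivative
of left translation; the next lemma is the other side. -/
theorem leftDeriv_id_comp_leftTranslation (g : G) :
    (leftDeriv I'' I'' (fun h : G => h) g).comp (leftTranslation I'' g) =
      ContinuousLinearMap.id ℝ V'' := by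
  have h : leftDeriv I'' I'' (fun h : G => h) g =
      modelDeriv I'' I'' (fun h : G => g⁻¹ * h) (g * 1) := by simp [leftDeriv]
  rw [h, leftTranslation, ← modelDeriv_comp (mdifferentiable_mul_left _ _)
    (mdifferentiable_mul_left _ _)]
  simp only [inv_mul_cancel_left]
  exact modelDeriv_id _

theorem leftTranslation_comp_leftDeriv_id (g : G) :
    (leftTranslation I'' g).comp (leftDeriv I'' I'' (fun h : G => h) g) =
      ContinuousLinearMap.id ℝ V'' := by
  rw [← modelDeriv_eq_leftTranslation_comp (F := fun h : G => h) mdifferentiableAt_id]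
  exact modelDeriv_id _

/-- The frame of left translations as a linear equivalence. -/
def leftTranslationEquiv (g : G) : V'' ≃ₗ[ℝ] V'' :=
  LinearEquiv.ofLinearMap (leftTranslation I'' g : V'' →ₗ[ℝ] V'')
    (leftDeriv I'' I'' (fun h : G => h) g : V'' →ₗ[ℝ] V'')
    (LinearMap.ext fun v => DFunLike.congr_fun (leftTranslation_comp_leftDeriv_id g) v)
    (LinearMap.ext fun v => DFunLike.congr_fun (leftDeriv_id_comp_leftTranslation g) v)

/-- The translation to `K x` and the one back to the identity cancel in the middle. This cocycle
property is what later splits the half-density factor of a composite map. -/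
theorem jac_comp {F K : G → G} {x : G} (hF : MDifferentiableAt I'' I'' F (K x))
    (hK : MDifferentiableAt I'' I'' K x) :
    jac I'' (fun y => F (K y)) x = jac I'' F (K x) * jac I'' K x := by
  rw [jac, leftDeriv_comp hF hK, modelDeriv_eq_leftTranslation_comp hK, jac, jac, ← absDet_comp]
  rfl

theorem jac_id (x : G) : jac I'' (fun y : G => y) x = 1 := by
  rw [jac, leftDeriv_id_comp_leftTranslation, absDet_id]

theorem absDet_leftDeriv_comp {F : G → G} {γ : V'' → G} {u : V''}
    (hF : MDifferentiableAt I'' I'' F (γ u)) (hγ : MDifferentiableAt 𝓘(ℝ, V'') I'' γ u) :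
    absDet (leftDeriv 𝓘(ℝ, V'') I'' (fun v => F (γ v)) u) =
      jac I'' F (γ u) * absDet (leftDeriv 𝓘(ℝ, V'') I'' γ u) := by
  rw [leftDeriv_comp hF hγ, modelDeriv_eq_leftTranslation_comp hγ, jac, ← absDet_comp]
  rfl

/-- Translating on both sides produces maps that fix the identity for every `x`, which is the form
required by `contMDiffAt_modelDeriv_param`. -/
theorem jac_eq_absDet {F : G → G} {x : G} (hF : MDifferentiableAt I'' I'' F x) :
    jac I'' F x = absDet (modelDeriv I'' I'' (fun h : G => (F x)⁻¹ * F (x * h)) 1) := by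
  have hx : MDifferentiableAt I'' I'' F (x * 1) := by simpa using hF
  have := leftDeriv_comp (K := fun h : G => x * h) hx (mdifferentiable_mul_left (I'' := I'') x 1)
  have h1 : leftDeriv I'' I'' F x = leftDeriv I'' I'' F (x * 1) := by simp
  rw [jac, h1, leftTranslation, ← this]
  simp [leftDeriv]

theorem continuous_jac [FiniteDimensional ℝ V''] {F : G → G} (hF : ContMDiff I'' I'' ∞ F) :
    Continuous (jac I'' F) := by
  have : IsManifold I'' ∞ G := inferInstance
  have : IsManifold I'' 1 G := .of_le (n := ∞) (by simp)
  have h : jac I'' F = fun x => absDet (modelDeriv I'' I'' (fun h : G => (F x)⁻¹ * F (x * h)) 1) :=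
    funext fun x => jac_eq_absDet (hF.mdifferentiable (by simp) x)
  rw [h, continuous_iff_continuousAt]
  intro x₀
  refine continuous_absDet.continuousAt.comp (ContMDiffAt.continuousAt (I := I'') (n := ∞)
    (contMDiffAt_modelDeriv_param (p := (1 : G)) (f := fun x h => (F x)⁻¹ * F (x * h))
      ?_ (fun x => by simp)))
  exact ((hF.comp contMDiff_fst).inv.mul (hF.comp (contMDiff_fst.mul contMDiff_snd))).contMDiffAt

theorem continuousOn_absDet_leftDeriv [FiniteDimensional ℝ V''] {γ : V'' → G} {s : Set V''}
    (hs : IsOpen s) (hγ : ContMDiffOn 𝓘(ℝ, V'') I'' ∞ γ s) :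
    ContinuousOn (fun u => absDet (leftDeriv 𝓘(ℝ, V'') I'' γ u)) s := by
  have : IsManifold I'' ∞ G := inferInstance
  have : IsManifold I'' 1 G := .of_le (n := ∞) (by simp)
  have hc : ∀ u ∈ s, ContMDiffAt 𝓘(ℝ, V'') I'' ∞ γ u := fun u hu => hγ.contMDiffAt (hs.mem_nhds hu)
  -- Recentering the source at `0` and the target at the identity makes the base points independent
  -- of `u`.
  have key : ∀ u ∈ s, leftDeriv 𝓘(ℝ, V'') I'' γ u =
      modelDeriv 𝓘(ℝ, V'') I'' (fun h : V'' => (γ u)⁻¹ * γ (u + h)) 0 := by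
    intro u hu
    have hd : MDifferentiableAt 𝓘(ℝ, V'') I'' γ (u + 0) := by
      simpa using (hc u hu).mdifferentiableAt (by simp)
    have ha : HasFDerivAt (fun h : V'' => u + h) (ContinuousLinearMap.id ℝ V'') 0 :=
      (hasFDerivAt_id _).const_add u
    have h2 := leftDeriv_comp (K := fun h : V'' => u + h) hd ha.differentiableAt.mdifferentiableAt
    rw [modelDeriv_eq_fderiv, ha.fderiv] at h2
    simp only [leftDeriv, add_zero, ContinuousLinearMap.comp_id] at h2 ⊢
    exact h2.symm
  intro u₀ hu₀
  refine ContinuousAt.continuousWithinAt (ContinuousAt.congr (f := fun u => absDet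
    (modelDeriv 𝓘(ℝ, V'') I'' (fun h : V'' => (γ u)⁻¹ * γ (u + h)) 0)) ?_ ?_)
  · refine continuous_absDet.continuousAt.comp (ContMDiffAt.continuousAt (I := 𝓘(ℝ, V'')) (n := ∞)
      (contMDiffAt_modelDeriv_param (p := (1 : G)) (f := fun u h => (γ u)⁻¹ * γ (u + h))
      ?_ (fun x => by simp)))
    have h1 : ContMDiffAt (𝓘(ℝ, V'').prod 𝓘(ℝ, V'')) I'' ∞ (fun q : V'' × V'' => γ q.1) (u₀, 0) :=
      (hc u₀ hu₀).comp (u₀, (0 : V'')) contMDiffAt_fst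
    have h2 : ContMDiffAt (𝓘(ℝ, V'').prod 𝓘(ℝ, V'')) I'' ∞
        (fun q : V'' × V'' => γ (q.1 + q.2)) (u₀, 0) := by
      refine ContMDiffAt.comp (u₀, (0 : V'')) (g := γ) (f := fun q : V'' × V'' => q.1 + q.2)
        (by simpa using hc u₀ hu₀) ?_
      exact contMDiffAt_fst.add contMDiffAt_snd
    exact h1.inv.mul h2
  · filter_upwards [hs.mem_nhds hu₀] with u hu using by rw [key u hu]

end LeftDeriv

end

section

/-! ### Half-densities in left-invariant frames -/

section Half

variable {ι V : Type*} [AddCommGroup V] [Module ℝ V] [Fintype ι] [DecidableEq ι]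

/-- The half-density with a given value on a basis. -/
def HalfDensity.ofBasis (b : Module.Basis ι ℝ V) (c : ℂ) : HalfDensity ι V where
  toFun v := ((Real.sqrt |b.det v| : ℝ) : ℂ) * c
  map_comp' L v := by
    have h : b.det (fun i => L (v i)) = LinearMap.det L * b.det v := b.det_comp L v
    rw [h, abs_mul, Real.sqrt_mul (abs_nonneg _)]
    push_cast
    ring

theorem HalfDensity.ofBasis_apply (b : Module.Basis ι ℝ V) (c : ℂ) :
    (HalfDensity.ofBasis b c).toFun b = c := by
  change ((Real.sqrt |b.det b| : ℝ) : ℂ) * c = c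
  rw [Module.Basis.det_self]
  simp

end Half

section Frame

variable {ι V H G ι' V' H' G' : Type*}
  [NormedAddCommGroup V] [NormedSpace ℝ V] [TopologicalSpace H]
  [TopologicalSpace G] [ChartedSpace H G] [Group G]
  [NormedAddCommGroup V'] [NormedSpace ℝ V'] [TopologicalSpace H']
  [TopologicalSpace G'] [ChartedSpace H' G'] [Group G']
  (I : ModelWithCorners ℝ V H) (I' : ModelWithCorners ℝ V' H')

/-- The left-invariant frame that extends a basis of the tangent space at the identity. -/
def invFrame (b : Module.Basis ι ℝ V) (g : G) (i : ι) : V := leftTranslation I g (b i)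

variable {I I'} [LieGroup I ∞ G] [LieGroup I' ∞ G']

theorem invFrame_eq_basis (b : Module.Basis ι ℝ V) (g : G) :
    invFrame I b g = b.map (leftTranslationEquiv (I'' := I) g) := by
  ext i
  rw [Module.Basis.map_apply]
  rfl

/-- Every function is the coefficient of some half-density, so elements of `L²` may be treated as
half-densities. -/
theorem exists_halfDensity_invFrame [Fintype ι] [DecidableEq ι]
    (b : Module.Basis ι ℝ V) (g : G) (c : ℂ) :
    ∃ σ : HalfDensity ι V, σ.toFun (invFrame I b g) = c :=
  ⟨.ofBasis (b.map (leftTranslationEquiv (I'' := I) g)) c, by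
    rw [invFrame_eq_basis, HalfDensity.ofBasis_apply]⟩

/-- The image frame is obtained from the invariant frame at `F x` by the left-trivialized derivative
conjugated by the translation to `F x`, and conjugation preserves the determinant. -/
theorem HalfDensity.toFun_modelDeriv_invFrame (b : Module.Basis ι ℝ V) (σ : HalfDensity ι V)
    {F : G → G} {x : G} (hF : MDifferentiableAt I I F x) :
    σ.toFun (fun i => modelDeriv I I F x (invFrame I b x i)) =
      ((Real.sqrt (jac I F x) : ℝ) : ℂ) * σ.toFun (invFrame I b (F x)) := by
  set e := leftTranslationEquiv (I'' := I) (F x)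
  set A : V →ₗ[ℝ] V := ((leftDeriv I I F x).comp (leftTranslation I x)).toLinearMap
  have h : (fun i => modelDeriv I I F x (invFrame I b x i)) =
      fun i => (e.toLinearMap ∘ₗ A ∘ₗ e.symm.toLinearMap) (invFrame I b (F x) i) := by
    ext i
    have h1 : invFrame I b (F x) i = e (b i) := rfl
    rw [h1, modelDeriv_eq_leftTranslation_comp hF]
    simp only [LinearMap.comp_apply, LinearEquiv.coe_coe, LinearEquiv.symm_apply_apply]
    rfl
  rw [h, HalfDensity.map_comp', LinearMap.det_conj]
  rfl

theorem HalfDensity.pull_invFrame (b : Module.Basis ι ℝ V) (σ : HalfDensity ι V)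
    {F : G → G} {x : G} (hF : MDifferentiableAt I I F x) :
    (σ.pull (onModel (V := V) (mfderiv I I F x))).toFun (invFrame I b x) =
      ((Real.sqrt (jac I F x) : ℝ) : ℂ) * σ.toFun (invFrame I b (F x)) :=
  HalfDensity.toFun_modelDeriv_invFrame b σ hF

theorem leftTranslation_prod (g : G) (g' : G') :
    leftTranslation (I.prod I') (g, g') =
      (leftTranslation I g).prodMap (leftTranslation I' g') := by
  have h : (fun h : G × G' => (g, g') * h) = fun h => (g * h.1, g' * h.2) := rfl
  have h1 : MDifferentiableAt (I.prod I') I (fun h : G × G' => g * h.1) 1 :=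
    (mdifferentiable_mul_left g _).comp _ mdifferentiableAt_fst
  have h2 : MDifferentiableAt (I.prod I') I' (fun h : G × G' => g' * h.2) 1 :=
    (mdifferentiable_mul_left g' _).comp _ mdifferentiableAt_snd
  rw [leftTranslation, h, modelDeriv_prodMk h1 h2,
    modelDeriv_comp (mdifferentiable_mul_left g _) mdifferentiableAt_fst,
    modelDeriv_comp (mdifferentiable_mul_left g' _) mdifferentiableAt_snd, modelDeriv_fst,
    modelDeriv_snd]
  rfl

theorem invFrame_prod (b : Module.Basis ι ℝ V) (b' : Module.Basis ι' ℝ V') (g : G) (g' : G') :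
    invFrame (I.prod I') (b.prod b') (g, g') =
      Sum.elim (fun i => (invFrame I b g i, (0 : V'))) (fun j => ((0 : V), invFrame I' b' g' j)) := by
  ext i : 1
  rw [invFrame, leftTranslation_prod]
  rcases i with i | i <;> simp [invFrame]

end Frame

/-! ### Jacobians of maps acting on some factors of a product. -/

section Jacobian

variable {V₁ H₁ G₁ V₂ H₂ G₂ V₃ H₃ G₃ : Type*}
  [NormedAddCommGroup V₁] [NormedSpace ℝ V₁] [TopologicalSpace H₁]
  [TopologicalSpace G₁] [ChartedSpace H₁ G₁]
  [NormedAddCommGroup V₂] [NormedSpace ℝ V₂] [TopologicalSpace H₂]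
  [TopologicalSpace G₂] [ChartedSpace H₂ G₂]
  [NormedAddCommGroup V₃] [NormedSpace ℝ V₃] [TopologicalSpace H₃]
  [TopologicalSpace G₃] [ChartedSpace H₃ G₃]
  {I₁ : ModelWithCorners ℝ V₁ H₁} {I₂ : ModelWithCorners ℝ V₂ H₂} {I₃ : ModelWithCorners ℝ V₃ H₃}

/-- `F × id`, on `G₁ × (G₂ × G₃)`. -/
def extendRight (F : G₁ × G₂ → G₁ × G₂) (q : G₁ × (G₂ × G₃)) : G₁ × (G₂ × G₃) :=
  ((F (q.1, q.2.1)).1, ((F (q.1, q.2.1)).2, q.2.2))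

/-- `id × F`, on `G₁ × G₂`. -/
def extendLeft (F : G₂ → G₂) (q : G₁ × G₂) : G₁ × G₂ := (q.1, F q.2)

theorem contMDiff_extendRight {F : G₁ × G₂ → G₁ × G₂}
    (hF : ContMDiff (I₁.prod I₂) (I₁.prod I₂) ∞ F) :
    ContMDiff (I₁.prod (I₂.prod I₃)) (I₁.prod (I₂.prod I₃)) ∞
      (extendRight (G₃ := G₃) F) := by
  have h : ContMDiff (I₁.prod (I₂.prod I₃)) (I₁.prod I₂) ∞
      (fun q : G₁ × (G₂ × G₃) => F (q.1, q.2.1)) :=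
    hF.comp (contMDiff_fst.prodMk (contMDiff_fst.comp contMDiff_snd))
  exact (contMDiff_fst.comp h).prodMk ((contMDiff_snd.comp h).prodMk
    (contMDiff_snd.comp contMDiff_snd))

theorem contMDiff_extendLeft {F : G₂ → G₂} (hF : ContMDiff I₂ I₂ ∞ F) :
    ContMDiff (I₁.prod I₂) (I₁.prod I₂) ∞ (extendLeft (G₁ := G₁) F) :=
  contMDiff_fst.prodMk (hF.comp contMDiff_snd)

variable [Group G₁] [Group G₂] [Group G₃]
  [LieGroup I₁ ∞ G₁] [LieGroup I₂ ∞ G₂] [LieGroup I₃ ∞ G₃]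

theorem jac_extendLeft [FiniteDimensional ℝ V₁] [FiniteDimensional ℝ V₂] {F : G₂ → G₂}
    (hF : ContMDiff I₂ I₂ ∞ F) (q : G₁ × G₂) :
    jac (I₁.prod I₂) (extendLeft F) q = jac I₂ F q.2 := by
  have hF' := hF.mdifferentiable (by simp)
  rw [jac_eq_absDet ((contMDiff_extendLeft hF).mdifferentiable (by simp) q),
    jac_eq_absDet (hF' q.2)]
  have h : (fun h : G₁ × G₂ => (extendLeft F q)⁻¹ * extendLeft F (q * h)) =
      fun h => (h.1, (F q.2)⁻¹ * F (q.2 * h.2)) := by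
    ext h <;> simp [extendLeft]
  have h1 : MDifferentiableAt I₂ I₂ (fun h : G₂ => (F q.2)⁻¹ * F (q.2 * h)) (1 : G₁ × G₂).2 :=
    (mdifferentiable_mul_left _ _).comp _ ((hF' _).comp _ (mdifferentiable_mul_left _ _))
  have h2 : MDifferentiableAt (I₁.prod I₂) I₂ (fun h : G₁ × G₂ => (F q.2)⁻¹ * F (q.2 * h.2)) 1 :=
    h1.comp (1 : G₁ × G₂) mdifferentiableAt_snd
  rw [h, modelDeriv_prodMk mdifferentiableAt_fst h2, modelDeriv_fst,
    modelDeriv_comp h1 mdifferentiableAt_snd, modelDeriv_snd]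
  exact (absDet_prodMap (ContinuousLinearMap.id ℝ V₁) _).trans (by rw [absDet_id, one_mul]; rfl)

theorem jac_extendRight [FiniteDimensional ℝ V₁] [FiniteDimensional ℝ V₂] [FiniteDimensional ℝ V₃]
    {F : G₁ × G₂ → G₁ × G₂}
    (hF : ContMDiff (I₁.prod I₂) (I₁.prod I₂) ∞ F) (q : G₁ × (G₂ × G₃)) :
    jac (I₁.prod (I₂.prod I₃)) (extendRight F) q = jac (I₁.prod I₂) F (q.1, q.2.1) := by
  have hF' := hF.mdifferentiable (by simp)
  rw [jac_eq_absDet ((contMDiff_extendRight (I₃ := I₃) hF).mdifferentiable (by simp) q),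
    jac_eq_absDet (hF' _)]
  set p : G₁ × G₂ := (q.1, q.2.1)
  set K : G₁ × G₂ → G₁ × G₂ := fun h => (F p)⁻¹ * F (p * h)
  set c : G₁ × (G₂ × G₃) → G₁ × G₂ := fun h => (h.1, h.2.1)
  have h : (fun h : G₁ × (G₂ × G₃) => (extendRight F q)⁻¹ * extendRight F (q * h)) =
      fun h => ((K (c h)).1, ((K (c h)).2, h.2.2)) := by
    ext h <;> simp [extendRight, K, c, p]
  have hK : MDifferentiableAt (I₁.prod I₂) (I₁.prod I₂) K (c 1) :=
    (mdifferentiable_mul_left _ _).comp _ ((hF' _).comp _ (mdifferentiable_mul_left _ _))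
  have hs : MDifferentiableAt (I₁.prod (I₂.prod I₃)) (I₂.prod I₃)
    (Prod.snd : G₁ × (G₂ × G₃) → G₂ × G₃) 1 := mdifferentiableAt_snd
  have hs1 : MDifferentiableAt (I₁.prod (I₂.prod I₃)) I₂
    (fun h : G₁ × (G₂ × G₃) => h.2.1) 1 := mdifferentiableAt_fst.comp _ hs
  have hs2 : MDifferentiableAt (I₁.prod (I₂.prod I₃)) I₃
    (fun h : G₁ × (G₂ × G₃) => h.2.2) 1 := mdifferentiableAt_snd.comp _ hs
  have hc : MDifferentiableAt (I₁.prod (I₂.prod I₃)) (I₁.prod I₂) c 1 :=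
    mdifferentiableAt_fst.prodMk hs1
  have hKc : MDifferentiableAt (I₁.prod (I₂.prod I₃)) (I₁.prod I₂) (fun h => K (c h)) 1 :=
    hK.comp _ hc
  have hK1 : MDifferentiableAt (I₁.prod (I₂.prod I₃)) I₁ (fun h => (K (c h)).1) 1 :=
    mdifferentiableAt_fst.comp _ hKc
  have hK2 : MDifferentiableAt (I₁.prod (I₂.prod I₃)) I₂ (fun h => (K (c h)).2) 1 :=
    mdifferentiableAt_snd.comp _ hKc
  rw [h, modelDeriv_prodMk hK1 (hK2.prodMk hs2), modelDeriv_prodMk hK2 hs2,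
    modelDeriv_comp (g := Prod.fst) mdifferentiableAt_fst hKc,
    modelDeriv_comp (g := Prod.snd) mdifferentiableAt_snd hKc, modelDeriv_comp hK hc,
    modelDeriv_comp (g := Prod.snd) mdifferentiableAt_snd hs, modelDeriv_fst, modelDeriv_snd,
    modelDeriv_snd, modelDeriv_snd, modelDeriv_prodMk mdifferentiableAt_fst hs1, modelDeriv_fst,
    modelDeriv_comp (g := Prod.fst) mdifferentiableAt_fst hs, modelDeriv_fst, modelDeriv_snd]
  set L := modelDeriv (I₁.prod I₂) (I₁.prod I₂) K (c 1)
  -- After reassociation the derivative is block diagonal, with the blocks `L` and the identity of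
  -- `V₃`.
  let e : ((V₁ × V₂) × V₃) ≃ₗ[ℝ] (V₁ × (V₂ × V₃)) := LinearEquiv.prodAssoc ℝ V₁ V₂ V₃
  have hL : modelDeriv (I₁.prod I₂) (I₁.prod I₂) K 1 = L := rfl
  rw [hL, ← mul_one (absDet L), ← absDet_id (V := V₃), ← absDet_prodMap, absDet, absDet,
    ← LinearMap.det_conj _ e]
  rfl

end Jacobian

end

section

/-! ### Measures given by the left-invariant density -/

section Density

variable {V H G : Type*} [NormedAddCommGroup V] [NormedSpace ℝ V] [FiniteDimensional ℝ V]
  [MeasurableSpace V] [BorelSpace V] [TopologicalSpace H]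
  [TopologicalSpace G] [ChartedSpace H G] [Group G] [MeasurableSpace G] [BorelSpace G]
  (I : ModelWithCorners ℝ V H)

/-- A smooth chart, as an open partial homeomorphism to the model vector space. -/
def IsSmoothChart (φ : OpenPartialHomeomorph G V) : Prop :=
  ContMDiffOn I 𝓘(ℝ, V) ∞ φ φ.source ∧ ContMDiffOn 𝓘(ℝ, V) I ∞ φ.symm φ.target

/-- The left-invariant 1-density in a chart. -/
def chartDensity (φ : OpenPartialHomeomorph G V) (u : V) : ENNReal :=
  ENNReal.ofReal (absDet (leftDeriv 𝓘(ℝ, V) I φ.symm u))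

/-- The measure is the integral of the left-invariant 1-density normalized by `ν` at the
identity. -/
def IsLeftDensity (ν : Measure V) (μ : Measure G) : Prop :=
  ∀ g : G, ∃ φ : OpenPartialHomeomorph G V, g ∈ φ.source ∧ IsSmoothChart I φ ∧
    ∀ S ⊆ φ.source, MeasurableSet S → μ S = ∫⁻ u in φ '' S, chartDensity I φ u ∂ν

variable {I} {φ φ' : OpenPartialHomeomorph G V} {ν : Measure V} {μ : Measure G}

theorem measurableSet_image_chart {S : Set G} (hS : S ⊆ φ.source) (hm : MeasurableSet S) :
    MeasurableSet (φ '' S) := by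
  have h : φ '' S = Subtype.val '' ((φ.target.domRestrict φ.symm) ⁻¹' S) := by
    rw [φ.image_eq_target_inter_inv_preimage hS]
    ext u
    simp [Set.domRestrict, and_comm]
  rw [h]
  exact φ.open_target.measurableSet.subtype_image
    ((φ.continuousOn_symm.domRestrict.measurable) hm)

variable [LieGroup I ∞ G]

theorem continuousOn_chartDensity (hφ : IsSmoothChart I φ) :
    ContinuousOn (chartDensity I φ) φ.target :=
  ENNReal.continuous_ofReal.comp_continuousOn
    (continuousOn_absDet_leftDeriv φ.open_target hφ.2)

theorem aemeasurable_chartDensity (hφ : IsSmoothChart I φ) {t : Set V} (ht : t ⊆ φ.target)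
    (htm : MeasurableSet t) : AEMeasurable (chartDensity I φ) (ν.restrict t) :=
  ((continuousOn_chartDensity hφ).mono ht).aemeasurable htm

theorem restrict_eq_map_of_chart [SFinite ν]
    (h : ∀ S ⊆ φ.source, MeasurableSet S → μ S = ∫⁻ u in φ '' S, chartDensity I φ u ∂ν)
    {S : Set G} (hS : S ⊆ φ.source) (hm : MeasurableSet S) :
    μ.restrict S = ((ν.restrict (φ '' S)).withDensity (chartDensity I φ)).map φ.symm := by
  have hmi := measurableSet_image_chart hS hm
  have hsub : φ '' S ⊆ φ.target := by rintro _ ⟨x, hx, rfl⟩; exact φ.map_source (hS hx)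
  ext T hT
  have hae : AEMeasurable φ.symm ((ν.restrict (φ '' S)).withDensity (chartDensity I φ)) :=
    ((φ.continuousOn_symm.mono hsub).aemeasurable hmi).mono_ac (withDensity_absolutelyContinuous _ _)
  rw [Measure.map_apply_of_aemeasurable hae hT, withDensity_apply', Measure.restrict_apply hT,
    h _ (Set.inter_subset_right.trans hS) (hT.inter hm), Measure.restrict_restrict' hmi]
  congr 2
  ext u
  constructor
  · rintro ⟨x, ⟨hxT, hxS⟩, rfl⟩
    exact ⟨by simpa [φ.left_inv (hS hxS)] using hxT, x, hxS, rfl⟩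
  · rintro ⟨hu, x, hxS, rfl⟩
    exact ⟨x, ⟨by simpa [φ.left_inv (hS hxS)] using hu, hxS⟩, rfl⟩

theorem setLIntegral_eq_of_chart [SFinite ν] (hφ : IsSmoothChart I φ)
    (h : ∀ S ⊆ φ.source, MeasurableSet S → μ S = ∫⁻ u in φ '' S, chartDensity I φ u ∂ν)
    {S : Set G} (hS : S ⊆ φ.source) (hm : MeasurableSet S) {g : G → ENNReal} (hg : Measurable g) :
    ∫⁻ x in S, g x ∂μ = ∫⁻ u in φ '' S, chartDensity I φ u * g (φ.symm u) ∂ν := by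
  have hmi := measurableSet_image_chart hS hm
  have hsub : φ '' S ⊆ φ.target := by rintro _ ⟨x, hx, rfl⟩; exact φ.map_source (hS hx)
  have hae : AEMeasurable φ.symm (ν.restrict (φ '' S)) :=
    (φ.continuousOn_symm.mono hsub).aemeasurable hmi
  rw [restrict_eq_map_of_chart h hS hm, lintegral_map' hg.aemeasurable
      (hae.mono_ac (withDensity_absolutelyContinuous _ _)),
    lintegral_withDensity_eq_lintegral_mul₀ (g := fun u => g (φ.symm u))
      (aemeasurable_chartDensity hφ hsub hmi) (hg.comp_aemeasurable hae)]
  rfl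

/-- Change of variables between two charts. -/
theorem lintegral_chartDensity_image [ν.IsAddHaarMeasure] (hφ : IsSmoothChart I φ)
    (hφ' : IsSmoothChart I φ') {F : G → G} (hF : ContMDiff I I ∞ F) (hinj : Function.Injective F)
    {S : Set G} (hS : S ⊆ φ.source) (hm : MeasurableSet S) (hFS : F '' S ⊆ φ'.source) :
    ∫⁻ u in φ' '' (F '' S), chartDensity I φ' u ∂ν =
      ∫⁻ u in φ '' S, chartDensity I φ u * ENNReal.ofReal (jac I F (φ.symm u)) ∂ν := by
  set ψ : V → V := fun u => φ' (F (φ.symm u))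
  have hmi := measurableSet_image_chart hS hm
  have himg : φ' '' (F '' S) = ψ '' (φ '' S) := by
    rw [Set.image_image, Set.image_image]
    exact Set.image_congr fun x hx => by simp [ψ, φ.left_inv (hS hx)]
  have hFd := hF.mdifferentiable (by simp)
  have hγ : ∀ x ∈ S, MDifferentiableAt 𝓘(ℝ, V) I φ.symm (φ x) := fun x hx =>
    (hφ.2.contMDiffAt (φ.open_target.mem_nhds (φ.map_source (hS hx)))).mdifferentiableAt (by simp)
  have hFγ : ∀ x ∈ S, MDifferentiableAt 𝓘(ℝ, V) I (fun u => F (φ.symm u)) (φ x) := fun x hx =>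
    (hFd _).comp _ (hγ x hx)
  have hx' : ∀ x ∈ S, F (φ.symm (φ x)) ∈ φ'.source := fun x hx => by
    rw [φ.left_inv (hS hx)]; exact hFS ⟨x, hx, rfl⟩
  have hψ : ∀ x ∈ S, MDifferentiableAt 𝓘(ℝ, V) 𝓘(ℝ, V) ψ (φ x) := fun x hx =>
    ((hφ'.1.contMDiffAt (φ'.open_source.mem_nhds (hx' x hx))).mdifferentiableAt (by simp)).comp
      (φ x) (hFγ x hx)
  have hinjψ : Set.InjOn ψ (φ '' S) := by
    rintro _ ⟨x, hx, rfl⟩ _ ⟨y, hy, rfl⟩ hxy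
    simp only [ψ, φ.left_inv (hS hx), φ.left_inv (hS hy)] at hxy
    rw [hinj (φ'.injOn (hFS ⟨x, hx, rfl⟩) (hFS ⟨y, hy, rfl⟩) hxy)]
  rw [himg, lintegral_image_eq_lintegral_abs_det_fderiv_mul ν hmi (f' := fderiv ℝ ψ)
    (by rintro _ ⟨x, hx, rfl⟩
        exact (hψ x hx).differentiableAt.hasFDerivAt.hasFDerivWithinAt) hinjψ]
  refine setLIntegral_congr_fun hmi ?_
  rintro _ ⟨x, hx, rfl⟩
  -- Both sides compute the left derivative of one map, which near `φ x` is `φ'⁻¹ ∘ ψ` as well as `F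
  -- ∘ φ⁻¹`.
  have h1 : absDet (leftDeriv 𝓘(ℝ, V) I φ'.symm (ψ (φ x))) * absDet (fderiv ℝ ψ (φ x)) =
      absDet (leftDeriv 𝓘(ℝ, V) I φ.symm (φ x)) * jac I F (φ.symm (φ x)) := by
    have hψx : ψ (φ x) ∈ φ'.target := φ'.map_source (hx' x hx)
    rw [← absDet_comp, ← modelDeriv_eq_fderiv, ← leftDeriv_comp
      ((hφ'.2.contMDiffAt (φ'.open_target.mem_nhds hψx)).mdifferentiableAt (by simp)) (hψ x hx),
      mul_comm, ← absDet_leftDeriv_comp (hFd _) (hγ x hx)]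
    congr 1
    refine leftDeriv_congr ?_
    have hc : ContinuousAt (fun u => F (φ.symm u)) (φ x) := (hFγ x hx).continuousAt
    filter_upwards [hc.preimage_mem_nhds (φ'.open_source.mem_nhds (hx' x hx))] with u hu
    exact φ'.left_inv hu
  change ENNReal.ofReal (absDet (fderiv ℝ ψ (φ x))) * chartDensity I φ' (ψ (φ x)) = _
  simp only [chartDensity]
  rw [← ENNReal.ofReal_mul (absDet_nonneg _), ← ENNReal.ofReal_mul (absDet_nonneg _), mul_comm, h1]

/-- Change of variables for the left-invariant density. -/
theorem IsLeftDensity.map_withDensity_jac [SecondCountableTopology G] [ν.IsAddHaarMeasure]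
    (hμ : IsLeftDensity I ν μ) (F : G ≃ₜ G) (hF : ContMDiff I I ∞ F) :
    (μ.withDensity fun x => ENNReal.ofReal (jac I F x)).map F = μ := by
  have hjm : Measurable fun x => ENNReal.ofReal (jac I F x) :=
    ENNReal.measurable_ofReal.comp (continuous_jac hF).measurable
  -- In this form the claim is local on the source: it is checked in one chart at `x` and one at `F
  -- x`, and second countability leaves only countably many such neighbourhoods to glue.
  have key : (μ.withDensity fun x => ENNReal.ofReal (jac I F x)) = μ.map F.symm := by
    have hloc : ∀ x : G, ∃ O : Set G, IsOpen O ∧ x ∈ O ∧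
        (μ.withDensity fun x => ENNReal.ofReal (jac I F x)).restrict O =
          (μ.map F.symm).restrict O := by
      intro x
      obtain ⟨φ, hx, hφ, h⟩ := hμ x
      obtain ⟨φ', hx', hφ', h'⟩ := hμ (F x)
      refine ⟨φ.source ∩ F ⁻¹' φ'.source,
        φ.open_source.inter (φ'.open_source.preimage F.continuous), ⟨hx, hx'⟩, ?_⟩
      have hO := (φ.open_source.inter (φ'.open_source.preimage F.continuous)).measurableSet
      ext T hT
      rw [Measure.restrict_apply hT, Measure.restrict_apply hT]
      set S := T ∩ (φ.source ∩ F ⁻¹' φ'.source)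
      have hS : MeasurableSet S := hT.inter hO
      have hS1 : S ⊆ φ.source := fun y hy => hy.2.1
      have hS2 : F '' S ⊆ φ'.source := by rintro _ ⟨y, hy, rfl⟩; exact hy.2.2
      have himg : F.symm ⁻¹' S = F '' S := by
        ext y; constructor
        · intro hy; exact ⟨_, hy, F.apply_symm_apply y⟩
        · rintro ⟨z, hz, rfl⟩; simpa using hz
      rw [withDensity_apply _ hS, Measure.map_apply F.symm.continuous.measurable hS, himg,
        h' _ hS2 (himg ▸ F.symm.continuous.measurable hS),
        lintegral_chartDensity_image hφ hφ' hF F.injective hS1 hS hS2,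
        setLIntegral_eq_of_chart hφ h hS1 hS hjm]
    choose O hO hxO hOr using hloc
    obtain ⟨s, hs, hcov⟩ := TopologicalSpace.countable_cover_nhds
      fun x => (hO x).mem_nhds (hxO x)
    have : Countable s := hs
    refine (Measure.ext_iff_of_iUnion_eq_univ (s := fun x : s => O x) ?_).2 fun x => hOr x
    simpa [Set.iUnion_subtype] using hcov
  rw [key, Measure.map_map F.continuous.measurable F.symm.continuous.measurable]
  simp

theorem IsLeftDensity.lintegral_comp_mul_jac [SecondCountableTopology G] [ν.IsAddHaarMeasure]
    (hμ : IsLeftDensity I ν μ) (F : G ≃ₜ G) (hF : ContMDiff I I ∞ F) {g : G → ENNReal}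
    (hg : Measurable g) :
    ∫⁻ x, ENNReal.ofReal (jac I F x) * g (F x) ∂μ = ∫⁻ x, g x ∂μ := by
  have hjm : Measurable fun x => ENNReal.ofReal (jac I F x) :=
    ENNReal.measurable_ofReal.comp (continuous_jac hF).measurable
  conv_rhs => rw [← hμ.map_withDensity_jac F hF]
  rw [lintegral_map hg F.continuous.measurable,
    lintegral_withDensity_eq_lintegral_mul (g := fun x => g (F x)) _ hjm
      (hg.comp F.continuous.measurable)]
  rfl

/-- The density is continuous in the chart, so near a point it stays below its value there plus one.
-/
theorem IsLeftDensity.isLocallyFiniteMeasure [IsLocallyFiniteMeasure ν]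
    (hμ : IsLeftDensity I ν μ) : IsLocallyFiniteMeasure μ := by
  refine ⟨fun x => ?_⟩
  obtain ⟨φ, hx, hφ, h⟩ := hμ x
  have hu := φ.map_source hx
  obtain ⟨N₁, hN₁, hN₁o, hN₁f⟩ := ν.exists_isOpen_measure_lt_top (φ x)
  have hc := (continuousOn_chartDensity hφ).continuousAt (φ.open_target.mem_nhds hu)
  have hlt : chartDensity I φ (φ x) < chartDensity I φ (φ x) + 1 :=
    ENNReal.lt_add_right ENNReal.ofReal_ne_top one_ne_zero
  have hev := (hc.eventually_lt continuousAt_const hlt)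
  obtain ⟨N₂, hN₂, hN₂o, hN₂x⟩ := mem_nhds_iff.1 hev
  have hSo : IsOpen (φ.source ∩ φ ⁻¹' (N₁ ∩ N₂)) := φ.isOpen_inter_preimage (hN₁o.inter hN₂o)
  refine ⟨_, hSo.mem_nhds ⟨hx, hN₁, hN₂x⟩, ?_⟩
  rw [h _ Set.inter_subset_left hSo.measurableSet]
  calc ∫⁻ u in φ '' (φ.source ∩ φ ⁻¹' (N₁ ∩ N₂)), chartDensity I φ u ∂ν
      ≤ ∫⁻ u in N₁ ∩ N₂, chartDensity I φ u ∂ν := by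
        refine lintegral_mono_set ?_
        rintro _ ⟨y, hy, rfl⟩
        exact hy.2
    _ ≤ ∫⁻ u in N₁ ∩ N₂, (chartDensity I φ (φ x) + 1) ∂ν :=
        setLIntegral_mono measurable_const fun u hu => (hN₂ hu.2).le
    _ = (chartDensity I φ (φ x) + 1) * ν (N₁ ∩ N₂) := by simp
    _ < ⊤ := ENNReal.mul_lt_top (by simp [chartDensity])
        ((measure_mono Set.inter_subset_left).trans_lt hN₁f)

end Density

/-! ### Left-invariant densities on products. -/

section Prod

variable {V H G V' H' G' : Type*}
  [NormedAddCommGroup V] [NormedSpace ℝ V] [FiniteDimensional ℝ V]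
  [MeasurableSpace V] [BorelSpace V] [TopologicalSpace H]
  [TopologicalSpace G] [ChartedSpace H G] [Group G] [MeasurableSpace G] [BorelSpace G]
  [NormedAddCommGroup V'] [NormedSpace ℝ V'] [FiniteDimensional ℝ V']
  [MeasurableSpace V'] [BorelSpace V'] [TopologicalSpace H']
  [TopologicalSpace G'] [ChartedSpace H' G'] [Group G'] [MeasurableSpace G'] [BorelSpace G']
  {I : ModelWithCorners ℝ V H} {I' : ModelWithCorners ℝ V' H'}
  [LieGroup I ∞ G] [LieGroup I' ∞ G'] [SecondCountableTopology G] [SecondCountableTopology G']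
  {φ : OpenPartialHomeomorph G V} {φ' : OpenPartialHomeomorph G' V'}
  {ν : Measure V} {μ : Measure G} {ν' : Measure V'} {μ' : Measure G'}

theorem IsSmoothChart.prod (hφ : IsSmoothChart I φ) (hφ' : IsSmoothChart I' φ') :
    IsSmoothChart (I.prod I') (φ.prod φ') := by
  constructor
  · have h : ContMDiffOn (I.prod I') 𝓘(ℝ, V × V') ∞ (fun q : G × G' => (φ q.1, φ' q.2))
        (φ.source ×ˢ φ'.source) :=
      (hφ.1.comp contMDiffOn_fst fun q hq => hq.1).prodMk_space
        (hφ'.1.comp contMDiffOn_snd fun q hq => hq.2)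
    exact h
  · have h1 : ContMDiffOn 𝓘(ℝ, V × V') 𝓘(ℝ, V) ∞ (Prod.fst : V × V' → V) Set.univ :=
      contDiff_fst.contMDiff.contMDiffOn
    have h2 : ContMDiffOn 𝓘(ℝ, V × V') 𝓘(ℝ, V') ∞ (Prod.snd : V × V' → V') Set.univ :=
      contDiff_snd.contMDiff.contMDiffOn
    have h : ContMDiffOn 𝓘(ℝ, V × V') (I.prod I') ∞
        (fun q : V × V' => (φ.symm q.1, φ'.symm q.2)) (φ.target ×ˢ φ'.target) :=
      (hφ.2.comp (h1.mono (Set.subset_univ _)) fun q hq => hq.1).prodMk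
        (hφ'.2.comp (h2.mono (Set.subset_univ _)) fun q hq => hq.2)
    exact h

theorem chartDensity_prod (hφ : IsSmoothChart I φ) (hφ' : IsSmoothChart I' φ')
    {q : V × V'} (h1 : q.1 ∈ φ.target) (h2 : q.2 ∈ φ'.target) :
    chartDensity (I.prod I') (φ.prod φ') q = chartDensity I φ q.1 * chartDensity I' φ' q.2 := by
  have hd := (hφ.2.contMDiffAt (φ.open_target.mem_nhds h1)).mdifferentiableAt (by simp)
  have hd' := (hφ'.2.contMDiffAt (φ'.open_target.mem_nhds h2)).mdifferentiableAt (by simp)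
  have hf : MDifferentiableAt 𝓘(ℝ, V × V') 𝓘(ℝ, V) (Prod.fst : V × V' → V) q :=
    differentiableAt_fst.mdifferentiableAt
  have hs : MDifferentiableAt 𝓘(ℝ, V × V') 𝓘(ℝ, V') (Prod.snd : V × V' → V') q :=
    differentiableAt_snd.mdifferentiableAt
  have hg : MDifferentiableAt 𝓘(ℝ, V) I (fun u => (φ.symm q.1)⁻¹ * φ.symm u) q.1 :=
    (mdifferentiable_mul_left _ _).comp _ hd
  have hg' : MDifferentiableAt 𝓘(ℝ, V') I' (fun u => (φ'.symm q.2)⁻¹ * φ'.symm u) q.2 :=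
    (mdifferentiable_mul_left _ _).comp _ hd'
  have hgf : MDifferentiableAt 𝓘(ℝ, V × V') I
    (fun u : V × V' => (φ.symm q.1)⁻¹ * φ.symm u.1) q := hg.comp q hf
  have hgs : MDifferentiableAt 𝓘(ℝ, V × V') I'
    (fun u : V × V' => (φ'.symm q.2)⁻¹ * φ'.symm u.2) q := hg'.comp q hs
  have h : leftDeriv 𝓘(ℝ, V × V') (I.prod I') (φ.prod φ').symm q =
      (leftDeriv 𝓘(ℝ, V) I φ.symm q.1).prodMap (leftDeriv 𝓘(ℝ, V') I' φ'.symm q.2) := by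
    have h0 : (fun u => ((φ.prod φ').symm q)⁻¹ * (φ.prod φ').symm u) =
      fun u : V × V' => ((φ.symm q.1)⁻¹ * φ.symm u.1, (φ'.symm q.2)⁻¹ * φ'.symm u.2) := rfl
    rw [leftDeriv, h0, modelDeriv_prodMk hgf hgs, modelDeriv_comp hg hf, modelDeriv_comp hg' hs,
      modelDeriv_eq_fderiv, modelDeriv_eq_fderiv, fderiv_fst, fderiv_snd]
    rfl
  rw [chartDensity, h, absDet_prodMap, ENNReal.ofReal_mul (absDet_nonneg _)]
  rfl

theorem IsLeftDensity.prod [SigmaFinite ν] [SigmaFinite ν'] [SigmaFinite μ] [SigmaFinite μ']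
    (hμ : IsLeftDensity I ν μ) (hμ' : IsLeftDensity I' ν' μ') :
    IsLeftDensity (I.prod I') (ν.prod ν') (μ.prod μ') := by
  rintro ⟨g, g'⟩
  obtain ⟨φ, hg, hφ, h⟩ := hμ g
  obtain ⟨φ', hg', hφ', h'⟩ := hμ' g'
  have hp := hφ.prod hφ'
  refine ⟨φ.prod φ', ⟨hg, hg'⟩, hp, ?_⟩
  have hO : MeasurableSet (φ.prod φ').target := (φ.prod φ').open_target.measurableSet
  -- `τ` integrates the product density in the product chart. A product measure is determined by
  -- rectangles, so comparing the two there, where the density factors, settles all measurable sets.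
  set τ : Measure (G × G') := (((ν.prod ν').restrict (φ.prod φ').target).withDensity
    (chartDensity (I.prod I') (φ.prod φ'))).map (φ.prod φ').symm
  have hτ : ∀ S, MeasurableSet S → τ S =
      ∫⁻ u in (φ.prod φ') '' ((φ.prod φ').source ∩ S),
        chartDensity (I.prod I') (φ.prod φ') u ∂(ν.prod ν') := by
    intro S hS
    have hae : AEMeasurable (φ.prod φ').symm (((ν.prod ν').restrict (φ.prod φ').target).withDensity
        (chartDensity (I.prod I') (φ.prod φ'))) :=
      ((φ.prod φ').continuousOn_symm.aemeasurable hO).mono_ac (withDensity_absolutelyContinuous _ _)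
    rw [Measure.map_apply_of_aemeasurable hae hS, withDensity_apply', Measure.restrict_restrict' hO,
      OpenPartialHomeomorph.image_source_inter_eq', Set.inter_comm]
  have hrect : (μ.restrict φ.source).prod (μ'.restrict φ'.source) = τ := by
    refine Measure.prod_eq fun s t hs ht => ?_
    have hms := φ.open_source.measurableSet.inter hs
    have hmt := φ'.open_source.measurableSet.inter ht
    have himg : (φ.prod φ') '' ((φ.prod φ').source ∩ s ×ˢ t) =
        (φ '' (φ.source ∩ s)) ×ˢ (φ' '' (φ'.source ∩ t)) := by
      rw [Set.prod_image_image_eq]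
      congr 1
      ext q
      simp only [OpenPartialHomeomorph.prod_source, Set.mem_inter_iff, Set.mem_prod]
      tauto
    have hA := measurableSet_image_chart (φ := φ) Set.inter_subset_left hms
    have hB := measurableSet_image_chart (φ := φ') Set.inter_subset_left hmt
    have hA' : φ '' (φ.source ∩ s) ⊆ φ.target := by
      rintro _ ⟨x, hx, rfl⟩; exact φ.map_source hx.1
    have hB' : φ' '' (φ'.source ∩ t) ⊆ φ'.target := by
      rintro _ ⟨x, hx, rfl⟩; exact φ'.map_source hx.1
    rw [hτ _ (hs.prod ht), himg, setLIntegral_congr_fun (hA.prod hB)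
      (fun q hq => chartDensity_prod hφ hφ' (hA' hq.1) (hB' hq.2)), ← Measure.prod_restrict,
      lintegral_prod_mul (aemeasurable_chartDensity hφ hA' hA)
        (aemeasurable_chartDensity hφ' hB' hB), Measure.restrict_apply hs,
      Measure.restrict_apply ht, Set.inter_comm s, Set.inter_comm t,
      h _ Set.inter_subset_left hms, h' _ Set.inter_subset_left hmt]
  intro S hS hm
  rw [Measure.prod_restrict] at hrect
  have h1 : (φ.prod φ').source ∩ S = S := Set.inter_eq_right.2 hS
  have h2 := hτ S hm
  have h3 : S ∩ φ.source ×ˢ φ'.source = S := Set.inter_eq_left.2 hS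
  rw [h1, ← hrect, Measure.restrict_apply hm, h3] at h2
  exact h2

end Prod

/-! ### The left measure of a Lie group -/

section LeftMeasure

variable (d : ℕ) (H : Type*) [TopologicalSpace H] [ChartedSpace (E d) H] [Group H]
  [LieGroup (𝓡 d) ∞ H] [MeasurableSpace H] [BorelSpace H]

theorem isSmoothChart_chartAt (h : H) : IsSmoothChart (𝓡 d) (chartAt (E d) h) :=
  ⟨contMDiffOn_chart, contMDiffOn_chart_symm⟩

theorem chartMeasure_apply {S : Set H} (hS : S ⊆ (chartAt (E d) (1 : H)).source)
    (hm : MeasurableSet S) :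
    chartMeasure d H S = ∫⁻ u in chartAt (E d) (1 : H) '' S,
      chartDensity (𝓡 d) (chartAt (E d) (1 : H)) u := by
  set φ := chartAt (E d) (1 : H)
  have hO : MeasurableSet φ.target := φ.open_target.measurableSet
  have h : chartMeasure d H = ((volume.restrict φ.target).withDensity
      (chartDensity (𝓡 d) φ)).map φ.symm := by
    have h1 : ⇑(extChartAt (𝓡 d) (1 : H)).symm = φ.symm := by
      ext u; simp [φ]
    have h2 : (extChartAt (𝓡 d) (1 : H)).target = φ.target := by simp [φ]
    have h3 : (fun u => ENNReal.ofReal (densityInChart d H u)) = chartDensity (𝓡 d) φ := by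
      ext u
      rw [densityInChart, h1]
      rfl
    rw [chartMeasure, h1, h2, h3]
  have hae : AEMeasurable φ.symm ((volume.restrict φ.target).withDensity (chartDensity (𝓡 d) φ)) :=
    (φ.continuousOn_symm.aemeasurable hO).mono_ac (withDensity_absolutelyContinuous _ _)
  rw [h, Measure.map_apply_of_aemeasurable hae hm, withDensity_apply',
    Measure.restrict_restrict' hO, φ.image_eq_target_inter_inv_preimage hS, Set.inter_comm]

variable {H} in
/-- The left translate of the chart at the identity. -/
def translatedChart (c : H) : OpenPartialHomeomorph H (E d) :=
  haveI : IsTopologicalGroup H := topologicalGroup_of_lieGroup (𝓡 d) ∞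
  (Homeomorph.mulLeft c⁻¹).toOpenPartialHomeomorph.trans (chartAt (E d) (1 : H))

variable {H}

theorem translatedChart_source (c : H) : (translatedChart d c).source =
    (fun g => c * g) '' (chartAt (E d) (1 : H)).source := by
  ext x
  simp only [translatedChart, OpenPartialHomeomorph.trans_source, Set.mem_image]
  constructor
  · intro hx
    exact ⟨c⁻¹ * x, hx.2, by simp⟩
  · rintro ⟨y, hy, rfl⟩
    exact ⟨trivial, by simpa using hy⟩

theorem translatedChart_apply (c x : H) :
    translatedChart d c x = chartAt (E d) (1 : H) (c⁻¹ * x) := rfl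

theorem translatedChart_symm (c : H) : ⇑(translatedChart d c).symm =
    fun u => c * (chartAt (E d) (1 : H)).symm u := by
  ext u
  change (c⁻¹)⁻¹ * (chartAt (E d) (1 : H)).symm u = _
  rw [inv_inv]

theorem translatedChart_target (c : H) :
    (translatedChart d c).target = (chartAt (E d) (1 : H)).target := by
  simp [translatedChart]

theorem isSmoothChart_translatedChart (c : H) : IsSmoothChart (𝓡 d) (translatedChart d c) := by
  have h := isSmoothChart_chartAt d H 1
  constructor
  · have : ContMDiffOn (𝓡 d) 𝓘(ℝ, E d) ∞ (fun x => chartAt (E d) (1 : H) (c⁻¹ * x))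
        (translatedChart d c).source := by
      refine h.1.comp contMDiff_mul_left.contMDiffOn ?_
      rw [translatedChart_source]
      rintro _ ⟨y, hy, rfl⟩
      simpa using hy
    exact this
  · rw [translatedChart_symm, translatedChart_target]
    exact (contMDiff_mul_left (a := c)).comp_contMDiffOn h.2

/-- The density is left invariant: in the translated chart it is the same function as in the chart
at the identity, by `leftDeriv_mul_left`. -/
theorem map_chartMeasure_apply (c : H) {S : Set H} (hS : S ⊆ (translatedChart d c).source)
    (hm : MeasurableSet S) :
    (chartMeasure d H).map (fun g => c * g) S =
      ∫⁻ u in translatedChart d c '' S, chartDensity (𝓡 d) (translatedChart d c) u := by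
  have : IsTopologicalGroup H := topologicalGroup_of_lieGroup (𝓡 d) ∞
  have hc : Measurable (fun g : H => c * g) := (continuous_const_mul c).measurable
  have h1 : (fun g => c * g) ⁻¹' S ⊆ (chartAt (E d) (1 : H)).source := by
    intro x hx
    have h2 := hS hx
    rw [translatedChart_source] at h2
    obtain ⟨y, hy, hxy⟩ := h2
    rwa [← mul_left_cancel hxy]
  rw [Measure.map_apply hc hm, chartMeasure_apply d H h1 (hc hm)]
  have h2 : translatedChart d c '' S = chartAt (E d) (1 : H) '' ((fun g => c * g) ⁻¹' S) := by
    ext u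
    constructor
    · rintro ⟨x, hx, rfl⟩
      exact ⟨c⁻¹ * x, by simpa using hx, rfl⟩
    · rintro ⟨x, hx, rfl⟩
      exact ⟨c * x, hx, by simp [translatedChart_apply]⟩
  rw [h2]
  congr 1
  ext u
  rw [chartDensity, chartDensity, translatedChart_symm, leftDeriv_mul_left]

/-- This is the change of variables between two charts for the identity map. Agreement on overlaps
makes `leftMeasure` independent of the pieces over which it is summed. -/
theorem map_chartMeasure_apply_eq (c c' : H) {S : Set H} (hS : S ⊆ (translatedChart d c).source)
    (hS' : S ⊆ (translatedChart d c').source) (hm : MeasurableSet S) :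
    (chartMeasure d H).map (fun g => c * g) S = (chartMeasure d H).map (fun g => c' * g) S := by
  rw [map_chartMeasure_apply d c hS hm, map_chartMeasure_apply d c' hS' hm]
  have h := lintegral_chartDensity_image (ν := volume) (isSmoothChart_translatedChart d c)
    (isSmoothChart_translatedChart d c') contMDiff_id Function.injective_id hS hm
    (by simpa using hS')
  rw [Set.image_id] at h
  have hj : ∀ x : H, jac (𝓡 d) id x = 1 := jac_id
  simpa [hj] using h.symm

/-- The left measure is given by the left-invariant density. -/
theorem isLeftDensity_leftMeasure [SecondCountableTopology H] :
    IsLeftDensity (𝓡 d) volume (leftMeasure d H) := by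
  have : IsTopologicalGroup H := topologicalGroup_of_lieGroup (𝓡 d) ∞
  intro c
  have h1 : (1 : H) ∈ (chartAt (E d) (1 : H)).source := mem_chart_source _ _
  refine ⟨translatedChart d c, ?_, isSmoothChart_translatedChart d c, fun S hS hm => ?_⟩
  · rw [translatedChart_source]
    exact ⟨1, h1, mul_one c⟩
  set U : ℕ → Set H := fun j => (fun g => TopologicalSpace.denseSeq H j * g) ''
    (extChartAt (𝓡 d) (1 : H)).source
  have hU : ∀ j, U j = (translatedChart d (TopologicalSpace.denseSeq H j)).source := by
    intro j
    rw [translatedChart_source, ← extChartAt_source (𝓡 d)]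
  have hUm : ∀ j, MeasurableSet (U j) := fun j => by
    rw [hU]; exact (translatedChart d _).open_source.measurableSet
  have hcov : ⋃ i, disjointed U i = Set.univ := by
    rw [iUnion_disjointed, Set.eq_univ_iff_forall]
    intro g
    -- The centres `x` whose translated chart contains `g` form an open set, nonempty because `x =
    -- g` is one of them, so the dense sequence meets it.
    have hopen : IsOpen ((fun x : H => x⁻¹ * g) ⁻¹' (chartAt (E d) (1 : H)).source) :=
      (chartAt (E d) (1 : H)).open_source.preimage (by fun_prop)
    obtain ⟨j, hj⟩ := (TopologicalSpace.denseRange_denseSeq H).exists_mem_open hopen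
      ⟨g, by simp⟩
    refine Set.mem_iUnion.2 ⟨j, ?_⟩
    rw [hU, translatedChart_source]
    exact ⟨_, hj, by simp⟩
  have hdm : ∀ i, MeasurableSet (disjointed U i) := fun i => MeasurableSet.disjointed hUm i
  rw [← map_chartMeasure_apply d c hS hm, leftMeasure, Measure.sum_apply _ hm]
  have hterm : ∀ i, (((chartMeasure d H).map
      (fun g => TopologicalSpace.denseSeq H i * g)).restrict (disjointed U i)) S =
      (chartMeasure d H).map (fun g => c * g) (S ∩ disjointed U i) := by
    intro i
    rw [Measure.restrict_apply hm]
    refine map_chartMeasure_apply_eq d _ _ ?_ (Set.inter_subset_left.trans hS) (hm.inter (hdm i))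
    rw [← hU]
    exact Set.inter_subset_right.trans (disjointed_subset U i)
  rw [tsum_congr hterm, ← measure_iUnion, ← Set.inter_iUnion, hcov, Set.inter_univ]
  · intro i j hij
    exact ((disjoint_disjointed U) hij).mono Set.inter_subset_right Set.inter_subset_right
  · exact fun i => hm.inter (hdm i)

instance [SecondCountableTopology H] : IsLocallyFiniteMeasure (leftMeasure d H) :=
  (isLeftDensity_leftMeasure d).isLocallyFiniteMeasure

end LeftMeasure

end

section

/-! ### The factorization of a double Lie group is smooth -/

section Chart

variable {V H G : Type*} [NormedAddCommGroup V] [NormedSpace ℝ V] [TopologicalSpace H]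
  [TopologicalSpace G] [ChartedSpace H G]
  {I : ModelWithCorners ℝ V H} {φ : OpenPartialHomeomorph G V}

theorem IsSmoothChart.injective_modelDeriv (hφ : IsSmoothChart I φ) {x : G} (hx : x ∈ φ.source) :
    Function.Injective (modelDeriv I 𝓘(ℝ, V) φ x) := by
  have h1 := (hφ.1.contMDiffAt (φ.open_source.mem_nhds hx)).mdifferentiableAt (by simp)
  have h2 := (hφ.2.contMDiffAt (φ.open_target.mem_nhds (φ.map_source hx))).mdifferentiableAt
    (by simp)
  have h3 : (modelDeriv 𝓘(ℝ, V) I φ.symm (φ x)).comp (modelDeriv I 𝓘(ℝ, V) φ x) =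
      ContinuousLinearMap.id ℝ V := by
    rw [← modelDeriv_comp h2 h1, ← modelDeriv_id (I := I) x]
    refine modelDeriv_congr ?_
    filter_upwards [φ.open_source.mem_nhds hx] with y hy using φ.left_inv hy
  exact Function.LeftInverse.injective (DFunLike.congr_fun h3)

theorem IsSmoothChart.injective_modelDeriv_symm (hφ : IsSmoothChart I φ) {u : V}
    (hu : u ∈ φ.target) : Function.Injective (modelDeriv 𝓘(ℝ, V) I φ.symm u) := by
  have h1 := (hφ.2.contMDiffAt (φ.open_target.mem_nhds hu)).mdifferentiableAt (by simp)
  have h2 := (hφ.1.contMDiffAt (φ.open_source.mem_nhds (φ.map_target hu))).mdifferentiableAt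
    (by simp)
  have h3 : (modelDeriv I 𝓘(ℝ, V) φ (φ.symm u)).comp (modelDeriv 𝓘(ℝ, V) I φ.symm u) =
      ContinuousLinearMap.id ℝ V := by
    rw [← modelDeriv_comp h2 h1, ← modelDeriv_id (I := 𝓘(ℝ, V)) u]
    refine modelDeriv_congr ?_
    filter_upwards [φ.open_target.mem_nhds hu] with y hy using φ.right_inv hy
  exact Function.LeftInverse.injective (DFunLike.congr_fun h3)

end Chart

/-! ### Integral curves of left-invariant fields. -/

section OneParameter

variable {d e : ℕ} {K G : Type*} [TopologicalSpace K] [ChartedSpace (E d) K] [Group K]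
  [LieGroup (𝓡 d) ∞ K] [TopologicalSpace G] [ChartedSpace (E e) G] [Group G]
  [LieGroup (𝓡 e) ∞ G]

/-- Differentiate `f (a h) = f a * f h` at `h = 1`. Consequently a homomorphism carries integral
curves of left-invariant fields to such curves. -/
theorem modelDeriv_monoidHom (f : K →* G) (hf : ContMDiff (𝓡 d) (𝓡 e) ∞ f) (a : K) :
    (modelDeriv (𝓡 d) (𝓡 e) f a).comp (leftTranslation (𝓡 d) a) =
      (leftTranslation (𝓡 e) (f a)).comp (modelDeriv (𝓡 d) (𝓡 e) f 1) := by
  have hd := hf.mdifferentiable (by simp)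
  have h1 : modelDeriv (𝓡 d) (𝓡 e) f a = modelDeriv (𝓡 d) (𝓡 e) f (a * 1) := by simp
  have h2 : leftTranslation (𝓡 e) (f a) =
    modelDeriv (𝓡 e) (𝓡 e) (fun h : G => f a * h) (f 1) := by simp [leftTranslation]
  rw [h1, h2, leftTranslation, ← modelDeriv_comp (hd _) (mdifferentiable_mul_left _ _),
    ← modelDeriv_comp (mdifferentiable_mul_left _ _) (hd _)]
  simp

theorem contMDiffAt_invariantField (v : E d) (a : K) :
    ContMDiffAt (𝓡 d) (𝓡 d).tangent 1 (fun x : K =>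
      (⟨x, mulInvariantVectorField (I := 𝓡 d) (G := K) v x⟩ : TangentBundle (𝓡 d) K)) a := by
  have : LieGroup (𝓡 d) (minSmoothness ℝ 3) K := LieGroup.of_le (n := ∞) (by
    rw [minSmoothness_of_isRCLikeNormedField]
    exact WithTop.coe_le_coe.2 (le_top : (3 : ℕ∞) ≤ ⊤))
  exact (contMDiffAt_mulInvariantVectorField (I := 𝓡 d) (G := K) v).of_le (by simp)

/-- A local one-parameter curve with a given velocity. -/
theorem exists_invariantCurve (v : E d) : ∃ γ : ℝ → K, γ 0 = 1 ∧
    ∀ᶠ t in nhds (0 : ℝ), MDifferentiableAt 𝓘(ℝ, ℝ) (𝓡 d) γ t ∧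
      modelDeriv 𝓘(ℝ, ℝ) (𝓡 d) γ t =
        (1 : ℝ →L[ℝ] ℝ).smulRight (leftTranslation (𝓡 d) (γ t) v) := by
  have : IsManifold (𝓡 d) 1 K := .of_le (n := ∞) (by simp)
  obtain ⟨γ, h0, hγ⟩ := exists_isMIntegralCurveAt_of_contMDiffAt_boundaryless (I := 𝓡 d) (M := K) 0
    (contMDiffAt_invariantField v 1)
  refine ⟨γ, h0, ?_⟩
  filter_upwards [hγ] with t ht
  exact ⟨ht.mdifferentiableAt, ht.mfderiv⟩

theorem invariantCurve_unique [T2Space G] (v : E e) {γ γ' : ℝ → G} (h0 : γ 0 = γ' 0)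
    (hγ : ∀ᶠ t in nhds (0 : ℝ), MDifferentiableAt 𝓘(ℝ, ℝ) (𝓡 e) γ t ∧
      modelDeriv 𝓘(ℝ, ℝ) (𝓡 e) γ t =
        (1 : ℝ →L[ℝ] ℝ).smulRight (leftTranslation (𝓡 e) (γ t) v))
    (hγ' : ∀ᶠ t in nhds (0 : ℝ), MDifferentiableAt 𝓘(ℝ, ℝ) (𝓡 e) γ' t ∧
      modelDeriv 𝓘(ℝ, ℝ) (𝓡 e) γ' t =
        (1 : ℝ →L[ℝ] ℝ).smulRight (leftTranslation (𝓡 e) (γ' t) v)) :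
    γ =ᶠ[nhds 0] γ' := by
  have : IsManifold (𝓡 e) 1 G := .of_le (n := ∞) (by simp)
  have conv : ∀ {γ : ℝ → G}, (∀ᶠ t in nhds (0 : ℝ), MDifferentiableAt 𝓘(ℝ, ℝ) (𝓡 e) γ t ∧
      modelDeriv 𝓘(ℝ, ℝ) (𝓡 e) γ t =
        (1 : ℝ →L[ℝ] ℝ).smulRight (leftTranslation (𝓡 e) (γ t) v)) →
      IsMIntegralCurveAt (I := 𝓡 e) γ (mulInvariantVectorField (I := 𝓡 e) (G := G) v) 0 := by
    intro γ hγ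
    filter_upwards [hγ] with t ht
    have h := ht.1.hasMFDerivAt
    have h2 : mfderiv 𝓘(ℝ, ℝ) (𝓡 e) γ t = _ := ht.2
    rw [h2] at h
    exact h
  exact isMIntegralCurveAt_eventuallyEq_of_contMDiffAt_boundaryless
    (contMDiffAt_invariantField v _) (conv hγ) (conv hγ') h0

theorem invariantCurve_map (f : K →* G) (hf : ContMDiff (𝓡 d) (𝓡 e) ∞ f) {v : E d} {γ : ℝ → K}
    (hγ : ∀ᶠ t in nhds (0 : ℝ), MDifferentiableAt 𝓘(ℝ, ℝ) (𝓡 d) γ t ∧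
      modelDeriv 𝓘(ℝ, ℝ) (𝓡 d) γ t =
        (1 : ℝ →L[ℝ] ℝ).smulRight (leftTranslation (𝓡 d) (γ t) v)) :
    ∀ᶠ t in nhds (0 : ℝ), MDifferentiableAt 𝓘(ℝ, ℝ) (𝓡 e) (fun t => f (γ t)) t ∧
      modelDeriv 𝓘(ℝ, ℝ) (𝓡 e) (fun t => f (γ t)) t =
        (1 : ℝ →L[ℝ] ℝ).smulRight
          (leftTranslation (𝓡 e) (f (γ t)) (modelDeriv (𝓡 d) (𝓡 e) f 1 v)) := by
  have hd := hf.mdifferentiable (by simp)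
  filter_upwards [hγ] with t ht
  refine ⟨(hd _).comp _ ht.1, ?_⟩
  rw [modelDeriv_comp (hd _) ht.1, ht.2]
  have h := DFunLike.congr_fun (modelDeriv_monoidHom f hf (γ t)) v
  simp only [ContinuousLinearMap.comp_apply] at h
  ext s
  simp [← h]

end OneParameter

/-! ### The product map `A × B → G` and its smooth inverse. -/

namespace DoubleLieGroup

variable {G : Type*} [TopologicalSpace G] [T2Space G] [SecondCountableTopology G] [Group G]
  {n p k : ℕ} [ChartedSpace (E n) G] [LieGroup (𝓡 n) ∞ G] {A B : Subgroup G}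
  [ChartedSpace (E p) A] [LieGroup (𝓡 p) ∞ A] [ChartedSpace (E k) B] [LieGroup (𝓡 k) ∞ B]
  (D : DoubleLieGroup n p k A B)

theorem mul_injective (D : DoubleLieGroup n p k A B) {a a' : A} {b b' : B} (h : (a : G) * b = a' * b') : a = a' ∧ b = b' := by
  have h1 : ((a' : G)⁻¹ * a) = b' * (b : G)⁻¹ := by
    rw [inv_mul_eq_iff_eq_mul, ← mul_assoc, ← h, mul_inv_cancel_right]
  have h2 : ((a' : G)⁻¹ * a) ∈ A ⊓ B :=
    ⟨A.mul_mem (A.inv_mem a'.2) a.2, h1 ▸ B.mul_mem b'.2 (B.inv_mem b.2)⟩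
  rw [D.inf_eq_bot, Subgroup.mem_bot] at h2
  constructor
  · exact Subtype.ext (inv_mul_eq_one.1 h2).symm
  · exact Subtype.ext (mul_inv_eq_one.1 (h1.symm.trans h2)).symm

theorem aL_mul (a : A) (b : B) : D.aL ((a : G) * b) = a :=
  (D.mul_injective (D.aL_mul_bR _)).1

theorem bR_mul (a : A) (b : B) : D.bR ((a : G) * b) = b :=
  (D.mul_injective (D.aL_mul_bR _)).2

/-- Multiplication `A × B → G`. -/
def mulMap (_ : DoubleLieGroup n p k A B) (q : A × B) : G := q.1 * q.2

/-- The factorization `G → A × B`. -/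
def factor (g : G) : A × B := (D.aL g, D.bR g)

theorem mulMap_factor (g : G) : D.mulMap (D.factor g) = g := D.aL_mul_bR g

theorem factor_mulMap (q : A × B) : D.factor (D.mulMap q) = q :=
  Prod.ext (D.aL_mul _ _) (D.bR_mul _ _)

theorem contMDiff_mulMap : ContMDiff ((𝓡 p).prod (𝓡 k)) (𝓡 n) ∞ D.mulMap :=
  (D.smooth_left.comp contMDiff_fst).mul (D.smooth_right.comp contMDiff_snd)

/-- The derivative at the identity is `(X, Y) ↦ dA X + dB Y`. If it vanishes, the curve in `A` with
velocity `X` and the curve in `B` with velocity `-Y` are integral curves of the same left-invariant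
field on `G`; they coincide near `0` and lie in `A ∩ B = {1}`, so `X = 0`, and then `Y = 0` because
`B` is immersed. -/
theorem injective_modelDeriv_mulMap :
    Function.Injective (modelDeriv ((𝓡 p).prod (𝓡 k)) (𝓡 n) D.mulMap 1) := by
  set dA := modelDeriv (𝓡 p) (𝓡 n) (fun a : A => (a : G)) 1
  set dB := modelDeriv (𝓡 k) (𝓡 n) (fun b : B => (b : G)) 1
  have hsA := D.smooth_left.mdifferentiable (by simp)
  have hsB := D.smooth_right.mdifferentiable (by simp)
  have hm := D.contMDiff_mulMap.mdifferentiable (by simp) (1 : A × B)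
  have hidA : MDifferentiableAt (𝓡 p) (𝓡 p) (fun a : A => a) 1 := mdifferentiableAt_id
  have hidB : MDifferentiableAt (𝓡 k) (𝓡 k) (fun b : B => b) 1 := mdifferentiableAt_id
  have hD : ∀ v, modelDeriv ((𝓡 p).prod (𝓡 k)) (𝓡 n) D.mulMap 1 v = dA v.1 + dB v.2 := by
    intro v
    have h1 : modelDeriv (𝓡 p) (𝓡 n) (fun a : A => D.mulMap (a, 1)) 1 =
        (modelDeriv ((𝓡 p).prod (𝓡 k)) (𝓡 n) D.mulMap 1).comp
          (ContinuousLinearMap.inl ℝ (E p) (E k)) := by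
      rw [modelDeriv_comp (f := fun a : A => (a, (1 : B))) hm
        (hidA.prodMk mdifferentiableAt_const),
        modelDeriv_prodMk hidA mdifferentiableAt_const]
      congr 1
      ext1 w
      exact Prod.ext (DFunLike.congr_fun (modelDeriv_id (I := 𝓡 p) (1 : A)) w)
        (DFunLike.congr_fun (modelDeriv_const (I := 𝓡 p) (I' := 𝓡 k) (1 : B) (1 : A)) w)
    have h2 : modelDeriv (𝓡 k) (𝓡 n) (fun b : B => D.mulMap (1, b)) 1 =
        (modelDeriv ((𝓡 p).prod (𝓡 k)) (𝓡 n) D.mulMap 1).comp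
          (ContinuousLinearMap.inr ℝ (E p) (E k)) := by
      rw [modelDeriv_comp (f := fun b : B => ((1 : A), b)) hm
        (mdifferentiableAt_const.prodMk hidB),
        modelDeriv_prodMk mdifferentiableAt_const hidB]
      congr 1
      ext1 w
      exact Prod.ext
        (DFunLike.congr_fun (modelDeriv_const (I := 𝓡 k) (I' := 𝓡 p) (1 : A) (1 : B)) w)
        (DFunLike.congr_fun (modelDeriv_id (I := 𝓡 k) (1 : B)) w)
    simp only [mulMap, Subgroup.coe_one, mul_one, one_mul] at h1 h2
    have h3 : v = ContinuousLinearMap.inl ℝ (E p) (E k) v.1 +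
      ContinuousLinearMap.inr ℝ (E p) (E k) v.2 := by simp
    conv_lhs => rw [h3, map_add]
    exact congrArg₂ (· + ·) (DFunLike.congr_fun h1 v.1).symm (DFunLike.congr_fun h2 v.2).symm
  have hA : Function.Injective dA := D.immersive_left 1
  have hB : Function.Injective dB := D.immersive_right 1
  rw [injective_iff_map_eq_zero]
  rintro ⟨X, Y⟩ h
  rw [hD] at h
  have hXY : dA X = dB (-Y) := by rw [map_neg]; exact eq_neg_of_add_eq_zero_left h
  obtain ⟨γ, h0, hγ⟩ := exists_invariantCurve (K := A) X
  obtain ⟨γ', h0', hγ'⟩ := exists_invariantCurve (K := B) (-Y)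
  have e1 := invariantCurve_map A.subtype D.smooth_left hγ
  have e2 := invariantCurve_map B.subtype D.smooth_right hγ'
  have hXY' : modelDeriv (𝓡 p) (𝓡 n) A.subtype 1 X = modelDeriv (𝓡 k) (𝓡 n) B.subtype 1 (-Y) := hXY
  rw [hXY'] at e1
  have heq := invariantCurve_unique _ (by simp [h0, h0']) e1 e2
  have hone : γ =ᶠ[nhds 0] fun _ => 1 := by
    filter_upwards [heq] with t ht
    have hmem : (γ t : G) ∈ A ⊓ B := ⟨(γ t).2, by
      have : (γ t : G) = γ' t := ht
      rw [this]; exact (γ' t).2⟩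
    rw [D.inf_eq_bot, Subgroup.mem_bot] at hmem
    exact Subtype.ext hmem
  have hX : X = 0 := by
    have h1 := hγ.self_of_nhds.2
    rw [modelDeriv_congr hone, modelDeriv_const, h0] at h1
    have h2 := DFunLike.congr_fun h1 (1 : ℝ)
    have h3 : leftTranslation (𝓡 p) (1 : A) = ContinuousLinearMap.id ℝ (E p) := by
      simp only [leftTranslation, one_mul]
      exact modelDeriv_id _
    rw [h3] at h2
    simpa using h2.symm
  subst hX
  have hY : Y = 0 := by
    have h4 : dB (-Y) = dB 0 := by rw [← hXY, map_zero, map_zero]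
    simpa using hB h4
  rw [hY]
  rfl

/-- The group `A × B` acts transitively on `G` by `(a, b) · g = a g b⁻¹`. It is σ-compact and `G` is
locally compact Hausdorff, so the orbit map of `1` is open by the Baire category argument; inverting
`b` turns it into the product map. -/
theorem isOpenMap_mulMap : IsOpenMap D.mulMap := by
  have : IsTopologicalGroup G := topologicalGroup_of_lieGroup (𝓡 n) ∞
  have : LocallyCompactSpace G := Manifold.locallyCompact_of_finiteDimensional (𝓡 n)
  have : LocallyCompactSpace A := Manifold.locallyCompact_of_finiteDimensional (𝓡 p)
  have : LocallyCompactSpace B := Manifold.locallyCompact_of_finiteDimensional (𝓡 k)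
  let _ : MulAction (A × B) G :=
    { smul := fun q g => q.1 * g * (q.2 : G)⁻¹
      one_smul := fun g => by
        change ((1 : A) : G) * g * ((1 : B) : G)⁻¹ = g
        simp
      mul_smul := fun q r g => by
        change ((q.1 * r.1 : A) : G) * g * ((q.2 * r.2 : B) : G)⁻¹ =
          q.1 * (r.1 * g * (r.2 : G)⁻¹) * (q.2 : G)⁻¹
        simp [mul_assoc] }
  have hs : ∀ (q : A × B) (g : G), q • g = q.1 * g * (q.2 : G)⁻¹ := fun _ _ => rfl
  have : ContinuousSMul (A × B) G := ⟨by simp only [hs]; fun_prop⟩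
  have : MulAction.IsPretransitive (A × B) G := by
    have h1 : ∀ g : G, ((D.aL g, (D.bR g)⁻¹) : A × B) • (1 : G) = g := fun g => by
      rw [hs, mul_one, Subgroup.coe_inv, inv_inv]
      exact D.aL_mul_bR g
    refine ⟨fun g g' => ⟨(D.aL g', (D.bR g')⁻¹) * (D.aL g, (D.bR g)⁻¹)⁻¹, ?_⟩⟩
    rw [mul_smul, inv_smul_eq_iff.2 (h1 g).symm, h1]
  have h := isOpenMap_smul_of_sigmaCompact (G := A × B) (1 : G)
  have h2 : D.mulMap = (fun q : A × B => q • (1 : G)) ∘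
      (Homeomorph.prodCongr (Homeomorph.refl A) (Homeomorph.inv B)) := by
    ext q
    simp [mulMap, hs]
  rw [h2]
  exact h.comp (Homeomorph.isOpenMap _)

variable [MeasurableSpace G] [BorelSpace G]

/-- Injectivity of the derivative gives one inequality. If it were strict, the product map in charts
would send a ball to a set of Hausdorff dimension below `n`, whose complement is dense, although
that image is open. -/
theorem finrank_eq (D : DoubleLieGroup n p k A B) :
    Module.finrank ℝ (E p × E k) = Module.finrank ℝ (E n) := by
  set L := modelDeriv ((𝓡 p).prod (𝓡 k)) (𝓡 n) D.mulMap 1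
  refine le_antisymm (LinearMap.finrank_le_finrank_of_injective (f := L.toLinearMap)
    D.injective_modelDeriv_mulMap) (le_of_not_gt fun hlt => ?_)
  set φ := (chartAt (E p) (1 : A)).prod (chartAt (E k) (1 : B))
  have hφ : IsSmoothChart ((𝓡 p).prod (𝓡 k)) φ :=
    (isSmoothChart_chartAt p A 1).prod (isSmoothChart_chartAt k B 1)
  set χ := chartAt (E n) (1 : G)
  have hχ : IsSmoothChart (𝓡 n) χ := isSmoothChart_chartAt n G 1
  have h1 : (1 : A × B) ∈ φ.source := ⟨mem_chart_source _ _, mem_chart_source _ _⟩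
  have hm1 : D.mulMap 1 = 1 := by simp [mulMap]
  have h2 : D.mulMap (φ.symm (φ 1)) ∈ χ.source := by
    rw [φ.left_inv h1, hm1]; exact mem_chart_source _ _
  have hcont := D.contMDiff_mulMap.continuous
  set O : Set (A × B) := φ.source ∩ D.mulMap ⁻¹' χ.source
  have hO : IsOpen O := φ.open_source.inter (χ.open_source.preimage hcont)
  have hU : IsOpen (φ.target ∩ φ.symm ⁻¹' O) := φ.isOpen_inter_preimage_symm hO
  have h1O : (1 : A × B) ∈ O := ⟨h1, by rw [Set.mem_preimage, hm1]; exact mem_chart_source _ _⟩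
  have hu : φ 1 ∈ φ.target ∩ φ.symm ⁻¹' O :=
    ⟨φ.map_source h1, by rw [Set.mem_preimage, φ.left_inv h1]; exact h1O⟩
  obtain ⟨r, hr, hball⟩ := Metric.isOpen_iff.1 hU _ hu
  set ψ : E p × E k → E n := fun u => χ (D.mulMap (φ.symm u))
  have hψ : ContDiffOn ℝ 1 ψ (Metric.ball (φ 1) r) := by
    have h : ContMDiffOn 𝓘(ℝ, E p × E k) 𝓘(ℝ, E n) ∞ ψ (φ.target ∩ φ.symm ⁻¹' O) :=
      hχ.1.comp (D.contMDiff_mulMap.comp_contMDiffOn (hφ.2.mono Set.inter_subset_left))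
        fun u hu => hu.2.2
    exact ((contMDiffOn_iff_contDiffOn.1 h).mono hball).of_le (by simp)
  have hdense : Dense (ψ '' Metric.ball (φ 1) r)ᶜ := by
    refine hψ.dense_compl_image_of_dimH_lt_finrank (convex_ball _ _) subset_rfl ?_
    refine (dimH_mono (Set.subset_univ _)).trans_lt ?_
    rw [Real.dimH_univ_eq_finrank]
    exact_mod_cast hlt
  have hopen : IsOpen (ψ '' Metric.ball (φ 1) r) := by
    have e : ψ '' Metric.ball (φ 1) r = χ '' (D.mulMap '' (φ.symm '' Metric.ball (φ 1) r)) := by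
      rw [Set.image_image, Set.image_image]
    rw [e]
    refine χ.isOpen_image_of_subset_source (D.isOpenMap_mulMap _
      (φ.symm.isOpen_image_of_subset_source Metric.isOpen_ball fun u hu => (hball hu).1)) ?_
    rintro _ ⟨_, ⟨u, hu, rfl⟩, rfl⟩
    exact (hball hu).2.2
  obtain ⟨y, hy1, hy2⟩ := hdense.inter_open_nonempty _ hopen ⟨_, φ 1, Metric.mem_ball_self hr, rfl⟩
  exact hy2 hy1

/-- Injectivity and equal dimensions make the derivative at the identity invertible, so the inverse
function theorem yields a smooth local inverse; by uniqueness of factorization it is `factor` near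
`1`. -/
theorem contMDiffAt_factor_one : ContMDiffAt (𝓡 n) ((𝓡 p).prod (𝓡 k)) ∞ D.factor 1 := by
  set φ := (chartAt (E p) (1 : A)).prod (chartAt (E k) (1 : B))
  have hφ : IsSmoothChart ((𝓡 p).prod (𝓡 k)) φ :=
    (isSmoothChart_chartAt p A 1).prod (isSmoothChart_chartAt k B 1)
  set χ := chartAt (E n) (1 : G)
  have hχ : IsSmoothChart (𝓡 n) χ := isSmoothChart_chartAt n G 1
  have h1 : (1 : A × B) ∈ φ.source := ⟨mem_chart_source _ _, mem_chart_source _ _⟩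
  have h1G : (1 : G) ∈ χ.source := mem_chart_source _ _
  have hm1 : D.mulMap 1 = 1 := by simp [mulMap]
  have ht := φ.map_source h1
  set ψ : E p × E k → E n := fun u => χ (D.mulMap (φ.symm u))
  have hγ : ContMDiffAt 𝓘(ℝ, E p × E k) ((𝓡 p).prod (𝓡 k)) ∞ φ.symm (φ 1) :=
    hφ.2.contMDiffAt (φ.open_target.mem_nhds ht)
  have hx : D.mulMap (φ.symm (φ 1)) = 1 := by rw [φ.left_inv h1, hm1]
  have hχ1 : ContMDiffAt (𝓡 n) 𝓘(ℝ, E n) ∞ χ (D.mulMap (φ.symm (φ 1))) := by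
    rw [hx]; exact hχ.1.contMDiffAt (χ.open_source.mem_nhds h1G)
  have hmγ : ContMDiffAt 𝓘(ℝ, E p × E k) (𝓡 n) ∞ (fun u => D.mulMap (φ.symm u)) (φ 1) :=
    (D.contMDiff_mulMap _).comp _ hγ
  have hψ : ContDiffAt ℝ ∞ ψ (φ 1) := contMDiffAt_iff_contDiffAt.1 (hχ1.comp (φ 1) hmγ)
  have hinj : Function.Injective (fderiv ℝ ψ (φ 1)) := by
    have h : fderiv ℝ ψ (φ 1) = (modelDeriv (𝓡 n) 𝓘(ℝ, E n) χ 1).comp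
        ((modelDeriv ((𝓡 p).prod (𝓡 k)) (𝓡 n) D.mulMap 1).comp
          (modelDeriv 𝓘(ℝ, E p × E k) ((𝓡 p).prod (𝓡 k)) φ.symm (φ 1))) := by
      rw [← modelDeriv_eq_fderiv, modelDeriv_comp (f := fun u => D.mulMap (φ.symm u))
        (hχ1.mdifferentiableAt (by simp)) (hmγ.mdifferentiableAt (by simp)), hx,
        modelDeriv_comp ((D.contMDiff_mulMap _).mdifferentiableAt (by simp))
          (hγ.mdifferentiableAt (by simp)), φ.left_inv h1]
    rw [h]
    exact (hχ.injective_modelDeriv h1G).comp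
      (D.injective_modelDeriv_mulMap.comp (hφ.injective_modelDeriv_symm ht))
  set e : (E p × E k) ≃L[ℝ] E n := (LinearEquiv.ofInjectiveOfFinrankEq
    (fderiv ℝ ψ (φ 1)).toLinearMap hinj D.finrank_eq).toContinuousLinearEquiv
  have hd : HasFDerivAt ψ (e : E p × E k →L[ℝ] E n) (φ 1) := by
    have h : (e : E p × E k →L[ℝ] E n) = fderiv ℝ ψ (φ 1) :=
      ContinuousLinearMap.ext fun v => rfl
    rw [h]
    exact (hψ.differentiableAt (by simp)).hasFDerivAt
  have hψ1 : ψ (φ 1) = χ 1 := by simp only [ψ, hx]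
  set ℓ := hψ.localInverse hd (by simp)
  have hℓ : ContDiffAt ℝ ∞ ℓ (χ 1) := hψ1 ▸ hψ.to_localInverse hd (by simp)
  have hℓ1 : ℓ (χ 1) = φ 1 := hψ1 ▸ hψ.localInverse_apply_image hd (by simp)
  have hright : ∀ᶠ y in nhds (χ 1), ψ (ℓ y) = y :=
    hψ1 ▸ (hψ.hasStrictFDerivAt' hd (by simp)).eventually_right_inverse
  have hχ1' : ContMDiffAt (𝓡 n) 𝓘(ℝ, E n) ∞ χ 1 := hχ.1.contMDiffAt (χ.open_source.mem_nhds h1G)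
  have hℓχ : ContMDiffAt (𝓡 n) 𝓘(ℝ, E p × E k) ∞ (fun g => ℓ (χ g)) 1 :=
    (contMDiffAt_iff_contDiffAt.2 hℓ).comp _ hχ1'
  have hfin : ContMDiffAt (𝓡 n) ((𝓡 p).prod (𝓡 k)) ∞ (fun g => φ.symm (ℓ (χ g))) 1 := by
    refine ContMDiffAt.comp (1 : G) (g := φ.symm) ?_ hℓχ
    rw [hℓ1]; exact hγ
  refine hfin.congr_of_eventuallyEq ?_
  -- The local inverse satisfies its equation only after applying `χ`; staying in the source of `χ`
  -- permits cancelling it.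
  have hsrc : ∀ᶠ g in nhds (1 : G), D.mulMap (φ.symm (ℓ (χ g))) ∈ χ.source := by
    have hc : ContinuousAt (fun g => D.mulMap (φ.symm (ℓ (χ g)))) 1 :=
      D.contMDiff_mulMap.continuous.continuousAt.comp hfin.continuousAt
    refine hc.preimage_mem_nhds (χ.open_source.mem_nhds ?_)
    rw [hℓ1, hx]; exact h1G
  filter_upwards [hsrc, χ.open_source.mem_nhds h1G,
    hχ1'.continuousAt.preimage_mem_nhds hright] with g hg1 hg2 hg3
  have h : D.mulMap (φ.symm (ℓ (χ g))) = g := χ.injOn hg1 hg2 hg3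
  rw [← D.factor_mulMap (φ.symm (ℓ (χ g))), h]

theorem contMDiff_factor : ContMDiff (𝓡 n) ((𝓡 p).prod (𝓡 k)) ∞ D.factor := by
  intro g
  set a := D.aL g
  set b := D.bR g
  have hg : (a : G)⁻¹ * g * (b : G)⁻¹ = 1 := by
    rw [mul_inv_eq_one, inv_mul_eq_iff_eq_mul]; exact (D.aL_mul_bR g).symm
  -- Multiplying by `a` on the left and `b` on the right respects factorizations, which reduces
  -- smoothness at `g = a b` to smoothness at `1`.
  have h : D.factor = fun x => (a * (D.factor ((a : G)⁻¹ * x * (b : G)⁻¹)).1,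
      (D.factor ((a : G)⁻¹ * x * (b : G)⁻¹)).2 * b) := by
    ext1 x
    rw [← D.factor_mulMap (_, _)]
    congr 1
    have h2 := D.mulMap_factor ((a : G)⁻¹ * x * (b : G)⁻¹)
    simp only [mulMap, Subgroup.coe_mul] at h2 ⊢
    rw [mul_assoc, ← mul_assoc ((D.factor ((a : G)⁻¹ * x * (b : G)⁻¹)).1 : G), h2]
    group
  have hs : ContMDiffAt (𝓡 n) ((𝓡 p).prod (𝓡 k)) ∞
      (fun x => D.factor ((a : G)⁻¹ * x * (b : G)⁻¹)) g := by
    refine ContMDiffAt.comp g (g := D.factor) ?_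
      ((contMDiffAt_const.mul contMDiffAt_id).mul contMDiffAt_const)
    rw [hg]
    exact D.contMDiffAt_factor_one
  rw [h]
  exact (contMDiffAt_const.mul (contMDiffAt_fst.comp g hs)).prodMk
    ((contMDiffAt_snd.comp g hs).mul contMDiffAt_const)

theorem contMDiff_aL : ContMDiff (𝓡 n) (𝓡 p) ∞ D.aL := contMDiff_fst.comp D.contMDiff_factor

theorem contMDiff_bR : ContMDiff (𝓡 n) (𝓡 k) ∞ D.bR := contMDiff_snd.comp D.contMDiff_factor

theorem contMDiff_bL : ContMDiff (𝓡 n) (𝓡 k) ∞ D.bL :=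
  (D.contMDiff_bR.comp (contMDiff_inv (𝓡 n) ∞)).inv

end DoubleLieGroup

end

section

/-! ### Integral operators on `L²` -/

section Schur

variable {X Y : Type*} [MeasurableSpace X] [MeasurableSpace Y] {μ : Measure X} {β : Measure Y}

theorem eLpNorm_two_sq (f : X → ℂ) : eLpNorm f 2 μ ^ 2 = ∫⁻ x, ‖f x‖ₑ ^ 2 ∂μ := by
  have h := eLpNorm_nnreal_pow_eq_lintegral (μ := μ) (f := f) (p := 2) (by norm_num)
  simpa using h

/-- Cauchy–Schwarz for the splitting `a g = √a · (√a g)`. -/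
theorem sq_lintegral_mul_le {a g : Y → ENNReal} (ha : AEMeasurable a β) (hg : AEMeasurable g β) :
    (∫⁻ t, a t * g t ∂β) ^ 2 ≤ (∫⁻ t, a t ∂β) * ∫⁻ t, a t * g t ^ 2 ∂β := by
  have h2 : (0 : ℝ) ≤ 1 / 2 := by norm_num
  have e1 : ∀ t, a t * g t = a t ^ (1 / 2 : ℝ) * (a t ^ (1 / 2 : ℝ) * g t) := fun t => by
    rw [← mul_assoc, ← ENNReal.rpow_add_of_nonneg _ _ h2 h2]; norm_num
  have e2 : ∀ t, (a t ^ (1 / 2 : ℝ)) ^ (2 : ℝ) = a t := fun t => by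
    rw [← ENNReal.rpow_mul]; norm_num
  have e3 : ∀ t, (a t ^ (1 / 2 : ℝ) * g t) ^ (2 : ℝ) = a t * g t ^ 2 := fun t => by
    rw [ENNReal.mul_rpow_of_nonneg _ _ (by norm_num), e2]; norm_num
  have h := ENNReal.lintegral_mul_le_Lp_mul_Lq β Real.HolderConjugate.two_two
    (f := fun t => a t ^ (1 / 2 : ℝ)) (g := fun t => a t ^ (1 / 2 : ℝ) * g t)
    (ha.pow_const _) ((ha.pow_const _).mul hg)
  simp only [Pi.mul_apply, ← e1, e2, e3] at h
  calc (∫⁻ t, a t * g t ∂β) ^ 2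
      ≤ ((∫⁻ t, a t ∂β) ^ (1 / 2 : ℝ) * (∫⁻ t, a t * g t ^ 2 ∂β) ^ (1 / 2 : ℝ)) ^ 2 := by gcongr
    _ = _ := by
        rw [mul_pow, ← ENNReal.rpow_natCast, ← ENNReal.rpow_natCast, ← ENNReal.rpow_mul,
          ← ENNReal.rpow_mul]
        norm_num

variable [SigmaFinite μ] [SigmaFinite β]

theorem ae_ae_swap_of_ae_prod {P : Y × X → Prop} (h : ∀ᵐ q ∂(β.prod μ), P q) :
    ∀ᵐ x ∂μ, ∀ᵐ t ∂β, P (t, x) :=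
  Measure.ae_ae_of_ae_prod
    (Measure.measurePreserving_swap (μ := μ) (ν := β).quasiMeasurePreserving.ae h)

/-- An integral operator along a family of maps, from the estimates that bound it. -/
theorem exists_integralOperator {w : Y × X → ℂ} {y : Y × X → X} (hw : Measurable w)
    (hy : Measurable y) (h0 : ∀ N, MeasurableSet N → μ N = 0 → ∀ᵐ q ∂(β.prod μ), y q ∈ N → w q = 0)
    (C : NNReal) (hC : ∀ f : X → ℂ, Measurable f →
      ∫⁻ x, (∫⁻ t, ‖w (t, x)‖ₑ * ‖f (y (t, x))‖ₑ ∂β) ^ 2 ∂μ ≤ C ^ 2 * ∫⁻ x, ‖f x‖ₑ ^ 2 ∂μ) :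
    ∃ T : Lp ℂ 2 μ →L[ℂ] Lp ℂ 2 μ, ∀ (f : X → ℂ) (F : Lp ℂ 2 μ), F =ᵐ[μ] f →
      T F =ᵐ[μ] fun x => ∫ t, w (t, x) * f (y (t, x)) ∂β := by
  set K : (X → ℂ) → X → ℂ := fun f x => ∫ t, w (t, x) * f (y (t, x)) ∂β
  -- By `h0` the kernel vanishes almost everywhere that `y` lands in a given null set, so `K` is
  -- well defined on classes even though `y` may send large sets into null ones.
  have hcongr : ∀ f f' : X → ℂ, f =ᵐ[μ] f' →
      ∀ᵐ x ∂μ, ∀ᵐ t ∂β, w (t, x) * f (y (t, x)) = w (t, x) * f' (y (t, x)) := by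
    intro f f' hff
    refine ae_ae_swap_of_ae_prod (P := fun q => w q * f (y q) = w q * f' (y q)) ?_
    filter_upwards [h0 (toMeasurable μ {x | f x ≠ f' x}) (measurableSet_toMeasurable _ _)
      (by rw [measure_toMeasurable]; exact hff)] with q hq
    by_cases hfq : f (y q) = f' (y q)
    · rw [hfq]
    · rw [hq (subset_toMeasurable _ _ hfq), zero_mul, zero_mul]
  have hKcongr : ∀ f f' : X → ℂ, f =ᵐ[μ] f' → K f =ᵐ[μ] K f' := by
    intro f f' hff
    filter_upwards [hcongr f f' hff] with x hx using integral_congr_ae hx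
  set r : Lp ℂ 2 μ → X → ℂ := fun F => (Lp.aestronglyMeasurable F).mk F
  have hr : ∀ F : Lp ℂ 2 μ, StronglyMeasurable (r F) := fun F => (Lp.aestronglyMeasurable F).stronglyMeasurable_mk
  have hrF : ∀ F : Lp ℂ 2 μ, F =ᵐ[μ] r F := fun F => (Lp.aestronglyMeasurable F).ae_eq_mk
  have hrn : ∀ F : Lp ℂ 2 μ, eLpNorm (r F) 2 μ = ‖F‖ₑ := fun F => by
    rw [← eLpNorm_congr_ae (hrF F), Lp.enorm_def]
  have hsm : ∀ F : Lp ℂ 2 μ, StronglyMeasurable fun q : Y × X => w q * r F (y q) := fun F =>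
    (hw.mul ((hr F).measurable.comp hy)).stronglyMeasurable
  have hKm : ∀ F : Lp ℂ 2 μ, AEStronglyMeasurable (K (r F)) μ := fun F =>
    ((hsm F).integral_prod_left').aestronglyMeasurable
  have hbound : ∀ F : Lp ℂ 2 μ, ∫⁻ x, (∫⁻ t, ‖w (t, x) * r F (y (t, x))‖ₑ ∂β) ^ 2 ∂μ ≤
      (C * ‖F‖ₑ) ^ 2 := by
    intro F
    simp only [enorm_mul]
    rw [mul_pow, ← hrn, eLpNorm_two_sq]
    exact hC _ (hr F).measurable
  have hint : ∀ F : Lp ℂ 2 μ, ∀ᵐ x ∂μ, Integrable (fun t => w (t, x) * r F (y (t, x))) β := by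
    intro F
    have hmeas : Measurable fun x => (∫⁻ t, ‖w (t, x) * r F (y (t, x))‖ₑ ∂β) ^ 2 :=
      ((hsm F).measurable.enorm.lintegral_prod_left').pow_const 2
    have hlt := ae_lt_top hmeas ((hbound F).trans_lt (ENNReal.pow_lt_top
      (ENNReal.mul_lt_top ENNReal.coe_lt_top (by simp [enorm_lt_top])))).ne
    filter_upwards [hlt] with x hx
    refine ⟨((hsm F).comp_measurable measurable_prodMk_right).aestronglyMeasurable, ?_⟩
    rw [hasFiniteIntegral_iff_enorm]
    by_contra hcon
    rw [not_lt, top_le_iff] at hcon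
    rw [hcon] at hx
    simp at hx
  have hKn : ∀ F : Lp ℂ 2 μ, eLpNorm (K (r F)) 2 μ ≤ C * ‖F‖ₑ := by
    intro F
    rw [← ENNReal.pow_le_pow_left_iff two_ne_zero, eLpNorm_two_sq]
    refine le_trans (lintegral_mono fun x => ?_) (hbound F)
    gcongr
    exact enorm_integral_le_lintegral_enorm _
  have hmem : ∀ F : Lp ℂ 2 μ, MemLp (K (r F)) 2 μ := fun F =>
    ⟨hKm F, (hKn F).trans_lt (ENNReal.mul_lt_top ENNReal.coe_lt_top (by simp [enorm_lt_top]))⟩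
  let T₀ : Lp ℂ 2 μ →ₗ[ℂ] Lp ℂ 2 μ :=
    { toFun := fun F => (hmem F).toLp
      map_add' := fun F F' => by
        rw [← MemLp.toLp_add]
        refine MemLp.toLp_congr _ _ ?_
        have h1 : r (F + F') =ᵐ[μ] fun x => r F x + r F' x := by
          filter_upwards [hrF (F + F'), hrF F, hrF F', Lp.coeFn_add F F'] with x h1 h2 h3 h4
          rw [← h1, h4, Pi.add_apply, h2, h3]
        refine (hKcongr _ _ h1).trans ?_
        filter_upwards [hint F, hint F'] with x hx hx'
        simp only [K, mul_add, Pi.add_apply]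
        exact integral_add hx hx'
      map_smul' := fun c F => by
        rw [RingHom.id_apply, ← MemLp.toLp_const_smul]
        refine MemLp.toLp_congr _ _ ?_
        have h1 : r (c • F) =ᵐ[μ] fun x => c * r F x := by
          filter_upwards [hrF (c • F), hrF F, Lp.coeFn_smul c F] with x h1 h2 h4
          rw [← h1, h4, Pi.smul_apply, h2, smul_eq_mul]
        refine (hKcongr _ _ h1).trans (Filter.Eventually.of_forall fun x => ?_)
        simp only [K, Pi.smul_apply, smul_eq_mul, mul_left_comm _ c]
        exact integral_const_mul _ _ }
  refine ⟨T₀.mkContinuous C fun F => ?_, fun f F hF => ?_⟩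
  · have h := hKn F
    rw [← eLpNorm_congr_ae (hmem F).coeFn_toLp, ← Lp.enorm_def, ← ofReal_norm, ← ofReal_norm,
      ← ENNReal.ofReal_coe_nnreal, ← ENNReal.ofReal_mul (NNReal.coe_nonneg _),
      ENNReal.ofReal_le_ofReal_iff (by positivity)] at h
    exact h
  · exact ((hmem F).coeFn_toLp).trans (hKcongr _ _ ((hrF F).symm.trans hF))

/-- An integral operator with a kernel supported on the graphs of a bijection, bounded by
Schur's test. -/
theorem exists_schurOperator {c : Y × X → ℂ} {j : Y × X → ℝ} (hc : Measurable c)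
    (hj : Measurable j) (hj0 : ∀ q, 0 ≤ j q) (Φ : Y × X ≃ᵐ Y × X)
    (hΦ : ∀ g : Y × X → ENNReal, Measurable g →
      ∫⁻ q, ENNReal.ofReal (j q) * g (Φ q) ∂(β.prod μ) = ∫⁻ q, g q ∂(β.prod μ))
    (C₁ C₂ : NNReal) (h₁ : ∀ x, ∫⁻ t, ‖c (t, x)‖ₑ ∂β ≤ C₁)
    (h₂ : ∀ x, ∫⁻ t, ‖c (Φ.symm (t, x))‖ₑ ∂β ≤ C₂) :
    ∃ T : Lp ℂ 2 μ →L[ℂ] Lp ℂ 2 μ, ∀ (f : X → ℂ) (F : Lp ℂ 2 μ), F =ᵐ[μ] f →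
      T F =ᵐ[μ] fun x =>
        ∫ t, ((Real.sqrt (j (t, x)) : ℝ) : ℂ) * c (t, x) * f (Φ (t, x)).2 ∂β := by
  have hw : Measurable fun q => ((Real.sqrt (j q) : ℝ) : ℂ) * c q :=
    (Complex.measurable_ofReal.comp hj.sqrt).mul hc
  refine exists_integralOperator (w := fun q => ((Real.sqrt (j q) : ℝ) : ℂ) * c q)
    (y := fun q => (Φ q).2) hw (measurable_snd.comp Φ.measurable) (fun N hN hN0 => ?_)
    (NNReal.sqrt (C₁ * C₂)) (fun f hf => ?_)
  -- The change of variables for the indicator of the null set `Y × N` forces `j = 0` almost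
  -- everywhere that `Φ` lands over `N`, and the kernel contains `√j`.
  · have h := hΦ (Set.indicator (Prod.snd ⁻¹' N) 1) (measurable_one.indicator (measurable_snd hN))
    have h2 : (β.prod μ) (Prod.snd ⁻¹' N) = 0 := by
      rw [← Set.univ_prod, Measure.prod_prod, hN0, mul_zero]
    rw [lintegral_indicator_one (measurable_snd hN), h2, lintegral_eq_zero_iff] at h
    · filter_upwards [h] with q hq hqN
      have h3 : (Φ q) ∈ (Prod.snd ⁻¹' N : Set (Y × X)) := hqN
      simp only [Set.indicator_of_mem h3, Pi.one_apply, mul_one, Pi.zero_apply,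
        ENNReal.ofReal_eq_zero] at hq
      rw [Real.sqrt_eq_zero_of_nonpos hq]
      simp
    · exact (ENNReal.measurable_ofReal.comp hj).mul
        ((measurable_one.indicator (measurable_snd hN)).comp Φ.measurable)
  · have hsq : ∀ q, ‖((Real.sqrt (j q) : ℝ) : ℂ)‖ₑ ^ 2 = ENNReal.ofReal (j q) := fun q => by
      rw [← ofReal_norm, Complex.norm_real, Real.norm_of_nonneg (Real.sqrt_nonneg _),
        ← ENNReal.ofReal_pow (Real.sqrt_nonneg _), Real.sq_sqrt (hj0 q)]
    have hm1 : Measurable fun q : Y × X => ‖c q‖ₑ := hc.enorm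
    have hm2 : Measurable fun q : Y × X => ‖((Real.sqrt (j q) : ℝ) : ℂ)‖ₑ * ‖f (Φ q).2‖ₑ :=
      (Complex.measurable_ofReal.comp hj.sqrt).enorm.mul
        (hf.comp (measurable_snd.comp Φ.measurable)).enorm
    have hm3 : Measurable fun r : Y × X => ‖c (Φ.symm r)‖ₑ * ‖f r.2‖ₑ ^ 2 :=
      (hc.comp Φ.symm.measurable).enorm.mul ((hf.comp measurable_snd).enorm.pow_const 2)
    -- Schur's test: Cauchy–Schwarz in `t` with the weight `|c|` costs `C₁`. The square of `√j` is
    -- then the Jacobian absorbed by the substitution `Φ`, after which the remaining integral of `|c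
    -- ∘ Φ⁻¹|` costs `C₂`; hence the norm bound `√(C₁ C₂)`.
    calc ∫⁻ x, (∫⁻ t, ‖((Real.sqrt (j (t, x)) : ℝ) : ℂ) * c (t, x)‖ₑ * ‖f (Φ (t, x)).2‖ₑ ∂β) ^ 2 ∂μ
        ≤ ∫⁻ x, C₁ * ∫⁻ t, ‖c (t, x)‖ₑ *
            (‖((Real.sqrt (j (t, x)) : ℝ) : ℂ)‖ₑ * ‖f (Φ (t, x)).2‖ₑ) ^ 2 ∂β ∂μ := by
          refine lintegral_mono fun x => ?_
          simp only [enorm_mul]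
          have h := sq_lintegral_mul_le (β := β) (a := fun t => ‖c (t, x)‖ₑ)
            (g := fun t => ‖((Real.sqrt (j (t, x)) : ℝ) : ℂ)‖ₑ * ‖f (Φ (t, x)).2‖ₑ)
            (hm1.comp measurable_prodMk_right).aemeasurable
            (hm2.comp measurable_prodMk_right).aemeasurable
          refine le_trans (le_of_eq ?_) (h.trans (mul_le_mul_left (h₁ x) _))
          congr 2
          ext t
          ring
      _ = C₁ * ∫⁻ q, ENNReal.ofReal (j q) * (‖c (Φ.symm (Φ q))‖ₑ * ‖f (Φ q).2‖ₑ ^ 2) ∂(β.prod μ) := by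
          rw [lintegral_const_mul _ (Measurable.lintegral_prod_left' (f := fun q : Y × X =>
              ‖c q‖ₑ * (‖((Real.sqrt (j q) : ℝ) : ℂ)‖ₑ * ‖f (Φ q).2‖ₑ) ^ 2)
              (hm1.mul (hm2.pow_const 2))),
            lintegral_prod_symm (fun q => ENNReal.ofReal (j q) *
              (‖c (Φ.symm (Φ q))‖ₑ * ‖f (Φ q).2‖ₑ ^ 2)) ((ENNReal.measurable_ofReal.comp hj).mul
              (hm3.comp Φ.measurable)).aemeasurable]
          congr 2
          ext x
          congr 1
          ext t
          rw [mul_pow, hsq, Φ.symm_apply_apply]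
          ring
      _ = C₁ * ∫⁻ x, ‖f x‖ₑ ^ 2 * ∫⁻ t, ‖c (Φ.symm (t, x))‖ₑ ∂β ∂μ := by
          rw [hΦ _ hm3, lintegral_prod_symm _ hm3.aemeasurable]
          congr 2
          ext x
          rw [mul_comm, ← lintegral_mul_const _ (f := fun t => ‖c (Φ.symm (t, x))‖ₑ)
            ((hc.comp Φ.symm.measurable).enorm.comp measurable_prodMk_right)]
      _ ≤ C₁ * ∫⁻ x, ‖f x‖ₑ ^ 2 * C₂ ∂μ := by
          gcongr with x
          exact h₂ x
      _ = (NNReal.sqrt (C₁ * C₂)) ^ 2 * ∫⁻ x, ‖f x‖ₑ ^ 2 ∂μ := by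
          rw [lintegral_mul_const _ (hf.enorm.pow_const 2), ← ENNReal.coe_pow, NNReal.sq_sqrt,
            ENNReal.coe_mul]
          ring

end Schur

/-! ### Weighted composition operators -/

section WeightedComp

variable {X : Type*} [MeasurableSpace X] {μ : Measure X}

/-- The square of `√j` supplies the Jacobian in `he`, so the operator preserves norms. Applying `he`
to indicators of null sets shows that it respects almost everywhere equality. -/
theorem exists_weightedComp (e : X ≃ᵐ X) {j : X → ℝ} (hj : Measurable j) (hj0 : ∀ x, 0 ≤ j x)
    (he : ∀ g : X → ENNReal, Measurable g →
      ∫⁻ x, ENNReal.ofReal (j x) * g (e x) ∂μ = ∫⁻ x, g x ∂μ) :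
    ∃ U : Lp ℂ 2 μ →ₗᵢ[ℂ] Lp ℂ 2 μ, ∀ (f : X → ℂ) (F : Lp ℂ 2 μ), F =ᵐ[μ] f →
      U F =ᵐ[μ] fun x => ((Real.sqrt (j x) : ℝ) : ℂ) * f (e x) := by
  set K : (X → ℂ) → X → ℂ := fun f x => ((Real.sqrt (j x) : ℝ) : ℂ) * f (e x)
  have hKcongr : ∀ f f' : X → ℂ, f =ᵐ[μ] f' → K f =ᵐ[μ] K f' := by
    intro f f' hff
    set N := toMeasurable μ {x | f x ≠ f' x}
    have hN : MeasurableSet N := measurableSet_toMeasurable _ _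
    have hN0 : μ N = 0 := by rw [measure_toMeasurable]; exact hff
    have h := he (Set.indicator N 1) (measurable_one.indicator hN)
    rw [lintegral_indicator_one hN, hN0, lintegral_eq_zero_iff] at h
    · filter_upwards [h] with x hx
      by_cases hfx : f (e x) = f' (e x)
      · simp only [K, hfx]
      · have h3 : e x ∈ N := subset_toMeasurable _ _ hfx
        simp only [Set.indicator_of_mem h3, Pi.one_apply, mul_one, Pi.zero_apply,
          ENNReal.ofReal_eq_zero] at hx
        simp [K, Real.sqrt_eq_zero_of_nonpos hx]
    · exact (ENNReal.measurable_ofReal.comp hj).mul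
        ((measurable_one.indicator hN).comp e.measurable)
  set r : Lp ℂ 2 μ → X → ℂ := fun F => (Lp.aestronglyMeasurable F).mk F
  have hr : ∀ F : Lp ℂ 2 μ, StronglyMeasurable (r F) := fun F =>
    (Lp.aestronglyMeasurable F).stronglyMeasurable_mk
  have hrF : ∀ F : Lp ℂ 2 μ, F =ᵐ[μ] r F := fun F => (Lp.aestronglyMeasurable F).ae_eq_mk
  have hKm : ∀ F : Lp ℂ 2 μ, AEStronglyMeasurable (K (r F)) μ := fun F =>
    ((Complex.measurable_ofReal.comp hj.sqrt).mul
      ((hr F).measurable.comp e.measurable)).aestronglyMeasurable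
  have hsq : ∀ x, ‖((Real.sqrt (j x) : ℝ) : ℂ)‖ₑ ^ 2 = ENNReal.ofReal (j x) := fun x => by
    rw [← ofReal_norm, Complex.norm_real, Real.norm_of_nonneg (Real.sqrt_nonneg _),
      ← ENNReal.ofReal_pow (Real.sqrt_nonneg _), Real.sq_sqrt (hj0 x)]
  have hKn : ∀ F : Lp ℂ 2 μ, eLpNorm (K (r F)) 2 μ = ‖F‖ₑ := by
    intro F
    rw [Lp.enorm_def, eLpNorm_congr_ae (hrF F)]
    refine (ENNReal.pow_right_strictMono two_ne_zero).injective ?_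
    rw [eLpNorm_two_sq, eLpNorm_two_sq, ← he _ ((hr F).measurable.enorm.pow_const 2)]
    simp only [K, enorm_mul, mul_pow, hsq]
  have hmem : ∀ F : Lp ℂ 2 μ, MemLp (K (r F)) 2 μ := fun F =>
    ⟨hKm F, by rw [hKn]; simp [enorm_lt_top]⟩
  let T₀ : Lp ℂ 2 μ →ₗ[ℂ] Lp ℂ 2 μ :=
    { toFun := fun F => (hmem F).toLp
      map_add' := fun F F' => by
        rw [← MemLp.toLp_add]
        refine MemLp.toLp_congr _ _ ?_
        have h1 : r (F + F') =ᵐ[μ] fun x => r F x + r F' x := by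
          filter_upwards [hrF (F + F'), hrF F, hrF F', Lp.coeFn_add F F'] with x h1 h2 h3 h4
          rw [← h1, h4, Pi.add_apply, h2, h3]
        refine (hKcongr _ _ h1).trans (Filter.Eventually.of_forall fun x => ?_)
        simp only [K, mul_add, Pi.add_apply]
      map_smul' := fun c F => by
        rw [RingHom.id_apply, ← MemLp.toLp_const_smul]
        refine MemLp.toLp_congr _ _ ?_
        have h1 : r (c • F) =ᵐ[μ] fun x => c * r F x := by
          filter_upwards [hrF (c • F), hrF F, Lp.coeFn_smul c F] with x h1 h2 h4
          rw [← h1, h4, Pi.smul_apply, h2, smul_eq_mul]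
        refine (hKcongr _ _ h1).trans (Filter.Eventually.of_forall fun x => ?_)
        simp only [K, Pi.smul_apply, smul_eq_mul, mul_left_comm _ c] }
  refine ⟨⟨T₀, fun F => ?_⟩, fun f F hF => ?_⟩
  · have h := hKn F
    rw [← eLpNorm_congr_ae (hmem F).coeFn_toLp, ← Lp.enorm_def, ← ofReal_norm, ← ofReal_norm,
      ENNReal.ofReal_eq_ofReal_iff (norm_nonneg _) (norm_nonneg _)] at h
    exact h
  · exact ((hmem F).coeFn_toLp).trans (hKcongr _ _ ((hrF F).symm.trans hF))

/-- The weighted composition operator of a bijection and the one of the inverse are unitary and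
adjoint to each other. -/
theorem exists_unitary_weightedComp (e : X ≃ᵐ X) {j j' : X → ℝ} (hj : Measurable j)
    (hj0 : ∀ x, 0 ≤ j x) (hj' : Measurable j') (hj0' : ∀ x, 0 ≤ j' x)
    (he : ∀ g : X → ENNReal, Measurable g →
      ∫⁻ x, ENNReal.ofReal (j x) * g (e x) ∂μ = ∫⁻ x, g x ∂μ)
    (he' : ∀ g : X → ENNReal, Measurable g →
      ∫⁻ x, ENNReal.ofReal (j' x) * g (e.symm x) ∂μ = ∫⁻ x, g x ∂μ)
    (hjj : ∀ x, j x * j' (e x) = 1) :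
    ∃ U ∈ unitary (Lp ℂ 2 μ →L[ℂ] Lp ℂ 2 μ),
      (∀ (f : X → ℂ) (F : Lp ℂ 2 μ), F =ᵐ[μ] f →
        U F =ᵐ[μ] fun x => ((Real.sqrt (j x) : ℝ) : ℂ) * f (e x)) ∧
      ∀ (f : X → ℂ) (F : Lp ℂ 2 μ), F =ᵐ[μ] f →
        (star U) F =ᵐ[μ] fun x => ((Real.sqrt (j' x) : ℝ) : ℂ) * f (e.symm x) := by
  obtain ⟨U, hU⟩ := exists_weightedComp e hj hj0 he
  obtain ⟨U', hU'⟩ := exists_weightedComp e.symm hj' hj0' he'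
  have hUU' : ∀ F, U (U' F) = F := fun F => by
    refine Lp.ext ((hU _ _ (hU' F F (Filter.EventuallyEq.refl _ _))).trans
      (Filter.Eventually.of_forall fun x => ?_))
    simp only [e.symm_apply_apply, ← mul_assoc, ← Complex.ofReal_mul]
    rw [← Real.sqrt_mul (hj0 x), hjj, Real.sqrt_one, Complex.ofReal_one, one_mul]
  -- The right inverse `U'` makes the isometry `U` surjective, hence unitary, and then `star U = U⁻¹
  -- = U'`.
  let V : Lp ℂ 2 μ ≃ₗᵢ[ℂ] Lp ℂ 2 μ := LinearIsometryEquiv.ofSurjective U fun F => ⟨U' F, hUU' F⟩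
  have hmem := (Unitary.linearIsometryEquiv.symm V).2
  rw [Unitary.coe_symm_linearIsometryEquiv_apply] at hmem
  refine ⟨_, hmem, hU, ?_⟩
  have hstar : ∀ F, (star (V : Lp ℂ 2 μ →L[ℂ] Lp ℂ 2 μ)) F = U' F := fun F => by
    have h1 := DFunLike.congr_fun (Unitary.star_mul_self_of_mem hmem) (U' F)
    have h2 : (V : Lp ℂ 2 μ →L[ℂ] Lp ℂ 2 μ) (U' F) = F := hUU' F
    rwa [mul_apply_eq_comp, h2] at h1
  intro f F hF
  rw [hstar]
  exact hU' f F hF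

end WeightedComp

end

section

/-! ### Dense families in `L²` -/

section Dense

theorem clm_eq_of_dense {V W : Type*} [NormedAddCommGroup V] [NormedSpace ℂ V]
    [NormedAddCommGroup W] [NormedSpace ℂ W] {S : Set V} (hS : Dense S) {T T' : V →L[ℂ] W}
    (h : ∀ v ∈ S, T v = T' v) : T = T' :=
  ContinuousLinearMap.coeFn_injective (Continuous.ext_on hS T.continuous T'.continuous h)

/-- A class is approximated in `L²` by a continuous compactly supported `g`, and `g` uniformly by a
smooth function supported within the support of `g`. -/
theorem dense_contMDiff_hasCompactSupport {V H M : Type*} [NormedAddCommGroup V]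
    [NormedSpace ℝ V] [FiniteDimensional ℝ V] [TopologicalSpace H] (I : ModelWithCorners ℝ V H)
    [TopologicalSpace M] [ChartedSpace H M] [IsManifold I ∞ M] [SecondCountableTopology M]
    [T2Space M] [MeasurableSpace M] [BorelSpace M] (μ : Measure M) [IsLocallyFiniteMeasure μ] :
    Dense {F : Lp ℂ 2 μ | ∃ f : M → ℂ, ContMDiff I 𝓘(ℝ, ℂ) ∞ f ∧ HasCompactSupport f ∧
      F =ᵐ[μ] f} := by
  have : LocallyCompactSpace M := Manifold.locallyCompact_of_finiteDimensional I
  rw [Metric.dense_iff]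
  intro F ε hε
  have hε4 : 0 < ε / 4 := by positivity
  obtain ⟨g, hgc, hgF, hg, hgm⟩ := (Lp.memLp F).exists_hasCompactSupport_eLpNorm_sub_le
    (by norm_num) (ε := ENNReal.ofReal (ε / 4)) (by simpa using hε4)
  set m := (μ (tsupport g)).toReal
  have hmt : μ (tsupport g) ≠ ⊤ := hgc.measure_lt_top.ne
  -- A uniform error `δ` on the support of `g` costs at most `δ √m` in `L²`; the `+ 1` keeps the
  -- divisor positive when `m = 0`.
  obtain ⟨δ, hδ, hδm⟩ : ∃ δ : ℝ, 0 < δ ∧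
      ENNReal.ofReal δ * μ (tsupport g) ^ (1 / (2 : ENNReal).toReal) ≤ ENNReal.ofReal (ε / 4) := by
    refine ⟨ε / 4 / (m ^ (1 / 2 : ℝ) + 1), by positivity, ?_⟩
    have h1 : μ (tsupport g) ^ (1 / (2 : ENNReal).toReal) = ENNReal.ofReal (m ^ (1 / 2 : ℝ)) := by
      rw [← ENNReal.ofReal_rpow_of_nonneg ENNReal.toReal_nonneg (by norm_num),
        ENNReal.ofReal_toReal hmt]
      norm_num
    rw [h1, ← ENNReal.ofReal_mul (by positivity)]
    refine ENNReal.ofReal_le_ofReal ?_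
    rw [div_mul_eq_mul_div, div_le_iff₀ (by positivity)]
    nlinarith [Real.rpow_nonneg (ENNReal.toReal_nonneg (a := μ (tsupport g))) (1 / 2 : ℝ)]
  obtain ⟨f, hfd, hfs⟩ := hg.exists_contMDiff_approx I ⊤ (ε := fun _ => δ) continuous_const
    fun _ => hδ
  have hfc : HasCompactSupport f := hgc.mono hfs
  have hfm : MemLp f 2 μ := f.contMDiff.continuous.memLp_of_hasCompactSupport hfc
  have hfg : eLpNorm (⇑f - g) 2 μ ≤ ENNReal.ofReal (ε / 4) :=
    (eLpNorm_sub_le_of_dist_bdd μ (by norm_num) hgc.measurableSet hδ.le (fun x => (hfd x).le)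
      (hfs.trans (subset_tsupport g)) (subset_tsupport g)).trans hδm
  refine ⟨hfm.toLp, ?_, f, f.contMDiff, hfc, hfm.coeFn_toLp⟩
  have h1 : eLpNorm (⇑(hfm.toLp) - ⇑F) 2 μ ≤ ENNReal.ofReal (ε / 4) + ENNReal.ofReal (ε / 4) := by
    have h2 : ⇑(hfm.toLp) - ⇑F =ᵐ[μ] (⇑f - g) + (g - ⇑F) := by
      filter_upwards [hfm.coeFn_toLp] with x hx
      simp [hx]
    rw [eLpNorm_congr_ae h2]
    refine (eLpNorm_add_le (hfm.aestronglyMeasurable.sub hgm.aestronglyMeasurable)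
      (hgm.aestronglyMeasurable.sub (Lp.aestronglyMeasurable F)) (by norm_num)).trans
      (add_le_add hfg ?_)
    rw [eLpNorm_sub_comm]
    exact hgF
  rw [Metric.mem_ball, Lp.dist_def]
  calc (eLpNorm (⇑(hfm.toLp) - ⇑F) 2 μ).toReal
      ≤ (ENNReal.ofReal (ε / 4) + ENNReal.ofReal (ε / 4)).toReal :=
        ENNReal.toReal_mono (by simp) h1
    _ = ε / 4 + ε / 4 := by
        rw [ENNReal.toReal_add (by simp) (by simp), ENNReal.toReal_ofReal hε4.le]
    _ < ε := by linarith

variable {X Y : Type*} [MeasurableSpace X] [MeasurableSpace Y] {μ : Measure X} {ν : Measure Y}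
  [SigmaFinite μ] [SigmaFinite ν]

/-- A square integrable function with zero integrals over rectangles vanishes. -/
theorem ae_eq_zero_of_setIntegral_prod_eq_zero (F : Lp ℂ 2 (μ.prod ν))
    (hF : ∀ s t, MeasurableSet s → MeasurableSet t → μ s ≠ ⊤ → ν t ≠ ⊤ →
      ∫ q in s ×ˢ t, F q ∂(μ.prod ν) = 0) : F =ᵐ[μ.prod ν] 0 := by
  set P : ℕ → Set (X × Y) := fun i => spanningSets μ i ×ˢ spanningSets ν i
  have hPm : ∀ i, MeasurableSet (P i) := fun i =>
    (measurableSet_spanningSets μ i).prod (measurableSet_spanningSets ν i)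
  have hPf : ∀ i, (μ.prod ν) (P i) < ⊤ := fun i => by
    rw [Measure.prod_prod]
    exact ENNReal.mul_lt_top (measure_spanningSets_lt_top μ i) (measure_spanningSets_lt_top ν i)
  have hPu : ⋃ i, P i = Set.univ := by
    rw [Set.iUnion_prod_of_monotone (monotone_spanningSets μ) (monotone_spanningSets ν),
      iUnion_spanningSets, iUnion_spanningSets, Set.univ_prod_univ]
  have hz : ∀ i, F =ᵐ[(μ.prod ν).restrict (P i)] 0 := by
    intro i
    have : IsFiniteMeasure ((μ.prod ν).restrict (P i)) := ⟨by simpa using hPf i⟩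
    have hint : Integrable F ((μ.prod ν).restrict (P i)) :=
      ((Lp.memLp F).restrict _).integrable (by norm_num)
    -- On a box of finite measure `F` is integrable, so the sets with zero integral are closed under
    -- complements and disjoint unions; rectangles are a generating π-system.
    have key : ∀ S, MeasurableSet S → ∫ q in S, F q ∂((μ.prod ν).restrict (P i)) = 0 := by
      intro S hS
      refine MeasurableSpace.induction_on_inter
        (C := fun S _ => ∫ q in S, F q ∂((μ.prod ν).restrict (P i)) = 0)
        generateFrom_prod.symm isPiSystem_prod (by simp) ?_ ?_ ?_ S hS
      · rintro _ ⟨s, hs, t, ht, rfl⟩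
        rw [Measure.restrict_restrict (MeasurableSet.prod hs ht), Set.prod_inter_prod]
        refine hF _ _ (hs.inter (measurableSet_spanningSets μ i))
          (ht.inter (measurableSet_spanningSets ν i)) ?_ ?_
        · exact ((measure_mono Set.inter_subset_right).trans_lt
            (measure_spanningSets_lt_top μ i)).ne
        · exact ((measure_mono Set.inter_subset_right).trans_lt
            (measure_spanningSets_lt_top ν i)).ne
      · intro t ht h
        have htot : ∫ q, F q ∂((μ.prod ν).restrict (P i)) = 0 :=
          hF _ _ (measurableSet_spanningSets μ i) (measurableSet_spanningSets ν i)
            (measure_spanningSets_lt_top μ i).ne (measure_spanningSets_lt_top ν i).ne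
        rw [setIntegral_compl ht hint, h, htot, sub_zero]
      · intro f hd hm h
        rw [integral_iUnion hm hd hint.integrableOn]
        simp [h]
    exact hint.ae_eq_zero_of_forall_setIntegral_eq_zero fun S hS _ => key S hS
  have h := (ae_restrict_iUnion_iff P (fun q => F q = (0 : X × Y → ℂ) q)).2 hz
  rwa [hPu, Measure.restrict_univ] at h

/-- Operators on `L²(X × Y)` that agree on products are equal. -/
theorem clm_eq_of_eq_on_prod {W : Type*} [NormedAddCommGroup W] [NormedSpace ℂ W]
    {T T' : Lp ℂ 2 (μ.prod ν) →L[ℂ] W}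
    (h : ∀ (φ : Lp ℂ 2 μ) (ψ : Lp ℂ 2 ν) (F : Lp ℂ 2 (μ.prod ν)),
      F =ᵐ[μ.prod ν] (fun q => φ q.1 * ψ q.2) → T F = T' F) : T = T' := by
  set K := LinearMap.ker (T - T').toLinearMap
  have hKc : IsClosed (K : Set (Lp ℂ 2 (μ.prod ν))) := (T - T').isClosed_ker
  have : CompleteSpace K := hKc.completeSpace_coe
  -- The subspace on which the operators agree is closed and contains the indicators of rectangles;
  -- a vector orthogonal to those has zero integral over every rectangle.
  have hK : K = ⊤ := by
    rw [← Submodule.orthogonal_eq_bot_iff, Submodule.eq_bot_iff]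
    intro F hF
    refine Lp.ext ((ae_eq_zero_of_setIntegral_prod_eq_zero F fun s t hs ht hμs hνt => ?_).trans
      (Lp.coeFn_zero _ _ _).symm)
    have hst : (μ.prod ν) (s ×ˢ t) ≠ ⊤ := by
      rw [Measure.prod_prod]; exact ENNReal.mul_ne_top hμs hνt
    rw [← L2.inner_indicatorConstLp_one (𝕜 := ℂ) (hs.prod ht) hst F]
    refine hF _ ?_
    have h1 := h (indicatorConstLp 2 hs hμs 1) (indicatorConstLp 2 ht hνt 1)
      (indicatorConstLp 2 (hs.prod ht) hst 1) ?_
    · simp [K, h1]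
    · filter_upwards [indicatorConstLp_coeFn (p := 2) (hs := hs.prod ht) (hμs := hst) (c := (1 : ℂ)),
        Measure.quasiMeasurePreserving_fst.ae
          (indicatorConstLp_coeFn (p := 2) (hs := hs) (hμs := hμs) (c := (1 : ℂ))),
        Measure.quasiMeasurePreserving_snd.ae
          (indicatorConstLp_coeFn (p := 2) (hs := ht) (hμs := hνt) (c := (1 : ℂ)))] with q h1 h2 h3
      rw [h1, h2, h3]
      by_cases hq1 : q.1 ∈ s <;> by_cases hq2 : q.2 ∈ t <;> simp [Set.indicator, hq1, hq2]
  ext1 F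
  have hF : F ∈ K := hK ▸ Submodule.mem_top
  exact sub_eq_zero.1 hF

end Dense

end

section

/-! ### The groupoid `G_A` and the maps `t_h` -/

/-- The projections, base maps and `t_h⁻¹` are chosen by `Classical.epsilon`; each is computed by
exhibiting the unique candidate. -/
theorem epsilon_eq_of_unique {α : Type*} [Nonempty α] {P : α → Prop} {a : α} (ha : P a)
    (h : ∀ b, P b → b = a) : Classical.epsilon P = a :=
  h _ (Classical.epsilon_spec ⟨a, ha⟩)

variable {G : Type*} [TopologicalSpace G] [T2Space G] [SecondCountableTopology G] [Group G]
  {n p k : ℕ} [ChartedSpace (E n) G] [LieGroup (𝓡 n) ∞ G] {A B : Subgroup G}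
  [ChartedSpace (E p) A] [LieGroup (𝓡 p) ∞ A] [ChartedSpace (E k) B] [LieGroup (𝓡 k) ∞ B]

namespace DoubleLieGroup

variable (D : DoubleLieGroup n p k A B)

theorem bL_mul (b : B) (a : A) : D.bL ((b : G) * a) = b := by
  have h : ((b : G) * a)⁻¹ = ((a⁻¹ : A) : G) * ((b⁻¹ : B) : G) := by simp
  rw [bL, h, D.bR_mul, inv_inv]

theorem aL_mul_of_mem (g : G) (b : B) : D.aL (g * b) = D.aL g := by
  conv_lhs => rw [← D.aL_mul_bR g, mul_assoc, ← Subgroup.coe_mul, D.aL_mul]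

theorem bL_mul_of_mem (g : G) (a : A) : D.bL (g * a) = D.bL g := by
  conv_lhs => rw [← D.bL_mul_aR g, mul_assoc, ← Subgroup.coe_mul, D.bL_mul]

theorem aL_coe (a : A) : D.aL (a : G) = a := by
  simpa using D.aL_mul a 1

theorem bL_inv_mul (g : G) : (D.bL g : G)⁻¹ * g = D.aR g := by
  rw [inv_mul_eq_iff_eq_mul, D.bL_mul_aR]

theorem mul_bR_inv (g : G) : g * (D.bR g : G)⁻¹ = D.aL g := by
  rw [mul_inv_eq_iff_eq_mul, D.aL_mul_bR]

theorem bL_inv_mul_mul (g : G) (b : B) : (D.bL g : G)⁻¹ * (g * b) = D.aR g * b := by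
  rw [← mul_assoc, bL_inv_mul]

theorem mem_inf_eq_one (D : DoubleLieGroup n p k A B) {g : G} (hA : g ∈ A) (hB : g ∈ B) : g = 1 := by
  have h : g ∈ A ⊓ B := ⟨hA, hB⟩
  rwa [D.inf_eq_bot, Subgroup.mem_bot] at h

/-- The map `t⁻¹` of the identity morphism of `G_A`. -/
def shear : B × G ≃ B × G where
  toFun q := (D.bL (D.aL q.2 * q.1), (D.bL (D.aL q.2 * q.1) : G)⁻¹ * q.2)
  invFun q := (D.bR (q.1 * D.aL q.2), q.1 * q.2)
  left_inv := by
    rintro ⟨b, z⟩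
    -- With `x = a_L(z) b`, write `z = x b'` for some `b'` in `B`; removing `b_L(x)` leaves `a_R(x)
    -- b'`.
    have h : D.aL ((D.bL (D.aL z * b) : G)⁻¹ * z) = D.aR (D.aL z * b) := by
      have h1 : z = D.aL z * b * ((b⁻¹ * D.bR z : B) : G) := by
        simp only [Subgroup.coe_mul, Subgroup.coe_inv, mul_assoc, mul_inv_cancel_left]
        exact (D.aL_mul_bR z).symm
      have h2 := congrArg D.aL (D.bL_inv_mul_mul (D.aL z * b) (b⁻¹ * D.bR z))
      rwa [← h1, D.aL_mul] at h2
    simp only [h, D.bL_mul_aR, D.bR_mul, mul_inv_cancel_left]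
  right_inv := by
    rintro ⟨b, y⟩
    have h : (D.aL ((b : G) * y) : G) * D.bR (b * D.aL y) = b * D.aL y := by
      have h1 : (b : G) * y = b * D.aL y * D.bR y := by rw [mul_assoc, D.aL_mul_bR]
      rw [h1, D.aL_mul_of_mem, D.aL_mul_bR]
    simp only [h, D.bL_mul, inv_mul_cancel_left]

/-- The right side is the base map of `δ`, so `W⁻¹` matches the fibres used by `π_δ` with those used
by `π_id` in the first variable. For `g = b_R(z₁)⁻¹ z₂` one has `a_L(g) = g b_R(g)⁻¹`, hence `z₁
a_L(g) = a_L(z₁) z₂ b_R(g)⁻¹`. -/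
theorem aL_pentagonal_symm (z : G × G) :
    (D.aL ((pentagonal D).symm z).1 : G) = D.aL z.1 * D.aL z.2 := by
  have h : ((pentagonal D).symm z).1 = z.1 * D.aL ((D.bR z.1 : G)⁻¹ * z.2) := rfl
  set g := (D.bR z.1 : G)⁻¹ * z.2
  have h1 : z.1 * D.aL g = ((D.aL z.1 * D.aL z.2 : A) : G) *
      ((D.bR z.2 * (D.bR g)⁻¹ : B) : G) := by
    rw [← D.mul_bR_inv g]
    simp only [g, Subgroup.coe_mul, Subgroup.coe_inv, ← mul_assoc]
    rw [D.mul_bR_inv]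
    congr 1
    rw [mul_assoc _ (D.aL z.2 : G), D.aL_mul_bR]
  rw [h, h1, D.aL_mul, Subgroup.coe_mul]

end DoubleLieGroup

variable (D : DoubleLieGroup n p k A B)

/-- Solves the multiplication relation for its second factor: a left factor of `z` must lie in the
same left fibre, and it then determines the other factor. -/
theorem groupoidA_m_iff (x y z : G) :
    (groupoidA D).m z x y ↔ D.aL x = D.aL z ∧ y = (D.bL x : G)⁻¹ * z := by
  constructor
  · rintro ⟨a, b₁, b₂, rfl, rfl, rfl⟩
    rw [D.aL_mul_of_mem, D.bL_mul]
    simp [mul_assoc]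
  · rintro ⟨h, rfl⟩
    have h1 : x * ((D.bR x)⁻¹ * D.bR z : B) = z := by
      rw [Subgroup.coe_mul, ← mul_assoc, Subgroup.coe_inv, D.mul_bR_inv, h, D.aL_mul_bR]
    refine ⟨D.aR x, D.bL x, (D.bR x)⁻¹ * D.bR z, ?_, (D.bL_mul_aR x).symm, ?_⟩
    · rw [D.bL_mul_aR, h1]
    · rw [← D.bL_inv_mul, mul_assoc, h1]

theorem groupoidA_m_s_iff (e z : G) :
    (groupoidA D).m e z ((groupoidA D).s z) ↔ e = D.aL z := by
  have h : (groupoidA D).s z = (D.bL z : G)⁻¹ * D.aL z := rfl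
  rw [groupoidA_m_iff, h, mul_right_inj, eq_comm (b := e)]
  refine ⟨fun h => h.2, ?_⟩
  rintro rfl
  exact ⟨(D.aL_coe _).symm, rfl⟩

theorem groupoidA_eL (z : G) : (groupoidA D).eL z = D.aL z :=
  haveI : Nonempty G := ⟨z⟩
  epsilon_eq_of_unique ((groupoidA_m_s_iff D _ _).2 rfl) fun _ => (groupoidA_m_s_iff D _ _).1

theorem groupoidA_prod_eL (z : G × G) :
    ((groupoidA D).prod (groupoidA D)).eL z = ((D.aL z.1 : G), (D.aL z.2 : G)) :=
  haveI : Nonempty (G × G) := ⟨z⟩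
  epsilon_eq_of_unique ⟨(groupoidA_m_s_iff D _ _).2 rfl, (groupoidA_m_s_iff D _ _).2 rfl⟩
    fun _ he => Prod.ext ((groupoidA_m_s_iff D _ _).1 he.1) ((groupoidA_m_s_iff D _ _).1 he.2)

theorem fibrePoint_id (b : B) (z : G) :
    fibrePoint D (groupoidA D) (fun y x => y = x) b z = D.aL z * b := by
  have : Nonempty G := ⟨z⟩
  rw [fibrePoint, groupoidA_eL, baseMap, epsilon_eq_of_unique (a := (D.aL z : G))]
  · exact ⟨(D.aL z).2, (D.aL z).2, rfl⟩
  · exact fun e he => he.2.2.symm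

theorem tInvB_id : tInvB D (groupoidA D) (fun y x => y = x) = D.shear := by
  ext1 ⟨b, z⟩
  have : Nonempty G := ⟨z⟩
  rw [tInvB, fibrePoint_id, tInv, epsilon_eq_of_unique (a := (D.bL (D.aL z * b) : G)⁻¹ * z)]
  · rfl
  · exact ⟨_, rfl, (groupoidA_m_iff D _ _ _).2 ⟨by rw [D.aL_mul], rfl⟩⟩
  · rintro y ⟨x, rfl, hm⟩
    exact ((groupoidA_m_iff D _ _ _).1 hm).2

theorem fibrePoint_delta (b : B) (z : G × G) :
    fibrePoint D ((groupoidA D).prod (groupoidA D)) (delta A B) b z =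
      D.aL z.1 * D.aL z.2 * b := by
  have : Nonempty G := ⟨z.1⟩
  rw [fibrePoint, groupoidA_prod_eL, baseMap, epsilon_eq_of_unique (a := (D.aL z.1 * D.aL z.2 : G))]
  · exact ⟨mul_mem (D.aL z.1).2 (D.aL z.2).2, ⟨(D.aL z.1).2, (D.aL z.2).2⟩,
      1, D.aL z.1, D.aL z.2, by simp, by simp, by simp⟩
  · rintro e ⟨-, -, b, a₁, a₂, rfl, h1, h2⟩
    dsimp only at h1 h2
    have hb : (b : G) = 1 := by
      refine D.mem_inf_eq_one ?_ b.2
      rw [← inv_mul_cancel_left (a₁ : G) b, ← h1]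
      exact mul_mem (inv_mem a₁.2) (D.aL z.1).2
    rw [h1, h2, hb, mul_one, one_mul]

/-- Composability with `z` fixes the left projection of the first component of an element of `δ(x)`.
For `x = a₁ a₂ b` with `aᵢ = a_L(zᵢ)` this leaves only `(a₁ b_L(a₂ b), a₂ b)`. -/
theorem tInv_delta (b : B) (z : G × G) :
    tInv ((groupoidA D).prod (groupoidA D)) (delta A B) (D.aL z.1 * D.aL z.2 * b) z =
      ((D.bL (D.aL z.1 * D.aL z.2 * b) : G)⁻¹ * z.1, (D.bL (D.aL z.2 * b) : G)⁻¹ * z.2) := by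
  have : Nonempty G := ⟨z.1⟩
  have : Nonempty (G × G) := ⟨z⟩
  have hx : (D.aL z.1 * D.aL z.2 * b : G) =
      D.aL z.1 * D.bL (D.aL z.2 * b) * D.aR (D.aL z.2 * b) := by
    rw [mul_assoc, mul_assoc, D.bL_mul_aR]
  refine epsilon_eq_of_unique ⟨(D.aL z.1 * D.bL (D.aL z.2 * b), D.aL z.2 * b), ?_, ?_, ?_⟩ ?_
  · exact ⟨D.bL (D.aL z.2 * b), D.aL z.1, D.aR (D.aL z.2 * b), hx, rfl, (D.bL_mul_aR _).symm⟩
  · refine (groupoidA_m_iff D _ _ _).2 ⟨D.aL_mul _ _, ?_⟩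
    rw [hx, D.bL_mul_of_mem]
  · exact (groupoidA_m_iff D _ _ _).2 ⟨D.aL_mul _ _, rfl⟩
  · rintro y ⟨x', ⟨b', a₁, a₂, hx', h1, h2⟩, hm1, hm2⟩
    obtain ⟨e1, f1⟩ := (groupoidA_m_iff D _ _ _).1 hm1
    obtain ⟨e2, f2⟩ := (groupoidA_m_iff D _ _ _).1 hm2
    rw [h1, D.aL_mul] at e1
    have h3 : x'.2 = D.aL z.2 * b := by
      rw [h2, ← mul_right_inj (a₁ : G), ← mul_assoc, ← hx', e1, mul_assoc]
    have h4 : D.bL (D.aL z.1 * D.aL z.2 * b) = D.bL x'.1 := by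
      rw [hx', h1, D.bL_mul_of_mem]
    exact Prod.ext (by rw [f1, h4]) (by rw [f2, h3])

/-- With `w = W⁻¹ z`, the first `G`-components agree because `w₁ a_L(w₂)⁻¹ = z₁`. Since `w₂ =
b_R(z₁)⁻¹ z₂`, the second ones agree exactly by the identity `hb`. -/
theorem tInvB_delta : tInvB D ((groupoidA D).prod (groupoidA D)) (delta A B) = fun q =>
    extendLeft (pentagonal D) (extendRight D.shear (extendLeft (pentagonal D).symm q)) := by
  ext1 ⟨b, z⟩
  rw [tInvB, fibrePoint_delta, tInv_delta]
  set x : G := D.aL z.1 * D.aL z.2 * b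
  set w := (pentagonal D).symm z
  have hw : (D.aL w.1 : G) * b = x := by rw [D.aL_pentagonal_symm]
  have hw2 : w.2 = (D.bR z.1 : G)⁻¹ * z.2 := rfl
  have hw1 : w.1 = z.1 * D.aL w.2 := rfl
  -- With `b' = b_L(a_L(z₂) b)`, `x` and `a_L(z₁) b'` have the same `b_L`; removing it from `z₁ =
  -- (a_L(z₁) b') (b'⁻¹ b_R(z₁))` leaves an element of `A` times `b'⁻¹ b_R(z₁)`.
  have hb : D.bL (D.aL z.2 * b) * D.bR ((D.bL x : G)⁻¹ * z.1) = D.bR z.1 := by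
    set b' := D.bL (D.aL z.2 * b)
    have h1 : x = D.aL z.1 * b' * D.aR (D.aL z.2 * b) := by
      rw [mul_assoc, D.bL_mul_aR, ← mul_assoc]
    have h2 : z.1 = D.aL z.1 * b' * (b'⁻¹ * D.bR z.1 : B) := by
      simp only [Subgroup.coe_mul, Subgroup.coe_inv, mul_assoc, mul_inv_cancel_left]
      exact (D.aL_mul_bR _).symm
    have h3 : D.bR ((D.bL x : G)⁻¹ * z.1) = b'⁻¹ * D.bR z.1 := by
      have h4 := congrArg D.bR (D.bL_inv_mul_mul (D.aL z.1 * b') (b'⁻¹ * D.bR z.1))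
      rwa [← h2, D.bR_mul, ← D.bL_mul_of_mem _ (D.aR (D.aL z.2 * b)), ← h1] at h4
    rw [h3, mul_inv_cancel_left]
  refine Prod.ext ?_ (Prod.ext ?_ ?_)
  · change D.bL x = D.bL (D.aL w.1 * b)
    rw [hw]
  · change (D.bL x : G)⁻¹ * z.1 = (D.bL (D.aL w.1 * b) : G)⁻¹ * w.1 * (D.aL w.2 : G)⁻¹
    rw [hw, hw1, ← mul_assoc, mul_inv_cancel_right]
  · change (D.bL (D.aL z.2 * b) : G)⁻¹ * z.2 =
      D.bR ((D.bL (D.aL w.1 * b) : G)⁻¹ * w.1 * (D.aL w.2 : G)⁻¹) * w.2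
    rw [hw, hw1, ← mul_assoc, mul_inv_cancel_right, hw2, ← hb, Subgroup.coe_mul, mul_inv_rev,
      mul_assoc, mul_inv_cancel_left]

end

section

/-! ### Change of variables in the fibres -/

variable {G : Type*} [TopologicalSpace G] [T2Space G] [SecondCountableTopology G] [Group G]
  {n p k : ℕ} [ChartedSpace (E n) G] [LieGroup (𝓡 n) ∞ G] {A B : Subgroup G}
  [ChartedSpace (E p) A] [LieGroup (𝓡 p) ∞ A] [ChartedSpace (E k) B] [LieGroup (𝓡 k) ∞ B]
  [MeasurableSpace G] [BorelSpace G]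

namespace DoubleLieGroup

variable (D : DoubleLieGroup n p k A B)

theorem contMDiff_coe_aL : ContMDiff (𝓡 n) (𝓡 n) ∞ fun g => (D.aL g : G) :=
  D.smooth_left.comp D.contMDiff_aL

theorem contMDiff_coe_bR : ContMDiff (𝓡 n) (𝓡 n) ∞ fun g => (D.bR g : G) :=
  D.smooth_right.comp D.contMDiff_bR

theorem contMDiff_coe_bL : ContMDiff (𝓡 n) (𝓡 n) ∞ fun g => (D.bL g : G) :=
  D.smooth_right.comp D.contMDiff_bL

theorem contMDiff_shear : ContMDiff ((𝓡 k).prod (𝓡 n)) ((𝓡 k).prod (𝓡 n)) ∞ D.shear := by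
  have h : ContMDiff ((𝓡 k).prod (𝓡 n)) (𝓡 n) ∞ fun q : B × G => (D.aL q.2 : G) * q.1 :=
    (D.contMDiff_coe_aL.comp contMDiff_snd).mul (D.smooth_right.comp contMDiff_fst)
  exact (D.contMDiff_bL.comp h).prodMk
    ((ContMDiff.inv (D.contMDiff_coe_bL.comp h)).mul contMDiff_snd)

theorem contMDiff_shear_symm :
    ContMDiff ((𝓡 k).prod (𝓡 n)) ((𝓡 k).prod (𝓡 n)) ∞ D.shear.symm := by
  have h : ContMDiff ((𝓡 k).prod (𝓡 n)) (𝓡 n) ∞ fun q : B × G => (q.1 : G) :=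
    D.smooth_right.comp contMDiff_fst
  exact (D.contMDiff_bR.comp (h.mul (D.contMDiff_coe_aL.comp contMDiff_snd))).prodMk
    (h.mul contMDiff_snd)

theorem contMDiff_pentagonal :
    ContMDiff ((𝓡 n).prod (𝓡 n)) ((𝓡 n).prod (𝓡 n)) ∞ (pentagonal D) := by
  have h : ContMDiff ((𝓡 n).prod (𝓡 n)) (𝓡 n) ∞ fun q : G × G => q.1 * (D.aL q.2 : G)⁻¹ :=
    contMDiff_fst.mul (ContMDiff.inv (D.contMDiff_coe_aL.comp contMDiff_snd))
  exact h.prodMk ((D.contMDiff_coe_bR.comp h).mul contMDiff_snd)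

theorem contMDiff_pentagonal_symm :
    ContMDiff ((𝓡 n).prod (𝓡 n)) ((𝓡 n).prod (𝓡 n)) ∞ (pentagonal D).symm := by
  have h : ContMDiff ((𝓡 n).prod (𝓡 n)) (𝓡 n) ∞ fun q : G × G => (D.bR q.1 : G)⁻¹ * q.2 :=
    (ContMDiff.inv (D.contMDiff_coe_bR.comp contMDiff_fst)).mul contMDiff_snd
  exact (contMDiff_fst.mul (D.contMDiff_coe_aL.comp h)).prodMk h

/-- `shear` as a homeomorphism. -/
def shearHomeomorph : B × G ≃ₜ B × G where
  toEquiv := D.shear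
  continuous_toFun := D.contMDiff_shear.continuous
  continuous_invFun := D.contMDiff_shear_symm.continuous

/-- `shear × id` as a homeomorphism. -/
def shearRightHomeomorph : B × (G × G) ≃ₜ B × (G × G) where
  toFun := extendRight D.shear
  invFun := extendRight D.shear.symm
  left_inv q := by simp [extendRight]
  right_inv q := by simp [extendRight]
  continuous_toFun :=
    (contMDiff_extendRight (I₃ := 𝓡 n) (G₃ := G) D.contMDiff_shear).continuous
  continuous_invFun :=
    (contMDiff_extendRight (I₃ := 𝓡 n) (G₃ := G) D.contMDiff_shear_symm).continuous

/-- `pentagonal` as a homeomorphism. -/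
def pentagonalHomeomorph : G × G ≃ₜ G × G where
  toEquiv := pentagonal D
  continuous_toFun := D.contMDiff_pentagonal.continuous
  continuous_invFun := D.contMDiff_pentagonal_symm.continuous

theorem lintegral_shear {g : B × G → ENNReal} (hg : Measurable g) :
    ∫⁻ q, ENNReal.ofReal (jac ((𝓡 k).prod (𝓡 n)) D.shear q) * g (D.shear q)
      ∂((leftMeasure k B).prod (leftMeasure n G)) =
      ∫⁻ q, g q ∂((leftMeasure k B).prod (leftMeasure n G)) :=
  ((isLeftDensity_leftMeasure k).prod (isLeftDensity_leftMeasure n)).lintegral_comp_mul_jac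
    D.shearHomeomorph D.contMDiff_shear hg

theorem lintegral_shearRight {g : B × (G × G) → ENNReal} (hg : Measurable g) :
    ∫⁻ q, ENNReal.ofReal (jac ((𝓡 k).prod (𝓡 n)) D.shear (q.1, q.2.1)) * g (extendRight D.shear q)
      ∂((leftMeasure k B).prod ((leftMeasure n G).prod (leftMeasure n G))) =
      ∫⁻ q, g q ∂((leftMeasure k B).prod ((leftMeasure n G).prod (leftMeasure n G))) := by
  simp only [← jac_extendRight (I₃ := 𝓡 n) (G₃ := G) D.contMDiff_shear]
  have : (volume.prod volume : Measure (E n × E n)).IsAddHaarMeasure := inferInstance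
  have : (volume.prod (volume.prod volume) : Measure (E k × (E n × E n))).IsAddHaarMeasure :=
    Measure.prod.instIsAddHaarMeasure _ _
  exact ((isLeftDensity_leftMeasure k).prod ((isLeftDensity_leftMeasure n).prod
    (isLeftDensity_leftMeasure n))).lintegral_comp_mul_jac
    D.shearRightHomeomorph (contMDiff_extendRight D.contMDiff_shear) hg

theorem lintegral_pentagonal {g : G × G → ENNReal} (hg : Measurable g) :
    ∫⁻ q, ENNReal.ofReal (jac ((𝓡 n).prod (𝓡 n)) (pentagonal D) q) * g (pentagonal D q)
      ∂((leftMeasure n G).prod (leftMeasure n G)) =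
      ∫⁻ q, g q ∂((leftMeasure n G).prod (leftMeasure n G)) :=
  ((isLeftDensity_leftMeasure n).prod (isLeftDensity_leftMeasure n)).lintegral_comp_mul_jac
    D.pentagonalHomeomorph D.contMDiff_pentagonal hg

theorem lintegral_pentagonal_symm {g : G × G → ENNReal} (hg : Measurable g) :
    ∫⁻ q, ENNReal.ofReal (jac ((𝓡 n).prod (𝓡 n)) (pentagonal D).symm q) *
      g ((pentagonal D).symm q) ∂((leftMeasure n G).prod (leftMeasure n G)) =
      ∫⁻ q, g q ∂((leftMeasure n G).prod (leftMeasure n G)) :=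
  ((isLeftDensity_leftMeasure n).prod (isLeftDensity_leftMeasure n)).lintegral_comp_mul_jac
    D.pentagonalHomeomorph.symm D.contMDiff_pentagonal_symm hg

theorem jac_pentagonal_mul (z : G × G) :
    jac ((𝓡 n).prod (𝓡 n)) (pentagonal D).symm z *
      jac ((𝓡 n).prod (𝓡 n)) (pentagonal D) ((pentagonal D).symm z) = 1 := by
  rw [mul_comm, ← jac_comp (D.contMDiff_pentagonal.mdifferentiable (by simp) _)
    (D.contMDiff_pentagonal_symm.mdifferentiable (by simp) _)]
  simp only [Equiv.apply_symm_apply]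
  exact jac_id z

end DoubleLieGroup

/-- A continuous function with compact support has uniformly bounded integrals over the sections
of a continuous map. -/
theorem exists_lintegral_section_le {X Y : Type*} [TopologicalSpace X] [TopologicalSpace Y]
    [T2Space Y] [MeasurableSpace Y] [OpensMeasurableSpace Y] {β : Measure Y}
    [IsFiniteMeasureOnCompacts β] {π : X → Y} (hπ : Continuous π) {c : X → ℂ} (hc : Continuous c)
    (hs : HasCompactSupport c) :
    ∃ C : NNReal, ∀ γ : Y → X, (∀ t, π (γ t) = t) → ∫⁻ t, ‖c (γ t)‖ₑ ∂β ≤ C := by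
  obtain ⟨M, hM⟩ := hs.exists_bound_of_continuous hc
  have hK : IsCompact (π '' tsupport c) := hs.image hπ
  -- For a section `γ`, `c (γ t)` can be nonzero only for `t` in the compact set `π '' tsupport c`,
  -- whatever `γ` is; `M` bounds `|c|`.
  refine ⟨M.toNNReal * (β (π '' tsupport c)).toNNReal, fun γ hγ => ?_⟩
  rw [ENNReal.coe_mul, ENNReal.coe_toNNReal hK.measure_lt_top.ne, ← setLIntegral_const,
    ← lintegral_indicator hK.measurableSet]
  refine lintegral_mono fun t => ?_
  by_cases ht : γ t ∈ tsupport c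
  · rw [Set.indicator_of_mem (show t ∈ π '' tsupport c from ⟨γ t, ht, hγ t⟩), ← ofReal_norm]
    exact ENNReal.ofReal_le_ofReal (hM _)
  · rw [image_eq_zero_of_notMem_tsupport ht]
    simp

/-! ### The integrand of the representations -/

section Kernel

variable {Γ' ι V' H' : Type*} [Fintype ι] [DecidableEq ι]
  [NormedAddCommGroup V'] [NormedSpace ℝ V'] [TopologicalSpace H']
  {I' : ModelWithCorners ℝ V' H'} [TopologicalSpace Γ'] [ChartedSpace H' Γ'] [Group Γ']
  [LieGroup I' ∞ Γ'] (bV' : Module.Basis ι ℝ V')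
  (D : DoubleLieGroup n p k A B) (𝒢' : GroupoidData Γ') (h : Γ' → G → Prop)

/-- The frame on which the kernel is evaluated is the left-invariant frame of the product group `B ×
Γ'`, so the pull-back formula applies. The hypothesis `hb` matches the frame at `b` with the one
that defines `Bidensity.coeff`. -/
theorem kernel_invFrame (om : Bidensity G k) (Ψ : Γ' → HalfDensity ι V') (z : Γ') (b : B)
    (hd : MDifferentiableAt ((𝓡 k).prod I') ((𝓡 k).prod I') (tInvB D 𝒢' h) (b, z))
    (hb : D.bR (fibrePoint D 𝒢' h b z) = b) :
    kernel I' bV' D 𝒢' h om Ψ z (invFrame I' bV' z) b =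
      ((Real.sqrt (jac ((𝓡 k).prod I') (tInvB D 𝒢' h) (b, z)) : ℝ) : ℂ) *
        om.coeff D (fibrePoint D 𝒢' h b z) *
        (Ψ (tInvB D 𝒢' h (b, z)).2).toFun (invFrame I' bV' (tInvB D 𝒢' h (b, z)).2) := by
  have h1 : (Sum.elim (fun i => (leftFrame k b i, (0 : V')))
      (fun j => ((0 : E k), invFrame I' bV' z j))) =
      invFrame ((𝓡 k).prod I') ((stdBasis k).prod bV') (b, z) := (invFrame_prod _ _ _ _).symm
  have h2 : invFrame ((𝓡 k).prod I') ((stdBasis k).prod bV') (tInvB D 𝒢' h (b, z)) =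
      (Sum.elim (fun i => (leftFrame k (D.bL (fibrePoint D 𝒢' h b z)) i, (0 : V')))
      (fun j => ((0 : E k), invFrame I' bV' (tInvB D 𝒢' h (b, z)).2 j))) := invFrame_prod _ _ _ _
  rw [kernel, h1, tInvDeriv, HalfDensity.pull_invFrame _ _ hd, h2, HalfDensity.prod_apply,
    mul_assoc, Bidensity.coeff, hb]
  rfl

end Kernel

variable (D : DoubleLieGroup n p k A B)

theorem coeff_rep_id (om : Bidensity G k) (Ψ : Half G n) (z : G) :
    coeff (rep (𝓡 n) (stdBasis n) D (groupoidA D) (fun y x => y = x) om Ψ) z =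
      ∫ b : B, ((Real.sqrt (jac ((𝓡 k).prod (𝓡 n)) D.shear (b, z)) : ℝ) : ℂ) *
        om.coeff D (D.aL z * b) * coeff Ψ (D.shear (b, z)).2 ∂(leftMeasure k B) := by
  refine integral_congr_ae (Filter.Eventually.of_forall fun b => ?_)
  have h1 := kernel_invFrame (I' := 𝓡 n) (stdBasis n) D (groupoidA D) (fun y x => y = x) om Ψ z b
  rw [tInvB_id, fibrePoint_id, D.bR_mul] at h1
  exact h1 (D.contMDiff_shear.mdifferentiable (by simp) _) rfl

theorem coeff2_eq (Ψ : Half2 G n) (z : G × G) :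
    coeff2 Ψ z = (Ψ z).toFun
      (invFrame ((𝓡 n).prod (𝓡 n)) ((stdBasis n).prod (stdBasis n)) z) := by
  rw [coeff2]
  congr 1
  exact (invFrame_prod _ _ z.1 z.2).symm

theorem coeff2_pushforward (Ψ : Half2 G n) (z : G × G) :
    coeff2 (pushforward (pentagonal D) Ψ) z =
      ((Real.sqrt (jac ((𝓡 n).prod (𝓡 n)) (pentagonal D).symm z) : ℝ) : ℂ) *
        coeff2 Ψ ((pentagonal D).symm z) := by
  rw [coeff2_eq, coeff2_eq]
  exact HalfDensity.pull_invFrame _ _ (D.contMDiff_pentagonal_symm.mdifferentiable (by simp) _)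

/-- Multiplicativity of `jac` along `tInvB_delta` gives three factors. The one of `W⁻¹` does not
involve `b` and leaves the integral; read from outside, the formula is `W`, then the kernel of
`π_id(ω)` in the first variable, then `W*`. -/
theorem coeff2_rep_delta (om : Bidensity G k) (Ψ : Half2 G n) (z : G × G) :
    coeff2 (rep ((𝓡 n).prod (𝓡 n)) ((stdBasis n).prod (stdBasis n)) D
        ((groupoidA D).prod (groupoidA D)) (delta A B) om Ψ) z =
      ((Real.sqrt (jac ((𝓡 n).prod (𝓡 n)) (pentagonal D).symm z) : ℝ) : ℂ) *
      ∫ b : B, ((Real.sqrt (jac ((𝓡 k).prod (𝓡 n)) D.shear (b, ((pentagonal D).symm z).1)) : ℝ) :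
          ℂ) * om.coeff D (D.aL ((pentagonal D).symm z).1 * b) *
        (((Real.sqrt (jac ((𝓡 n).prod (𝓡 n)) (pentagonal D)
            (extendRight D.shear (b, (pentagonal D).symm z)).2) : ℝ) : ℂ) *
          coeff2 Ψ (pentagonal D (extendRight D.shear (b, (pentagonal D).symm z)).2))
        ∂(leftMeasure k B) := by
  rw [coeff2_eq, ← integral_const_mul]
  refine integral_congr_ae (Filter.Eventually.of_forall fun b => ?_)
  have h1 := kernel_invFrame (I' := (𝓡 n).prod (𝓡 n)) ((stdBasis n).prod (stdBasis n)) D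
    ((groupoidA D).prod (groupoidA D)) (delta A B) om Ψ z b
  rw [tInvB_delta, fibrePoint_delta, ← Subgroup.coe_mul, D.bR_mul] at h1
  have hW := D.contMDiff_pentagonal
  have hW' := D.contMDiff_pentagonal_symm
  have hS := D.contMDiff_shear
  have hK : MDifferentiableAt ((𝓡 k).prod ((𝓡 n).prod (𝓡 n))) ((𝓡 k).prod ((𝓡 n).prod (𝓡 n)))
      (fun q : B × (G × G) => extendRight D.shear (extendLeft (pentagonal D).symm q)) (b, z) :=
    ((contMDiff_extendRight hS).comp (contMDiff_extendLeft hW')).mdifferentiable (by simp) _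
  have hL := (contMDiff_extendLeft (I₁ := 𝓡 k) (G₁ := B) hW).mdifferentiable (by simp)
  have h2 := h1 ((hL _).comp _ hK) rfl
  rw [jac_comp (hL _) hK, jac_extendLeft hW, jac_comp
    ((contMDiff_extendRight hS).mdifferentiable (by simp) _)
    ((contMDiff_extendLeft hW').mdifferentiable (by simp) _), jac_extendRight hS,
    jac_extendLeft hW', Real.sqrt_mul (jac_nonneg _ _), Real.sqrt_mul (jac_nonneg _ _),
    Subgroup.coe_mul, ← D.aL_pentagonal_symm, ← coeff2_eq] at h2
  refine h2.trans ?_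
  simp only [extendLeft]
  push_cast
  ring

end

section

/-! ### The operators on `L²` -/

variable {G : Type*} [TopologicalSpace G] [T2Space G] [SecondCountableTopology G] [Group G]
  {n p k : ℕ} [ChartedSpace (E n) G] [LieGroup (𝓡 n) ∞ G] {A B : Subgroup G}
  [ChartedSpace (E p) A] [LieGroup (𝓡 p) ∞ A] [ChartedSpace (E k) B] [LieGroup (𝓡 k) ∞ B]
  [MeasurableSpace G] [BorelSpace G]

theorem exists_coeff_eq (f : G → ℂ) : ∃ Ψ : Half G n, coeff Ψ = f := by
  choose Ψ hΨ using fun z => exists_halfDensity_invFrame (I := 𝓡 n) (stdBasis n) z (f z)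
  exact ⟨Ψ, funext hΨ⟩

theorem exists_coeff2_eq (f : G × G → ℂ) : ∃ Ψ : Half2 G n, coeff2 Ψ = f := by
  choose Ψ hΨ using fun z => exists_halfDensity_invFrame (I := (𝓡 n).prod (𝓡 n))
    ((stdBasis n).prod (stdBasis n)) z (f z)
  exact ⟨Ψ, funext fun z => (coeff2_eq Ψ z).trans (hΨ z)⟩

variable (D : DoubleLieGroup n p k A B)

theorem exists_pentagonalUnitary : ∃ U : L2x2 G n →L[ℂ] L2x2 G n,
    IsPentagonalUnitary D U ∧
    ∀ (f : G × G → ℂ) (F : L2x2 G n), F =ᵐ[(leftMeasure n G).prod (leftMeasure n G)] f →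
      (star U) F =ᵐ[(leftMeasure n G).prod (leftMeasure n G)] fun z =>
        ((Real.sqrt (jac ((𝓡 n).prod (𝓡 n)) (pentagonal D) z) : ℝ) : ℂ) * f (pentagonal D z) := by
  obtain ⟨U, hU, h1, h2⟩ := exists_unitary_weightedComp
    (μ := (leftMeasure n G).prod (leftMeasure n G))
    D.pentagonalHomeomorph.symm.toMeasurableEquiv
    (continuous_jac D.contMDiff_pentagonal_symm).measurable (fun _ => jac_nonneg _ _)
    (continuous_jac D.contMDiff_pentagonal).measurable (fun _ => jac_nonneg _ _)
    (fun g => D.lintegral_pentagonal_symm) (fun g => D.lintegral_pentagonal) D.jac_pentagonal_mul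
  refine ⟨U, ⟨hU, fun Ψ F hF => (h1 _ F hF).trans (.of_forall fun z => ?_)⟩, h2⟩
  exact (coeff2_pushforward D Ψ z).symm

/-- No density argument is needed: the condition speaks of arbitrary sections, and every class has
one. -/
theorem isPentagonalUnitary_unique {U U' : L2x2 G n →L[ℂ] L2x2 G n}
    (hU : IsPentagonalUnitary D U) (hU' : IsPentagonalUnitary D U') : U = U' := by
  ext1 F
  obtain ⟨Ψ, hΨ⟩ := exists_coeff2_eq (n := n) F
  have hF : F =ᵐ[(leftMeasure n G).prod (leftMeasure n G)] coeff2 Ψ := by rw [hΨ]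
  exact Lp.ext ((hU.2 Ψ F hF).trans (hU'.2 Ψ F hF).symm)

theorem isRepId_unique {om : Bidensity G k} {T T' : L2 G n →L[ℂ] L2 G n}
    (hT : IsRepId D om T) (hT' : IsRepId D om T') : T = T' := by
  refine clm_eq_of_dense (dense_contMDiff_hasCompactSupport (𝓡 n) (leftMeasure n G)) ?_
  rintro F ⟨f, hf, hfc, hF⟩
  obtain ⟨Ψ, rfl⟩ := exists_coeff_eq (n := n) f
  exact Lp.ext ((hT Ψ F ⟨hf, hfc⟩ hF).trans (hT' Ψ F ⟨hf, hfc⟩ hF).symm)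

theorem isRepDelta_unique {om : Bidensity G k} {S S' : L2x2 G n →L[ℂ] L2x2 G n}
    (hS : IsRepDelta D om S) (hS' : IsRepDelta D om S') : S = S' := by
  refine clm_eq_of_dense (dense_contMDiff_hasCompactSupport ((𝓡 n).prod (𝓡 n))
    ((leftMeasure n G).prod (leftMeasure n G))) ?_
  rintro F ⟨f, hf, hfc, hF⟩
  obtain ⟨Ψ, rfl⟩ := exists_coeff2_eq (n := n) f
  exact Lp.ext ((hS Ψ F ⟨hf, hfc⟩ hF).trans (hS' Ψ F ⟨hf, hfc⟩ hF).symm)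

theorem isTensorOne_unique {T : L2 G n →L[ℂ] L2 G n} {R R' : L2x2 G n →L[ℂ] L2x2 G n}
    (hR : IsTensorOne T R) (hR' : IsTensorOne T R') : R = R' :=
  clm_eq_of_eq_on_prod fun φ ψ F hF => Lp.ext ((hR φ ψ F hF).trans (hR' φ ψ F hF).symm)

section Operators

variable {D} {om : Bidensity G k}

/-- The two bounds of Schur's test: `b ↦ a_L(z) b` is a section of `b_R`, and after `shear⁻¹` the
argument becomes `b a_L(z)`, a section of `b_L`. -/
theorem Bidensity.IsTest.exists_lintegral_le (hom : om.IsTest D) : ∃ C₁ C₂ : NNReal,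
    (∀ z : G, ∫⁻ b : B, ‖om.coeff D (D.aL z * b)‖ₑ ∂(leftMeasure k B) ≤ C₁) ∧
    ∀ z : G, ∫⁻ b : B, ‖om.coeff D (D.aL (D.shear.symm (b, z)).2 * (D.shear.symm (b, z)).1)‖ₑ
      ∂(leftMeasure k B) ≤ C₂ := by
  obtain ⟨C₁, h₁⟩ := exists_lintegral_section_le (β := leftMeasure k B) D.contMDiff_bR.continuous
    hom.1.continuous hom.2
  obtain ⟨C₂, h₂⟩ := exists_lintegral_section_le (β := leftMeasure k B) D.contMDiff_bL.continuous
    hom.1.continuous hom.2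
  refine ⟨C₁, C₂, fun z => h₁ _ fun b => D.bR_mul _ _, fun z => h₂ _ fun b => ?_⟩
  have h : D.aL (b * z) = D.aL (b * D.aL z) := by
    rw [← D.aL_mul_of_mem (b * D.aL z) (D.bR z), mul_assoc, D.aL_mul_bR]
  change D.bL (D.aL (b * z) * D.bR (b * D.aL z)) = b
  rw [h, D.aL_mul_bR, D.bL_mul]

theorem Bidensity.IsTest.measurable_coeff_fibre (hom : om.IsTest D) :
    Measurable fun q : B × G => om.coeff D (D.aL q.2 * q.1) := by
  have h : Continuous fun q : B × G => (D.aL q.2 : G) * q.1 :=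
    ((D.contMDiff_coe_aL.comp contMDiff_snd).mul
      (D.smooth_right.comp contMDiff_fst) : ContMDiff ((𝓡 k).prod (𝓡 n)) (𝓡 n) ∞ _).continuous
  exact (hom.1.continuous.comp h).measurable

theorem Bidensity.IsTest.exists_operator (hom : om.IsTest D) : ∃ T : L2 G n →L[ℂ] L2 G n,
    ∀ (f : G → ℂ) (F : L2 G n), F =ᵐ[leftMeasure n G] f → T F =ᵐ[leftMeasure n G] fun z =>
      ∫ b : B, ((Real.sqrt (jac ((𝓡 k).prod (𝓡 n)) D.shear (b, z)) : ℝ) : ℂ) *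
        om.coeff D (D.aL z * b) * f (D.shear (b, z)).2 ∂(leftMeasure k B) := by
  obtain ⟨C₁, C₂, h₁, h₂⟩ := hom.exists_lintegral_le
  exact exists_schurOperator hom.measurable_coeff_fibre
    (continuous_jac D.contMDiff_shear).measurable (fun _ => jac_nonneg _ _)
    D.shearHomeomorph.toMeasurableEquiv (fun g => D.lintegral_shear) C₁ C₂ h₁ h₂

theorem Bidensity.IsTest.exists_operator_prod (hom : om.IsTest D) : ∃ R : L2x2 G n →L[ℂ] L2x2 G n,
    ∀ (f : G × G → ℂ) (F : L2x2 G n), F =ᵐ[(leftMeasure n G).prod (leftMeasure n G)] f →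
      R F =ᵐ[(leftMeasure n G).prod (leftMeasure n G)] fun z =>
      ∫ b : B, ((Real.sqrt (jac ((𝓡 k).prod (𝓡 n)) D.shear (b, z.1)) : ℝ) : ℂ) *
        om.coeff D (D.aL z.1 * b) * f (extendRight D.shear (b, z)).2 ∂(leftMeasure k B) := by
  obtain ⟨C₁, C₂, h₁, h₂⟩ := hom.exists_lintegral_le
  have hm : Measurable fun q : B × (G × G) => (q.1, q.2.1) := by fun_prop
  exact exists_schurOperator (c := fun q : B × (G × G) => om.coeff D (D.aL q.2.1 * q.1))
    (hom.measurable_coeff_fibre.comp hm)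
    ((continuous_jac D.contMDiff_shear).measurable.comp hm) (fun _ => jac_nonneg _ _)
    D.shearRightHomeomorph.toMeasurableEquiv (fun g => D.lintegral_shearRight) C₁ C₂
    (fun z => h₁ z.1) (fun z => h₂ z.1)

end Operators

/-- The operators of a test bidensity exist, and are related by the pentagonal unitary. -/
theorem Bidensity.IsTest.exists_rep {D : DoubleLieGroup n p k A B} {om : Bidensity G k}
    (hom : om.IsTest D) {W : L2x2 G n →L[ℂ] L2x2 G n} (hW : IsPentagonalUnitary D W) :
    ∃ (T : L2 G n →L[ℂ] L2 G n) (R : L2x2 G n →L[ℂ] L2x2 G n), IsRepId D om T ∧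
      IsTensorOne T R ∧ IsRepDelta D om (W * R * star W) := by
  obtain ⟨T, hT⟩ := hom.exists_operator
  obtain ⟨R, hR⟩ := hom.exists_operator_prod
  obtain ⟨U, hU, hstar⟩ := exists_pentagonalUnitary D
  obtain rfl := isPentagonalUnitary_unique D hW hU
  refine ⟨T, R, fun Ψ F _ hF => (hT _ F hF).trans (.of_forall fun z => ?_),
    fun φ ψ F hF => ?_, fun Ψ F _ hF => ?_⟩
  · exact (coeff_rep_id D om Ψ z).symm
  · have h1 := hT φ φ (Filter.EventuallyEq.refl _ _)
    filter_upwards [hR _ F hF, Measure.quasiMeasurePreserving_fst.ae h1] with z h2 h3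
    rw [h2, h3, ← integral_mul_const]
    refine integral_congr_ae (.of_forall fun b => ?_)
    simp only [extendRight]
    ring
  -- This computes `R (star W F)`. Its value is realized as the coefficient of a half-density `Ψ'`,
  -- so that the defining property of `W` applies to it.
  · have h1 := hR _ _ (hstar _ F hF)
    obtain ⟨Ψ', hΨ'⟩ := exists_coeff2_eq (n := n) (fun z : G × G =>
      ∫ b : B, ((Real.sqrt (jac ((𝓡 k).prod (𝓡 n)) D.shear (b, z.1)) : ℝ) : ℂ) *
        om.coeff D (D.aL z.1 * b) *
        (((Real.sqrt (jac ((𝓡 n).prod (𝓡 n)) (pentagonal D)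
            (extendRight D.shear (b, z)).2) : ℝ) : ℂ) *
          coeff2 Ψ (pentagonal D (extendRight D.shear (b, z)).2)) ∂(leftMeasure k B))
    rw [← hΨ'] at h1
    refine (hW.2 Ψ' _ h1).trans (.of_forall fun z => ?_)
    rw [coeff2_pushforward, hΨ']
    exact (coeff2_rep_delta D om Ψ z).symm

end

end DLG

end

theorem proposition4p2 {n p k : ℕ} {G : Type*} [TopologicalSpace G] [T2Space G]
    [SecondCountableTopology G] [ChartedSpace (DLG.E n) G] [Group G] [LieGroup (𝓡 n) ∞ G]
    [MeasurableSpace G] [BorelSpace G]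
    (A B : Subgroup G)
    [ChartedSpace (DLG.E p) A] [LieGroup (𝓡 p) ∞ A]
    [ChartedSpace (DLG.E k) B] [LieGroup (𝓡 k) ∞ B]
    (D : DLG.DoubleLieGroup n p k A B) :
    (∃! W : DLG.L2x2 G n →L[ℂ] DLG.L2x2 G n, DLG.IsPentagonalUnitary D W) ∧
    ∀ om : DLG.Bidensity G k, om.IsTest D →
      (∃! T : DLG.L2 G n →L[ℂ] DLG.L2 G n, DLG.IsRepId D om T) ∧
      (∃! S : DLG.L2x2 G n →L[ℂ] DLG.L2x2 G n, DLG.IsRepDelta D om S) ∧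
      ∀ (W S : DLG.L2x2 G n →L[ℂ] DLG.L2x2 G n) (T : DLG.L2 G n →L[ℂ] DLG.L2 G n),
        DLG.IsPentagonalUnitary D W → DLG.IsRepId D om T → DLG.IsRepDelta D om S →
        (∃! R : DLG.L2x2 G n →L[ℂ] DLG.L2x2 G n, DLG.IsTensorOne T R) ∧
        ∀ R : DLG.L2x2 G n →L[ℂ] DLG.L2x2 G n, DLG.IsTensorOne T R → S = W * R * star W := by

  obtain ⟨U, hU, -⟩ := DLG.exists_pentagonalUnitary D
  refine ⟨⟨U, hU, fun U' hU' => DLG.isPentagonalUnitary_unique D hU' hU⟩, fun om hom => ?_⟩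
  obtain ⟨T, R, hT, hR, hS⟩ := hom.exists_rep hU
  refine ⟨⟨T, hT, fun T' hT' => DLG.isRepId_unique D hT' hT⟩,
    ⟨_, hS, fun S' hS' => DLG.isRepDelta_unique D hS' hS⟩, fun W S T' hW hT' hS' => ?_⟩
  -- Uniqueness replaces any operators with these properties by the constructed ones, for which the
  -- conjugation formula is already known.
  obtain rfl := DLG.isPentagonalUnitary_unique D hU hW
  obtain rfl := DLG.isRepId_unique D hT hT'
  refine ⟨⟨R, hR, fun R' hR' => DLG.isTensorOne_unique hR' hR⟩, fun R' hR' => ?_⟩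
  obtain rfl := DLG.isTensorOne_unique hR hR'
  exact DLG.isRepDelta_unique D hS' hS
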